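/- Setting. Let $A\in\mathbb{R}^{n_z\times n_z}$, $B\in\mathbb{R}^{n_z\times n_s}$, $S\in\mathbb{R}^{n_q\times n_z}$, $N\in\mathbb{R}^{n_z\times n_w}$, $C\in\mathbb{R}^{n_y\times n_z}$, $C_p\in\mathbb{R}^{n_p\times n_z}$, $L\in\mathbb{R}^{n_z\times n_y}$, $H\in\mathbb{R}^{n_y\times n_y}$, let $\psi\colon\mathbb{R}^{n_q}\to\mathbb{R}^{n_s}$ be Lipschitz with constant $\ell>0$, and let $0<T_1\le T_2$, $\lambda_t>0$, $\gamma>0$. The plant is $\dot z=Az+B\psi(Sz)+Nw$, $y=Cz+\eta$. The output $y$ is available only at sampling times $t_1<t_2<\dots$ with $0\le t_1\le T_2$ and $T_1\le t_{k+1}-t_k\le T_2$. The observer is $$\dot{\hat z}=A\hat z+B\psi(S\hat z)+L\theta,\quad \dot\theta=H\theta\quad (t\ne t_k),\qquad \hat z(t_k^+)=\hat z(t_k),\quad \theta(t_k^+)=y(t_k)-C\hat z(t_k).$$ With $\varepsilon=z-\hat z$, $\tilde\theta=C(z-\hat z)-\theta$, $\zeta(z,\varepsilon)=\psi(Sz)-\psi(S(z-\varepsilon))$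 and a timer $\tau$, let $\mathcal H_e$ be the hybrid system with state $x=(z,\varepsilon,\tilde\theta,\tau)\in\mathbb{R}^{2n_z+n_y+1}$, input $u=(w,\eta)$ and output $y_p=C_p\varepsilon$ that flows, $\dot x=f(x,w)$, when $\tau\in[0,T_2]$, with $$f(x,w)=\begin{pmatrix}Az+B\psi(Sz)+Nw\\ (A-LC)\varepsilon+L\tilde\theta+B\zeta(z,\varepsilon)+Nw\\ (CA-CLC-HC)\varepsilon+(CL+H)\tilde\theta+CB\zeta(z,\varepsilon)+CNw\\ -1\end{pmatrix},$$ and jumps when $\tau=0$, according to $x^+\in\{(z,\varepsilon,-\eta)\}\times[T_1,T_2]$. Solution pairs $(\phi,u)$ are defined on hybrid time domains in $\mathbb{R}_{\ge0}\times\mathbb{N}$: $\phi(\cdot,j)$ is locally absolutely continuous, $u(\cdot,j)$ is measurable and essentially bounded on bounded time intervals, and $\phi$ starts in and obeys the data above. Let $\mathcal A=\mathbb{R}^{n_z}\times\{0\}\times\{0\}\times[0,T_2]$, let $|x|_{\mathcal A}$ be the Euclidean distance to $\mathcal A$, and let $\|u\|_\infty$ be the larger of the essential supremum of $|u|$ over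 flow times and its supremum over jump times. Assumption. There are $C^1$ functions $V_1\colon\mathbb{R}^{n_z}\to\mathbb{R}$, $V_2\colon\mathbb{R}^{n_y+1}\to\mathbb{R}$ and positive $\alpha_1,\alpha_2,\omega_1,\omega_2$ such that, for all $x=(z,\varepsilon,\tilde\theta,\tau)$ with $\tau\in[0,T_2]$ and all $w$, $\alpha_1|\varepsilon|^2\le V_1(\varepsilon)\le\alpha_2|\varepsilon|^2$, $\omega_1|\tilde\theta|^2\le V_2(\tilde\theta,\tau)\le\omega_2|\tilde\theta|^2$, and $V(x)=V_1(\varepsilon)+V_2(\tilde\theta,\tau)$ satisfies $\langle\nabla V(x),f(x,w)\rangle\le-2\lambda_tV(x)-|C_p\varepsilon|^2+\gamma^2|w|^2$. Theorem. Under this assumption: (i) $\mathcal H_e$ is exponentially input-to-state stable with respect to $\mathcal A$: there are $\kappa,\lambda>0$ and a function $\rho$ of class $\mathcal K$ such that every solution pair $(\phi,u)$ with $\|u\|_\infty<\infty$ satisfies $|\phi(t,j)|_{\mathcal A}\le\max\{\kappa e^{-\lambda(t+j)}|\phi(0,0)|_{\mathcal A},\rho(\|u\|_\infty)\}$ for all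 $(t,j)\in\operatorname{dom}\phi$, and every maximal solution pair is complete, i.e. has an unbounded domain. (ii) There is $\alpha>0$ such that every solution pair with $\eta\equiv0$ satisfies $$\Big(\int_{\mathcal I}|y_p(s,j(s))|^2ds\Big)^{1/2}\le\alpha|\phi(0,0)|_{\mathcal A}+\gamma\Big(\int_{\mathcal I}|w(s,j(s))|^2ds\Big)^{1/2},$$ where $\mathcal I=\{s:\exists j,\ (s,j)\in\operatorname{dom}\phi\}$ and $j(s)=\min\{j:(s,j)\in\operatorname{dom}\phi\}$. (iii) The observer solves the estimation problem for the plant interconnected with it, uniformly over all sampling sequences as above. For all initial states, every measurable locally essentially bounded $w$ and every $\eta$, a trajectory $(z,\hat z,\theta)$ on $[0,\infty)$ exists. Writing $d(t)$ for the distance of $(z,\hat z,\theta)(t)$ to the set $\{z=\hat z,\ \theta=0\}$ (equivalently $\varepsilon=0$, $\tilde\theta=0$): (P1) if $w\equiv0$ and $\eta\equiv0$, then $d(t)\le\kappa e^{-\lambda_tt}d(0)$ for all $t\ge0$, with a constant $\kappa$ independent of the trajectory; (P2) $z-\hat z$ is bounded when $w$ and $\eta$ are bounded, with a bound that depends only on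 bounds on $w$, $\eta$ and $d(0)$; (P3) if $\eta\equiv0$, then $\|C_p(z-\hat z)\|_{L^2(0,\infty)}\le\alpha\,d(0)+\gamma\|w\|_{L^2(0,\infty)}$, with a constant $\alpha>0$ independent of the trajectory. -/

import Mathlib

open Set Filter Topology MeasureTheory
open scoped ENNReal NNReal

noncomputable section

/-! ### Hybrid time domains, hybrid signals, hybrid systems -/

/-- `ℝⁿ` with the Euclidean norm. -/
abbrev Eu (n : ℕ) : Type := EuclideanSpace ℝ (Fin n)

/-- The action `M v` of a real matrix on a Euclidean vector. -/
abbrev mulE {m n : ℕ} (M : Matrix (Fin m) (Fin n) ℝ) (v : Eu n) : Eu m :=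
  Matrix.toEuclideanLin M v

/-- Hybrid time domains: a union of finitely or infinitely many intervals `[t_j, t_{j+1}] × {j}`
with `0 = t_0 ≤ t_1 ≤ …`; if there are finitely many, the last one may also be of the form
`[t_J, T) × {J}` with `t_J < T ≤ ∞`. -/
def IsHybridTimeDomain (E : Set (ℝ × ℕ)) : Prop :=
  ∃ t : ℕ → ℝ, t 0 = 0 ∧ Monotone t ∧
    (E = {p | p.1 ∈ Icc (t p.2) (t (p.2 + 1))} ∨
      ∃ (J : ℕ) (I : Set ℝ),
        (I = Icc (t J) (t (J + 1)) ∨ (t J < t (J + 1) ∧ I = Ico (t J) (t (J + 1))) ∨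
          I = Ici (t J)) ∧
        E = {p | (p.2 < J ∧ p.1 ∈ Icc (t p.2) (t (p.2 + 1))) ∨ (p.2 = J ∧ p.1 ∈ I)})

/-- The set of ordinary times `t` with `(t, j) ∈ E`. -/
def slice (E : Set (ℝ × ℕ)) (j : ℕ) : Set ℝ := {t | (t, j) ∈ E}

/-- `dom_t`: the projection of a hybrid time domain onto ordinary time. -/
def domT (E : Set (ℝ × ℕ)) : Set ℝ := {t | ∃ j, (t, j) ∈ E}

/-- `j(t) = min {j : (t, j) ∈ E}`. -/
def jmin (E : Set (ℝ × ℕ)) (t : ℝ) : ℕ := sInf {j | (t, j) ∈ E}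

/-- `Γ`: the hybrid times at which a jump occurs. -/
def jumpTimes (E : Set (ℝ × ℕ)) : Set (ℝ × ℕ) := {p | p ∈ E ∧ (p.1, p.2 + 1) ∈ E}

/-- Hybrid inputs on `E`: each `u(·, j)` is measurable and locally essentially bounded, that is,
essentially bounded on bounded time intervals (no blow-up in finite time). -/
def IsHybridInput {U : Type*} [NormedAddCommGroup U] (E : Set (ℝ × ℕ)) (u : ℝ → ℕ → U) : Prop :=
  ∀ j, AEStronglyMeasurable (fun s => u s j) (volume.restrict (slice E j)) ∧
    ∀ T : ℝ, ∃ M : ℝ, ∀ᵐ s ∂(volume.restrict (slice E j ∩ Iic T)), ‖u s j‖ ≤ M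

/-- Hybrid arcs on `E`: each `φ(·, j)` is locally absolutely continuous. -/
def IsHybridArc {X : Type*} [PseudoMetricSpace X] (E : Set (ℝ × ℕ)) (φ : ℝ → ℕ → X) : Prop :=
  ∀ (j : ℕ) (a b : ℝ), a ≤ b → Icc a b ⊆ slice E j →
    AbsolutelyContinuousOnInterval (fun s => φ s j) a b

/-- The `T`-truncated `L∞` norm of a hybrid signal: the larger of the essential supremum over
the non-jump times and the supremum over the jump times `(s, k)` with `s + k ≤ T`. -/
def linfTrunc {U : Type*} [NormedAddCommGroup U] (E : Set (ℝ × ℕ)) (u : ℝ → ℕ → U) (T : ℝ) :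
    ℝ≥0∞ :=
  max
    (⨆ k : ℕ, essSup (fun s => ‖u s k‖ₑ)
      (volume.restrict {s | (s, k) ∈ E \ jumpTimes E ∧ s + k ≤ T}))
    (⨆ p ∈ {p : ℝ × ℕ | p ∈ jumpTimes E ∧ p.1 + p.2 ≤ T}, ‖u p.1 p.2‖ₑ)

/-- The `L∞` norm of a hybrid signal, the limit (equivalently, by monotonicity, the supremum) of
the truncated norms. -/
def linfNorm {U : Type*} [NormedAddCommGroup U] (E : Set (ℝ × ℕ)) (u : ℝ → ℕ → U) : ℝ≥0∞ :=
  ⨆ T : ℝ, linfTrunc E u T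

/-- A hybrid system `ẋ = f(x, w)` for `x ∈ C`, `x⁺ ∈ G(x, η)` for `x ∈ D`. -/
structure HybridSystem (X W Y : Type*) where
  flowMap : X → W → X
  flowSet : Set X
  jumpMap : X → Y → Set X
  jumpSet : Set X

namespace HybridSystem

variable {X W Y : Type*} [NormedAddCommGroup X] [NormedSpace ℝ X]
  [NormedAddCommGroup W] [NormedAddCommGroup Y]

/-- `(φ, u)`, `u = (w, η)`, is a solution pair with hybrid time domain `E`. -/
structure IsSolutionPair (S : HybridSystem X W Y) (E : Set (ℝ × ℕ))
    (φ : ℝ → ℕ → X) (u : ℝ → ℕ → WithLp 2 (W × Y)) : Prop where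
  dom : IsHybridTimeDomain E
  arc : IsHybridArc E φ
  input : IsHybridInput E u
  init : φ 0 0 ∈ S.flowSet ∪ S.jumpSet
  flow_mem : ∀ j, ∀ t ∈ interior (slice E j), φ t j ∈ S.flowSet
  flow : ∀ j, ∀ᵐ t ∂(volume.restrict (slice E j)),
    HasDerivAt (fun s => φ s j) (S.flowMap (φ t j) (u t j).fst) t
  jump : ∀ t j, (t, j) ∈ jumpTimes E →
    φ t j ∈ S.jumpSet ∧ φ t (j + 1) ∈ S.jumpMap (φ t j) (u t j).snd

/-- A solution pair is maximal if it is not a proper restriction of another solution pair. -/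
def IsMaximalPair (S : HybridSystem X W Y) (E : Set (ℝ × ℕ))
    (φ : ℝ → ℕ → X) (u : ℝ → ℕ → WithLp 2 (W × Y)) : Prop :=
  S.IsSolutionPair E φ u ∧
    ∀ E' φ' u', S.IsSolutionPair E' φ' u' → E ⊆ E' →
      (∀ t j, (t, j) ∈ E → φ' t j = φ t j ∧ u' t j = u t j) → E' = E

/-- Completeness: the hybrid time domain is unbounded. -/
def IsCompleteDom (E : Set (ℝ × ℕ)) : Prop := ∀ M : ℝ, ∃ p ∈ E, M < p.1 + p.2

/-- Pre-exponential input-to-state stability with respect to `A`; `ρ` is of class `𝒦`. -/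
def IsPreEISS (S : HybridSystem X W Y) (A : Set X) : Prop :=
  ∃ (κ lam : ℝ) (ρ : ℝ≥0 → ℝ≥0), 0 < κ ∧ 0 < lam ∧ Continuous ρ ∧ StrictMono ρ ∧ ρ 0 = 0 ∧
    ∀ E φ u, S.IsSolutionPair E φ u → linfNorm E u < ∞ →
      ∀ t j, (t, j) ∈ E →
        Metric.infDist (φ t j) A ≤
          max (κ * Real.exp (-lam * (t + j)) * Metric.infDist (φ 0 0) A)
            (ρ (linfNorm E u).toNNReal)

/-- Exponential input-to-state stability with respect to `A`: the pre-eISS estimate, and every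
maximal solution pair is complete. -/
def IsEISS (S : HybridSystem X W Y) (A : Set X) : Prop :=
  S.IsPreEISS A ∧ ∀ E φ u, S.IsMaximalPair E φ u → IsCompleteDom E

end HybridSystem

/-! ### The plant, the observer and the hybrid error system -/

/-- Data of the plant `ż = A z + B ψ(S z) + N w`, `y = C z + η`, with performance output
`y_p = C_p (z - ẑ)`. -/
structure Plant (nz nw ny ns nq np : ℕ) where
  A : Matrix (Fin nz) (Fin nz) ℝ
  B : Matrix (Fin nz) (Fin ns) ℝ
  S : Matrix (Fin nq) (Fin nz) ℝ
  N : Matrix (Fin nz) (Fin nw) ℝ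
  C : Matrix (Fin ny) (Fin nz) ℝ
  Cp : Matrix (Fin np) (Fin nz) ℝ
  ψ : Eu nq → Eu ns

/-- The state `x = (z, ε, θ̃, τ)`, with the Euclidean norm of `ℝ^(2 n_z + n_y + 1)`. -/
abbrev ErrState (nz ny : ℕ) : Type :=
  WithLp 2 (Eu nz × WithLp 2 (Eu nz × WithLp 2 (Eu ny × ℝ)))

namespace ErrState

variable {nz ny : ℕ}

/-- The point `(z, ε, θ̃, τ)`. -/
def mk (z ε : Eu nz) (θ : Eu ny) (τ : ℝ) : ErrState nz ny :=
  WithLp.toLp 2 (z, WithLp.toLp 2 (ε, WithLp.toLp 2 (θ, τ)))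

/-- The component `z`. -/
def z (x : ErrState nz ny) : Eu nz := x.fst

/-- The component `ε`. -/
def ε (x : ErrState nz ny) : Eu nz := x.snd.fst

/-- The component `θ̃`. -/
def θ (x : ErrState nz ny) : Eu ny := x.snd.snd.fst

/-- The component `τ`. -/
def τ (x : ErrState nz ny) : ℝ := x.snd.snd.snd

end ErrState

namespace Plant

variable {nz nw ny ns nq np : ℕ}

/-- `ζ(v₁, v₂) = ψ(S v₁) - ψ(S (v₁ - v₂))`. -/
def ζ (P : Plant nz nw ny ns nq np) (v₁ v₂ : Eu nz) : Eu ns :=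
  P.ψ (mulE P.S v₁) - P.ψ (mulE P.S (v₁ - v₂))

/-- The flow map of the hybrid error system: the blocks of `ℱ (ε, θ̃) + 𝒬 ζ(z, ε) + 𝒯 w` are
written out. -/
def errFlow (P : Plant nz nw ny ns nq np) (L : Matrix (Fin nz) (Fin ny) ℝ)
    (H : Matrix (Fin ny) (Fin ny) ℝ) (x : ErrState nz ny) (w : Eu nw) : ErrState nz ny :=
  ErrState.mk
    (mulE P.A x.z + mulE P.B (P.ψ (mulE P.S x.z)) + mulE P.N w)
    (mulE (P.A - L * P.C) x.ε + mulE L x.θ + mulE P.B (P.ζ x.z x.ε) + mulE P.N w)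
    (mulE (P.C * P.A - P.C * L * P.C - H * P.C) x.ε + mulE (P.C * L + H) x.θ
      + mulE (P.C * P.B) (P.ζ x.z x.ε) + mulE (P.C * P.N) w)
    (-1)

/-- The hybrid error system `ℋ_e`. -/
def errSystem (P : Plant nz nw ny ns nq np) (L : Matrix (Fin nz) (Fin ny) ℝ)
    (H : Matrix (Fin ny) (Fin ny) ℝ) (T₁ T₂ : ℝ) :
    HybridSystem (ErrState nz ny) (Eu nw) (Eu ny) where
  flowMap := P.errFlow L H
  flowSet := {x | x.τ ∈ Icc 0 T₂}
  jumpMap x η := {g | ∃ v ∈ Icc T₁ T₂, g = ErrState.mk x.z x.ε (-η) v}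
  jumpSet := {x | x.τ = 0}

/-- The set `𝒜 = ℝ^{n_z} × {0} × {0} × [0, T₂]`. -/
def errSet (nz ny : ℕ) (T₂ : ℝ) : Set (ErrState nz ny) :=
  {x | x.ε = 0 ∧ x.θ = 0 ∧ x.τ ∈ Icc 0 T₂}

/-- The function `V(x) = V₁(ε) + V₂(θ̃, τ)`. -/
def lyap (V₁ : Eu nz → ℝ) (V₂ : Eu ny × ℝ → ℝ) (x : ErrState nz ny) : ℝ :=
  V₁ x.ε + V₂ (x.θ, x.τ)

/-- The Lyapunov-type assumption with decay rate `lt` (that is, `λ_t`) and gain `γ`. Here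
`⟨∇V(x), v⟩` is the derivative of `V` at `x` in the direction `v`. -/
def DissipationAssumption (P : Plant nz nw ny ns nq np) (L : Matrix (Fin nz) (Fin ny) ℝ)
    (H : Matrix (Fin ny) (Fin ny) ℝ) (T₂ lt γ : ℝ) : Prop :=
  ∃ (V₁ : Eu nz → ℝ) (V₂ : Eu ny × ℝ → ℝ) (α₁ α₂ ω₁ ω₂ : ℝ),
    ContDiff ℝ 1 V₁ ∧ ContDiff ℝ 1 V₂ ∧ 0 < α₁ ∧ 0 < α₂ ∧ 0 < ω₁ ∧ 0 < ω₂ ∧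
    (∀ ε, α₁ * ‖ε‖ ^ 2 ≤ V₁ ε ∧ V₁ ε ≤ α₂ * ‖ε‖ ^ 2) ∧
    (∀ θ, ∀ τ ∈ Icc 0 T₂, ω₁ * ‖θ‖ ^ 2 ≤ V₂ (θ, τ) ∧ V₂ (θ, τ) ≤ ω₂ * ‖θ‖ ^ 2) ∧
    (∀ x : ErrState nz ny, x.τ ∈ Icc 0 T₂ → ∀ w : Eu nw,
      fderiv ℝ (lyap V₁ V₂) x (P.errFlow L H x w) ≤
        -2 * lt * lyap V₁ V₂ x - ‖mulE P.Cp x.ε‖ ^ 2 + γ ^ 2 * ‖w‖ ^ 2)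

/-! ### The plant interconnected with the observer, in ordinary time -/

/-- Sampling sequences; `t k` is the `(k+1)`-st sampling instant. -/
def IsSamplingSeq (T₁ T₂ : ℝ) (t : ℕ → ℝ) : Prop :=
  0 ≤ t 0 ∧ t 0 ≤ T₂ ∧ ∀ k, T₁ ≤ t (k + 1) - t k ∧ t (k + 1) - t k ≤ T₂

/-- Measurable, locally essentially bounded functions on `[0, ∞)`. -/
def IsLocBddInput (w : ℝ → Eu nw) : Prop :=
  AEStronglyMeasurable w (volume.restrict (Ici 0)) ∧
    ∀ T : ℝ, ∃ M : ℝ, ∀ᵐ s ∂(volume.restrict (Icc 0 T)), ‖w s‖ ≤ M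

/-- `(z, ẑ, θ)` is, on `[0, ∞)`, a trajectory of the plant with inputs `w`, `η` interconnected
with the observer
`ẑ' = A ẑ + B ψ(S ẑ) + L θ`, `θ' = H θ` off the sampling instants, and
`ẑ⁺ = ẑ`, `θ⁺ = y - C ẑ` at the sampling instants, where `y = C z + η`. At a sampling instant,
`θ` takes its value before the reset. -/
structure IsTrajectory (P : Plant nz nw ny ns nq np) (L : Matrix (Fin nz) (Fin ny) ℝ)
    (H : Matrix (Fin ny) (Fin ny) ℝ) (t : ℕ → ℝ) (w : ℝ → Eu nw) (η : ℝ → Eu ny)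
    (z zh : ℝ → Eu nz) (θ : ℝ → Eu ny) : Prop where
  plant_ac : ∀ b, 0 ≤ b → AbsolutelyContinuousOnInterval z 0 b
  plant_ode : ∀ᵐ s ∂(volume.restrict (Ici 0)),
    HasDerivAt z (mulE P.A (z s) + mulE P.B (P.ψ (mulE P.S (z s))) + mulE P.N (w s)) s
  est_cont : ContinuousOn zh (Ici 0)
  est_ode : ∀ s, 0 < s → s ∉ range t →
    HasDerivAt zh (mulE P.A (zh s) + mulE P.B (P.ψ (mulE P.S (zh s))) + mulE L (θ s)) s
  inj_ode : ∀ s, 0 < s → s ∉ range t → HasDerivAt θ (mulE H (θ s)) s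
  inj_zero : 0 ∉ range t → ContinuousWithinAt θ (Ici 0) 0
  inj_left : ∀ k, 0 < t k → ContinuousWithinAt θ (Iic (t k)) (t k)
  inj_reset : ∀ k, Tendsto θ (𝓝[>] (t k))
    (𝓝 (mulE P.C (z (t k)) + η (t k) - mulE P.C (zh (t k))))

/-- The state `(z, ẑ, θ)` of the interconnection, with the Euclidean norm. -/
def obsState (z zh : Eu nz) (θ : Eu ny) : WithLp 2 (Eu nz × WithLp 2 (Eu nz × Eu ny)) :=
  WithLp.toLp 2 (z, WithLp.toLp 2 (zh, θ))

/-- The target set `z = ẑ`, `θ = 0` (equivalently `ε = 0`, `θ̃ = C (z - ẑ) - θ = 0`) of the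
interconnection. -/
def targetSet (nz ny : ℕ) : Set (WithLp 2 (Eu nz × WithLp 2 (Eu nz × Eu ny))) :=
  {p | ∃ z : Eu nz, p = obsState z z 0}

/-- The observer with gains `L`, `H` solves the estimation problem with prescribed decay rate `lt`
(in ordinary time) and prescribed `L²` gain `γ`, uniformly over all sampling sequences. -/
structure SolvesEstimationProblem (P : Plant nz nw ny ns nq np)
    (L : Matrix (Fin nz) (Fin ny) ℝ) (H : Matrix (Fin ny) (Fin ny) ℝ)
    (T₁ T₂ lt γ : ℝ) : Prop where
  /-- Trajectories of the interconnection exist on `[0, ∞)`. -/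
  exist : ∀ t, IsSamplingSeq T₁ T₂ t → ∀ (w : ℝ → Eu nw) (η : ℝ → Eu ny), IsLocBddInput w →
    ∀ (z₀ zh₀ : Eu nz) (θ₀ : Eu ny), ∃ z zh θ,
      P.IsTrajectory L H t w η z zh θ ∧ z 0 = z₀ ∧ zh 0 = zh₀ ∧ θ 0 = θ₀
  /-- Global exponential stability with rate `lt` of the target set without disturbances. -/
  exp_stable : ∃ κ : ℝ, 0 < κ ∧ ∀ t, IsSamplingSeq T₁ T₂ t → ∀ z zh θ,
    P.IsTrajectory L H t (fun _ => 0) (fun _ => 0) z zh θ → ∀ s, 0 ≤ s →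
      Metric.infDist (obsState (z s) (zh s) (θ s)) (targetSet nz ny) ≤
        κ * Real.exp (-lt * s) *
          Metric.infDist (obsState (z 0) (zh 0) (θ 0)) (targetSet nz ny)
  /-- The estimation error is bounded when the disturbances are bounded. -/
  bounded : ∀ r : ℝ, ∃ M : ℝ, ∀ t, IsSamplingSeq T₁ T₂ t → ∀ (w : ℝ → Eu nw) (η : ℝ → Eu ny),
    IsLocBddInput w → (∀ᵐ s ∂(volume.restrict (Ici 0)), ‖w s‖ ≤ r) → (∀ k, ‖η (t k)‖ ≤ r) →
    ∀ z zh θ, P.IsTrajectory L H t w η z zh θ →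
      Metric.infDist (obsState (z 0) (zh 0) (θ 0)) (targetSet nz ny) ≤ r →
      ∀ s, 0 ≤ s → ‖z s - zh s‖ ≤ M
  /-- `L²` stability from `w` to the performance output, with gain `γ`, when `η ≡ 0`. -/
  l2_gain : ∃ α : ℝ, 0 < α ∧ ∀ t, IsSamplingSeq T₁ T₂ t → ∀ w : ℝ → Eu nw, IsLocBddInput w →
    ∀ z zh θ, P.IsTrajectory L H t w (fun _ => 0) z zh θ →
      (∫⁻ s in Ici 0, ‖mulE P.Cp (z s - zh s)‖ₑ ^ 2) ^ (1 / 2 : ℝ) ≤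
        ENNReal.ofReal
            (α * Metric.infDist (obsState (z 0) (zh 0) (θ 0)) (targetSet nz ny)) +
          ENNReal.ofReal γ * (∫⁻ s in Ici 0, ‖w s‖ₑ ^ 2) ^ (1 / 2 : ℝ)

end Plant

end

/-! On the flow set `V` is comparable with `|ε|² + |θ̃|²`, the squared distance to `𝒜`. Along flows
it decays at the rate `2 λ_t` up to the supply `γ² |w|²`, while a jump resets `θ̃` to `-η` and thus
raises `V` by at most `ω₂ |η|²`. As consecutive jumps are at least `T₁` apart, these increments sum
up to a geometric series, which bounds `V` at hybrid time `(t, j)` in terms of `t`; since `t` is at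
least `T₁ (j - 1)`, decay in `t` is decay in `t + j`. If `η = 0`, then `V` does not increase at
jumps, and integrating the dissipation inequality gives the `L²` gain.

A maximal solution pair with bounded domain would live up to some final time on its last slice.
There the arc has a limit, because its vector field grows at most linearly, and from this limit the
pair could be continued by a jump, if the timer has run out, or else by a flow.

A trajectory of the interconnection becomes a solution pair once the time that is left until the
next sample is taken for the timer, so that the hybrid estimates apply to it. Trajectories exist
because the plant and the observer have global flows between samples, which are glued together at
the sampling times. -/

/-! ### Absolutely continuous curves -/

section AbsolutelyContinuous

variable {X Y : Type*} [PseudoMetricSpace X] [PseudoMetricSpace Y] {φ : ℝ → X} {a b : ℝ}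

theorem absolutelyContinuousOnInterval_comp_of_lipschitzOnWith {K : ℝ≥0} {f : X → Y} {s : Set X}
    (hf : LipschitzOnWith K f s) (hφ : AbsolutelyContinuousOnInterval φ a b)
    (hs : MapsTo φ (uIcc a b) s) : AbsolutelyContinuousOnInterval (fun x => f (φ x)) a b := by
  rw [absolutelyContinuousOnInterval_iff] at hφ ⊢
  intro ε hε
  obtain ⟨δ, hδ, hE⟩ := hφ (ε / (K + 1)) (by positivity)
  refine ⟨δ, hδ, fun E hmem hlt => ?_⟩
  calc ∑ i ∈ Finset.range E.1, dist (f (φ (E.2 i).1)) (f (φ (E.2 i).2))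
      ≤ ∑ i ∈ Finset.range E.1, K * dist (φ (E.2 i).1) (φ (E.2 i).2) :=
        Finset.sum_le_sum fun i hi =>
          hf.dist_le_mul _ (hs (hmem.1 i hi).1) _ (hs (hmem.1 i hi).2)
    _ = K * ∑ i ∈ Finset.range E.1, dist (φ (E.2 i).1) (φ (E.2 i).2) := by rw [Finset.mul_sum]
    _ ≤ (K + 1) * ∑ i ∈ Finset.range E.1, dist (φ (E.2 i).1) (φ (E.2 i).2) := by
        gcongr
        exact le_add_of_nonneg_right zero_le_one
    _ < (K + 1) * (ε / (K + 1)) := by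
        gcongr
        exact hE E hmem hlt
    _ = ε := by field_simp

theorem absolutelyContinuousOnInterval_comp_of_lipschitzWith {K : ℝ≥0} {f : X → Y}
    (hf : LipschitzWith K f) (hφ : AbsolutelyContinuousOnInterval φ a b) :
    AbsolutelyContinuousOnInterval (fun x => f (φ x)) a b :=
  absolutelyContinuousOnInterval_comp_of_lipschitzOnWith (s := univ) hf.lipschitzOnWith hφ
    (mapsTo_univ _ _)

theorem absolutelyContinuousOnInterval_congr {ψ : ℝ → X}
    (hφ : AbsolutelyContinuousOnInterval φ a b) (h : EqOn φ ψ (uIcc a b)) :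
    AbsolutelyContinuousOnInterval ψ a b := by
  rw [absolutelyContinuousOnInterval_iff] at hφ ⊢
  intro ε hε
  obtain ⟨δ, hδ, hE⟩ := hφ ε hε
  refine ⟨δ, hδ, fun E hmem hlt => ?_⟩
  have hdist := hE E hmem hlt
  rwa [Finset.sum_congr rfl fun i hi => by rw [h (hmem.1 i hi).1, h (hmem.1 i hi).2]] at hdist

end AbsolutelyContinuous

theorem absolutelyContinuousOnInterval_comp_of_contDiff {E F : Type*} [NormedAddCommGroup E]
    [NormedSpace ℝ E] [FiniteDimensional ℝ E] [NormedAddCommGroup F] [NormedSpace ℝ F]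
    {f : E → F} (hf : ContDiff ℝ 1 f) {φ : ℝ → E} {a b : ℝ}
    (hφ : AbsolutelyContinuousOnInterval φ a b) :
    AbsolutelyContinuousOnInterval (fun x => f (φ x)) a b := by
  obtain ⟨C, hC⟩ := hφ.exists_bound
  have : ProperSpace E := FiniteDimensional.proper ℝ E
  obtain ⟨K, hK⟩ := hf.contDiffOn.exists_lipschitzOnWith (s := Metric.closedBall (0 : E) C)
    one_ne_zero (convex_closedBall _ _) (isCompact_closedBall _ _)
  exact absolutelyContinuousOnInterval_comp_of_lipschitzOnWith hK hφ
    fun x hx => mem_closedBall_zero_iff.2 (hC x hx)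

theorem sub_le_integral_of_ae_hasDerivAt_le {g h : ℝ → ℝ} {a b : ℝ} (hab : a ≤ b)
    (hg : AbsolutelyContinuousOnInterval g a b)
    (hd : ∀ᵐ x ∂(volume.restrict (Icc a b)), ∃ d, HasDerivAt g d x ∧ d ≤ h x)
    (hh : IntervalIntegrable h volume a b) : g b - g a ≤ ∫ x in a..b, h x := by
  rw [← hg.integral_deriv_eq_sub]
  refine intervalIntegral.integral_mono_ae_restrict hab hg.intervalIntegrable_deriv hh ?_
  filter_upwards [hd] with x ⟨d, hgd, hle⟩
  rwa [hgd.deriv]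

theorem exp_neg_mul_mul_add_div_le_of_ae_hasDerivAt_le {v : ℝ → ℝ} {a b c k : ℝ} (hab : a ≤ b)
    (hc : c ≠ 0) (hv : AbsolutelyContinuousOnInterval v a b)
    (hd : ∀ᵐ x ∂(volume.restrict (Icc a b)), ∃ d, HasDerivAt v d x ∧ d ≤ c * v x + k) :
    Real.exp (-c * b) * (v b + k / c) ≤ Real.exp (-c * a) * (v a + k / c) := by
  have hexp : AbsolutelyContinuousOnInterval (fun x => Real.exp (-c * x)) a b :=
    ContDiffOn.absolutelyContinuousOnInterval (by fun_prop)
  have hconst : AbsolutelyContinuousOnInterval (fun _ : ℝ => k / c) a b :=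
    contDiff_const.contDiffOn.absolutelyContinuousOnInterval
  have hle := sub_le_integral_of_ae_hasDerivAt_le (h := fun _ => 0) hab
    (hexp.fun_mul (hv.fun_add hconst)) ?_ (by simp)
  · simpa only [intervalIntegral.integral_zero, sub_nonpos] using hle
  · filter_upwards [hd] with x ⟨d, hvd, hle⟩
    have hexp' : HasDerivAt (fun x => Real.exp (-c * x)) (Real.exp (-c * x) * (-c)) x := by
      simpa using ((hasDerivAt_id x).const_mul (-c)).exp
    refine ⟨_, hexp'.mul (hvd.add_const (k / c)), ?_⟩
    calc Real.exp (-c * x) * -c * (v x + k / c) + Real.exp (-c * x) * d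
        = Real.exp (-c * x) * (d - (c * v x + k)) := by field_simp; ring
      _ ≤ 0 := mul_nonpos_of_nonneg_of_nonpos (Real.exp_nonneg _) (sub_nonpos.2 hle)

theorem add_div_le_exp_mul_of_ae_hasDerivAt_le {v : ℝ → ℝ} {a b c k : ℝ} (hab : a ≤ b)
    (hc : c ≠ 0) (hv : AbsolutelyContinuousOnInterval v a b)
    (hd : ∀ᵐ x ∂(volume.restrict (Icc a b)), ∃ d, HasDerivAt v d x ∧ d ≤ c * v x + k) :
    v b + k / c ≤ Real.exp (c * (b - a)) * (v a + k / c) := by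
  calc v b + k / c = Real.exp (c * b) * (Real.exp (-c * b) * (v b + k / c)) := by
        rw [← mul_assoc, ← Real.exp_add, neg_mul, add_neg_cancel, Real.exp_zero, one_mul]
    _ ≤ Real.exp (c * b) * (Real.exp (-c * a) * (v a + k / c)) := by
        gcongr ?_ * ?_
        exact exp_neg_mul_mul_add_div_le_of_ae_hasDerivAt_le hab hc hv hd
    _ = Real.exp (c * (b - a)) * (v a + k / c) := by
        rw [← mul_assoc, ← Real.exp_add, show c * b + -c * a = c * (b - a) by ring]

theorem norm_sub_le_of_ae_hasDerivAt_le {E : Type*} [NormedAddCommGroup E] [NormedSpace ℝ E]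
    {φ : ℝ → E} {a b M : ℝ} (hab : a ≤ b) (hφ : AbsolutelyContinuousOnInterval φ a b)
    (hd : ∀ᵐ x ∂(volume.restrict (Icc a b)), ∃ d, HasDerivAt φ d x ∧ ‖d‖ ≤ M) :
    ‖φ b - φ a‖ ≤ M * (b - a) := by
  obtain ⟨g, hg, hgφ⟩ := exists_dual_vector'' ℝ (φ b - φ a)
  have hle : g (φ b) - g (φ a) ≤ ∫ _ in a..b, M := by
    refine sub_le_integral_of_ae_hasDerivAt_le hab
      (absolutelyContinuousOnInterval_comp_of_lipschitzWith g.lipschitz hφ) ?_ (by simp)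
    filter_upwards [hd] with x ⟨d, hφd, hdM⟩
    refine ⟨g d, g.hasFDerivAt.comp_hasDerivAt x hφd, ?_⟩
    calc g d ≤ ‖g d‖ := le_abs_self _
      _ ≤ 1 * ‖d‖ := g.le_of_opNorm_le hg d
      _ ≤ M := (one_mul _).trans_le hdM
  calc ‖φ b - φ a‖ = g (φ b) - g (φ a) := by rw [← map_sub, hgφ, RCLike.ofReal_real_eq_id, id]
    _ ≤ ∫ _ in a..b, M := hle
    _ = M * (b - a) := by rw [intervalIntegral.integral_const, smul_eq_mul, mul_comm]

/-! ### Global solutions of Lipschitz differential equations -/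

section GlobalODE

variable {E : Type*} [NormedAddCommGroup E] [NormedSpace ℝ E] {f : ℝ → E → E} {K : ℝ≥0}

theorem exists_hasDerivWithinAt_Icc_of_lipschitzWith [CompleteSpace E]
    (hf : ∀ t, LipschitzWith K (f t)) (hc : ∀ x, Continuous fun t => f t x) (s : ℝ) (x₀ : E) :
    ∃ α : ℝ → E, α s = x₀ ∧ ∀ t ∈ Icc s (s + 1 / (2 * (K + 1))),
      HasDerivWithinAt α (f t (α t)) (Icc s (s + 1 / (2 * (K + 1)))) t := by
  set h : ℝ := 1 / (2 * (K + 1)) with hh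
  have hpos : 0 < h := by positivity
  obtain ⟨M, hM⟩ := isCompact_Icc.exists_bound_of_continuousOn (s := Icc s (s + h))
    (hc x₀).continuousOn
  have hM0 : 0 ≤ M := (norm_nonneg _).trans (hM s ⟨le_rfl, by linarith⟩)
  lift M to ℝ≥0 using hM0
  -- On the ball of radius `M` the speed is at most `M + K M`, and `(M + K M) h = M / 2`.
  have hpl : IsPicardLindelof f (tmin := s) (tmax := s + h) ⟨s, le_rfl, by linarith⟩ x₀ M 0
      (M + K * M) K := by
    refine ⟨fun t _ => (hf t).lipschitzOnWith, fun x _ => (hc x).continuousOn, fun t ht x hx => ?_,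
      ?_⟩
    · have hx' : ‖x - x₀‖ ≤ M := mem_closedBall_iff_norm.1 hx
      calc ‖f t x‖ ≤ ‖f t x₀‖ + ‖f t x - f t x₀‖ := norm_le_norm_add_norm_sub' _ _
        _ ≤ M + K * M := by
          gcongr
          · exact hM t ht
          · exact ((hf t).norm_sub_le x x₀).trans (by gcongr)
    · have hmax : max (s + h - s) (s - s) = h := by simp [hpos.le]
      have hKh : (M + K * M) * h = M / 2 := by rw [hh]; field_simp; ring
      push_cast
      rw [hmax, hKh, sub_zero]
      exact half_le_self M.2
  exact hpl.exists_eq_forall_mem_Icc_hasDerivWithinAt₀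

theorem eq_of_hasDerivWithinAt_Icc_of_lipschitzWith
    (hf : ∀ t, LipschitzWith K (f t)) {α β : ℝ → E} {a b c : ℝ} (h0 : α a = β a)
    (hα : ∀ t ∈ Icc a b, HasDerivWithinAt α (f t (α t)) (Icc a b) t)
    (hβ : ∀ t ∈ Icc a c, HasDerivWithinAt β (f t (β t)) (Icc a c) t) {t : ℝ} (ha : a ≤ t)
    (hb : t ≤ b) (hc : t ≤ c) : α t = β t := by
  have forward : ∀ {γ : ℝ → E} {d : ℝ}, t ≤ d →
      (∀ t ∈ Icc a d, HasDerivWithinAt γ (f t (γ t)) (Icc a d) t) →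
      ContinuousOn γ (Icc a t) ∧ ∀ s ∈ Ico a t, HasDerivWithinAt γ (f s (γ s)) (Ici s) s := by
    intro γ d hd hγ
    refine ⟨fun s hs => ((hγ s ⟨hs.1, hs.2.trans hd⟩).continuousWithinAt).mono
      (Icc_subset_Icc_right hd), fun s hs =>
      (hγ s ⟨hs.1, hs.2.le.trans hd⟩).mono_of_mem_nhdsWithin ?_⟩
    exact mem_of_superset (Icc_mem_nhdsGE (hs.2.trans_le hd)) (Icc_subset_Icc_left hs.1)
  obtain ⟨hαc, hαd⟩ := forward hb hα
  obtain ⟨hβc, hβd⟩ := forward hc hβ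
  exact ODE_solution_unique hf hαc hαd hβc hβd h0 ⟨ha, le_rfl⟩

theorem exists_hasDerivWithinAt_Icc_of_Icc_of_Icc {α β : ℝ → E} {a b c : ℝ}
    (hab : a ≤ b) (hbc : b ≤ c)
    (hα : ∀ t ∈ Icc a b, HasDerivWithinAt α (f t (α t)) (Icc a b) t)
    (hβ : ∀ t ∈ Icc b c, HasDerivWithinAt β (f t (β t)) (Icc b c) t) (hαβ : β b = α b) :
    ∃ γ : ℝ → E, γ a = α a ∧
      ∀ t ∈ Icc a c, HasDerivWithinAt γ (f t (γ t)) (Icc a c) t := by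
  set γ : ℝ → E := fun t => if t ≤ b then α t else β t
  have hγα : EqOn γ α (Icc a b) := fun t ht => if_pos ht.2
  have hγβ : EqOn γ β (Icc b c) := fun t ht => by
    rcases ht.1.eq_or_lt with rfl | hlt
    · rw [hγα ⟨hab, le_rfl⟩, hαβ]
    · exact if_neg hlt.not_ge
  have piece : ∀ {δ : ℝ → E} {l r : ℝ}, EqOn γ δ (Icc l r) →
      (∀ t ∈ Icc l r, HasDerivWithinAt δ (f t (δ t)) (Icc l r) t) →
      ∀ t, HasDerivWithinAt γ (f t (γ t)) (Icc l r) t := by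
    intro δ l r hγδ hδ t
    by_cases ht : t ∈ Icc l r
    · rw [hγδ ht]
      exact (hδ t ht).congr hγδ (hγδ ht)
    · exact HasFDerivWithinAt.of_notMem_closure (by rwa [isClosed_Icc.closure_eq])
  refine ⟨γ, hγα ⟨le_rfl, hab⟩, fun t _ => ?_⟩
  rw [← Icc_union_Icc_eq_Icc hab hbc]
  exact (piece hγα hα t).union (piece hγβ hβ t)

theorem exists_hasDerivWithinAt_Icc_nat_mul_of_lipschitzWith [CompleteSpace E]
    (hf : ∀ t, LipschitzWith K (f t)) (hc : ∀ x, Continuous fun t => f t x) (s : ℝ) (x₀ : E)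
    (n : ℕ) :
    ∃ α : ℝ → E, α s = x₀ ∧ ∀ t ∈ Icc s (s + (n + 1) * (1 / (2 * (K + 1)))),
      HasDerivWithinAt α (f t (α t)) (Icc s (s + (n + 1) * (1 / (2 * (K + 1))))) t := by
  set h : ℝ := 1 / (2 * (K + 1)) with hh
  have hpos : 0 < h := by positivity
  induction n with
  | zero => simpa [← hh] using exists_hasDerivWithinAt_Icc_of_lipschitzWith hf hc s x₀
  | succ n ih =>
    obtain ⟨α, h0, hα⟩ := ih
    obtain ⟨β, hβ0, hβ⟩ :=
      exists_hasDerivWithinAt_Icc_of_lipschitzWith hf hc (s + (n + 1) * h) (α (s + (n + 1) * h))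
    rw [← h0, show s + ((n + 1 : ℕ) + 1) * h = s + (n + 1) * h + h by push_cast; ring]
    have hn : 0 ≤ (n + 1) * h := by positivity
    exact exists_hasDerivWithinAt_Icc_of_Icc_of_Icc (by linarith) (by linarith) hα hβ hβ0

theorem exists_hasDerivWithinAt_Ici_of_lipschitzWith [CompleteSpace E]
    (hf : ∀ t, LipschitzWith K (f t)) (hc : ∀ x, Continuous fun t => f t x) (s : ℝ) (x₀ : E) :
    ∃ α : ℝ → E, α s = x₀ ∧ ∀ t, s ≤ t → HasDerivWithinAt α (f t (α t)) (Ici s) t := by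
  have hlocal := exists_hasDerivWithinAt_Icc_nat_mul_of_lipschitzWith hf hc s x₀
  set h : ℝ := 1 / (2 * (K + 1))
  have hpos : 0 < h := by positivity
  choose α h0 hα using hlocal
  have hlt : ∀ t, t < s + (⌈(t - s) / h⌉₊ + 1) * h := fun t => by
    have := (div_le_iff₀ hpos).1 (Nat.le_ceil ((t - s) / h))
    linarith
  refine ⟨fun t => α ⌈(t - s) / h⌉₊ t, by simpa using h0 0, fun t ht => ?_⟩
  set n := ⌈(t - s) / h⌉₊
  have hIio : Iio (s + (n + 1) * h) ∈ 𝓝[Ici s] t :=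
    mem_nhdsWithin_of_mem_nhds (Iio_mem_nhds (hlt t))
  have hαn : HasDerivWithinAt (α n) (f t (α n t)) (Ici s) t :=
    (hα n t ⟨ht, (hlt t).le⟩).mono_of_mem_nhdsWithin <| by
      filter_upwards [hIio, self_mem_nhdsWithin] with r hr hsr using ⟨hsr, hr.le⟩
  refine hαn.congr_of_eventuallyEq ?_ rfl
  filter_upwards [hIio, self_mem_nhdsWithin] with r hr hsr
  exact eq_of_hasDerivWithinAt_Icc_of_lipschitzWith hf ((h0 _).trans (h0 _).symm) (hα _) (hα _)
    hsr (hlt r).le hr.le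

end GlobalODE

theorem lipschitzOnWith_of_norm_sub_le {E : Type*} [SeminormedAddCommGroup E] {f : ℝ → E}
    {s : Set ℝ} {M : ℝ≥0} (h : ∀ x ∈ s, ∀ y ∈ s, x ≤ y → ‖f y - f x‖ ≤ M * (y - x)) :
    LipschitzOnWith M f s := by
  refine LipschitzOnWith.of_dist_le_mul fun x hx y hy => ?_
  rcases le_total x y with hxy | hxy
  · rw [dist_comm, dist_eq_norm, dist_comm, Real.dist_eq, abs_of_nonneg (sub_nonneg.2 hxy)]
    exact h x hx y hy hxy
  · rw [dist_eq_norm, Real.dist_eq, abs_of_nonneg (sub_nonneg.2 hxy)]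
    exact h y hy x hx hxy

theorem lipschitzOnWith_Icc_of_hasDerivAt {E : Type*} [NormedAddCommGroup E] [NormedSpace ℝ E]
    {f f' : ℝ → E} {a b M : ℝ} (hf : ContinuousOn f (Icc a b))
    (hd : ∀ s ∈ Ioo a b, HasDerivAt f (f' s) s) (hM : ∀ s ∈ Ioo a b, ‖f' s‖ ≤ M) :
    LipschitzOnWith M.toNNReal f (Icc a b) := by
  rcases lt_or_ge a b with hab | hab
  · rw [← closure_Ioo hab.ne] at hf ⊢
    refine LipschitzOnWith.closure hf ((convex_Ioo a b).lipschitzOnWith_of_nnnorm_hasDerivWithin_le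
      (fun s hs => (hd s hs).hasDerivWithinAt) fun s hs => ?_)
    exact NNReal.coe_le_coe.1 ((hM s hs).trans (Real.le_coe_toNNReal M))
  · exact LipschitzOnWith.of_dist_le_mul fun x hx y hy => by
      simp [subsingleton_Icc_of_ge hab hx hy]

theorem ae_mem_interior_of_ordConnected {s : Set ℝ} (hs : s.OrdConnected) :
    ∀ᵐ x ∂(volume.restrict s), x ∈ interior s := by
  rw [ae_restrict_iff' hs.measurableSet]
  filter_upwards [compl_mem_ae_iff.2 (hs.convex.addHaar_frontier volume)] with x hx hxs
  by_contra hxi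
  exact hx ⟨subset_closure hxs, hxi⟩

/-! ### Hybrid time domains -/

/-- The shapes that a non-empty slice of a hybrid time domain may have, if it starts at `a`; `b` is
its right end point when it is bounded. -/
def IsSliceInterval (a b : ℝ) (I : Set ℝ) : Prop :=
  I = Icc a b ∨ (a < b ∧ I = Ico a b) ∨ I = Ici a

/-- `t` lists the left end points of the slices of the hybrid time domain `E`; beyond the last
slice, its values carry no information. -/
structure IsSliceSeq (E : Set (ℝ × ℕ)) (t : ℕ → ℝ) : Prop where
  zero : t 0 = 0
  mono : Monotone t
  nonempty : (slice E 0).Nonempty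
  slice_eq : ∀ j, slice E j = ∅ ∨ IsSliceInterval (t j) (t (j + 1)) (slice E j)
  slice_eq_Icc : ∀ j, (slice E (j + 1)).Nonempty → slice E j = Icc (t j) (t (j + 1))

/-- The hybrid time domain with `J` jumps at the times `t 1, …, t J`, and last slice `I`. -/
def finiteDomain (t : ℕ → ℝ) (J : ℕ) (I : Set ℝ) : Set (ℝ × ℕ) :=
  {p | (p.2 < J ∧ p.1 ∈ Icc (t p.2) (t (p.2 + 1))) ∨ (p.2 = J ∧ p.1 ∈ I)}

section FiniteDomain

variable {t : ℕ → ℝ} {J j : ℕ} {I : Set ℝ}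

theorem slice_finiteDomain_of_lt (hj : j < J) :
    slice (finiteDomain t J I) j = Icc (t j) (t (j + 1)) := by
  ext s
  simp [finiteDomain, slice, hj, hj.ne]

variable (t J I) in
theorem slice_finiteDomain_self : slice (finiteDomain t J I) J = I := by
  ext s
  simp [finiteDomain, slice]

theorem slice_finiteDomain_of_gt (hj : J < j) : slice (finiteDomain t J I) j = ∅ := by
  ext s
  simp [finiteDomain, slice, hj.not_gt, hj.ne']

theorem isSliceSeq_finiteDomain (h0 : t 0 = 0) (hm : Monotone t)
    (hI : IsSliceInterval (t J) (t (J + 1)) I) : IsSliceSeq (finiteDomain t J I) t := by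
  refine ⟨h0, hm, ?_, fun j => ?_, fun j hj => ?_⟩
  · rcases J.eq_zero_or_pos with rfl | hJ
    · rw [slice_finiteDomain_self]
      rcases hI with rfl | ⟨h, rfl⟩ | rfl
      exacts [nonempty_Icc.2 (hm (Nat.le_succ 0)), nonempty_Ico.2 h, nonempty_Ici]
    · rw [slice_finiteDomain_of_lt hJ]
      exact nonempty_Icc.2 (hm (Nat.le_succ 0))
  · rcases lt_trichotomy j J with hj | rfl | hj
    · exact Or.inr (Or.inl (slice_finiteDomain_of_lt hj))
    · rw [slice_finiteDomain_self]
      exact Or.inr hI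
    · exact Or.inl (slice_finiteDomain_of_gt hj)
  · refine slice_finiteDomain_of_lt (not_le.1 fun hJ => ?_)
    rw [slice_finiteDomain_of_gt (Nat.lt_succ_of_le hJ)] at hj
    exact not_nonempty_empty hj

end FiniteDomain

namespace IsHybridTimeDomain

theorem exists_isSliceSeq {E : Set (ℝ × ℕ)} (hE : IsHybridTimeDomain E) :
    ∃ t, IsSliceSeq E t := by
  obtain ⟨t, h0, hm, rfl | ⟨J, I, hI, rfl⟩⟩ := hE
  · exact ⟨t, h0, hm, nonempty_Icc.2 (hm (Nat.le_succ 0)), fun j => Or.inr (Or.inl rfl),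
      fun j _ => rfl⟩
  · exact ⟨t, isSliceSeq_finiteDomain h0 hm hI⟩

end IsHybridTimeDomain

theorem lintegral_le_of_forall_lintegral_Icc_le {I : Set ℝ} (hI : I.OrdConnected) {a : ℝ}
    (ha : a ∈ lowerBounds I) {f : ℝ → ℝ≥0∞} {C : ℝ≥0∞}
    (hC : ∀ s ∈ I, ∫⁻ x in Icc a s, f x ≤ C) : ∫⁻ x in I, f x ≤ C := by
  by_cases hmax : ∃ m ∈ I, ∀ s ∈ I, s ≤ m
  · obtain ⟨m, hm, hle⟩ := hmax
    have hsub : I ⊆ Icc a m := fun s hs => ⟨ha hs, hle s hs⟩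
    exact (lintegral_mono_set hsub).trans (hC m hm)
  · push Not at hmax
    have hsub : I ⊆ ⋃ q : {q : ℚ // (q : ℝ) ∈ I}, Icc a q := fun s hs => by
      obtain ⟨s', hs', hlt⟩ := hmax s hs
      obtain ⟨q, hsq, hqs'⟩ := exists_rat_btwn hlt
      exact mem_iUnion.2 ⟨⟨q, hI.out hs hs' ⟨hsq.le, hqs'.le⟩⟩, ha hs, hsq.le⟩
    have hdir : Directed (· ⊆ ·) fun q : {q : ℚ // (q : ℝ) ∈ I} => Icc a (q : ℝ) :=
      Monotone.directed_le fun p q hpq => Icc_subset_Icc_right (Rat.cast_le.2 hpq)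
    calc ∫⁻ x in I, f x ≤ ∫⁻ x in ⋃ q : {q : ℚ // (q : ℝ) ∈ I}, Icc a q, f x :=
          lintegral_mono_set hsub
      _ = ⨆ q : {q : ℚ // (q : ℝ) ∈ I}, ∫⁻ x in Icc a q, f x :=
          setLIntegral_iUnion_of_directed _ hdir
      _ ≤ C := iSup_le fun q => hC q q.2

namespace IsSliceSeq

variable {E : Set (ℝ × ℕ)} {t : ℕ → ℝ} {s : ℝ} {i j : ℕ}

theorem nonneg (h : IsSliceSeq E t) (j : ℕ) : 0 ≤ t j := h.zero ▸ h.mono j.zero_le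

theorem left_le (h : IsSliceSeq E t) (hs : s ∈ slice E j) : t j ≤ s := by
  rcases h.slice_eq j with h1 | h1 | ⟨_, h1⟩ | h1 <;> rw [h1] at hs
  exacts [hs.elim, hs.1, hs.1, hs]

theorem left_mem (h : IsSliceSeq E t) (hs : s ∈ slice E j) : t j ∈ slice E j := by
  rcases h.slice_eq j with h1 | h1 | ⟨hlt, h1⟩ | h1 <;> rw [h1] at hs ⊢
  exacts [hs.elim, ⟨le_rfl, h.mono j.le_succ⟩, ⟨le_rfl, hlt⟩, self_mem_Ici]

theorem ordConnected (h : IsSliceSeq E t) (j : ℕ) : (slice E j).OrdConnected := by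
  rcases h.slice_eq j with h1 | h1 | ⟨_, h1⟩ | h1 <;> rw [h1]
  exacts [ordConnected_empty, ordConnected_Icc, ordConnected_Ico, ordConnected_Ici]

theorem zero_mem (h : IsSliceSeq E t) : ((0 : ℝ), 0) ∈ E := by
  have hmem : (t 0, 0) ∈ E := h.left_mem h.nonempty.some_mem
  rwa [h.zero] at hmem

theorem measurableSet_slice (h : IsSliceSeq E t) (j : ℕ) : MeasurableSet (slice E j) :=
  (h.ordConnected j).measurableSet

theorem Icc_subset (h : IsSliceSeq E t) (hs : s ∈ slice E j) : Icc (t j) s ⊆ slice E j :=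
  (h.ordConnected j).out (h.left_mem hs) hs

theorem mem_jumpTimes (h : IsSliceSeq E t) (hj : (slice E (j + 1)).Nonempty) :
    (t (j + 1), j) ∈ jumpTimes E := by
  have hmem : t (j + 1) ∈ slice E j := by
    rw [h.slice_eq_Icc j hj]
    exact ⟨h.mono j.le_succ, le_rfl⟩
  exact ⟨hmem, h.left_mem hj.some_mem⟩

theorem eq_of_mem_jumpTimes (h : IsSliceSeq E t) (hs : (s, j) ∈ jumpTimes E) : s = t (j + 1) := by
  have hsucc : s ∈ slice E (j + 1) := hs.2
  have hle : s ∈ Icc (t j) (t (j + 1)) := h.slice_eq_Icc j ⟨s, hsucc⟩ ▸ hs.1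
  exact le_antisymm hle.2 (h.left_le hsucc)

theorem nonempty_of_le (h : IsSliceSeq E t) (hij : i ≤ j) (hj : (slice E j).Nonempty) :
    (slice E i).Nonempty := by
  induction j, hij using Nat.le_induction with
  | base => exact hj
  | succ k _ ih => exact ih ⟨_, (h.mem_jumpTimes hj).1⟩

theorem eq_of_mem_slice_of_lt (h : IsSliceSeq E t) (hij : i < j) (hi : s ∈ slice E i)
    (hj : s ∈ slice E j) : s = t j := by
  rw [h.slice_eq_Icc i (h.nonempty_of_le hij ⟨s, hj⟩)] at hi
  exact le_antisymm (hi.2.trans (h.mono hij)) (h.left_le hj)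

theorem jmin_eq (h : IsSliceSeq E t) (hs : s ∈ slice E j) (hne : s ≠ t j) : jmin E s = j := by
  have hmem : s ∈ slice E (jmin E s) := Nat.sInf_mem (s := {j | (s, j) ∈ E}) ⟨j, hs⟩
  have hle : jmin E s ≤ j := Nat.sInf_le hs
  by_contra hj
  exact hne (h.eq_of_mem_slice_of_lt (lt_of_le_of_ne hle hj) hmem hs)

theorem aedisjoint_slice (h : IsSliceSeq E t) :
    Pairwise (Function.onFun (AEDisjoint volume) (slice E)) := by
  have of_lt : ∀ i j, i < j → AEDisjoint volume (slice E i) (slice E j) := fun i j hij =>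
    measure_mono_null (fun s hs => h.eq_of_mem_slice_of_lt hij hs.1 hs.2)
      (Real.volume_singleton (a := t j))
  intro i j hij
  rcases lt_or_gt_of_ne hij with hlt | hlt
  exacts [of_lt i j hlt, (of_lt j i hlt).symm]

theorem lintegral_domT (h : IsSliceSeq E t) (f : ℝ → ℕ → ℝ≥0∞) :
    ∫⁻ s in domT E, f s (jmin E s) = ∑' j, ∫⁻ s in slice E j, f s j := by
  have hdom : domT E = ⋃ j, slice E j := by
    ext s
    simp [domT, slice]
  rw [hdom, lintegral_iUnion₀ (fun j => (h.measurableSet_slice j).nullMeasurableSet)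
    h.aedisjoint_slice]
  refine tsum_congr fun j => setLIntegral_congr_fun_ae (h.measurableSet_slice j) ?_
  filter_upwards [Measure.ae_ne volume (t j)] with s hs hmem
  rw [h.jmin_eq hmem hs]

end IsSliceSeq

section LinfNorm

variable {U : Type*} [NormedAddCommGroup U] {E : Set (ℝ × ℕ)} {t : ℕ → ℝ} (u : ℝ → ℕ → U)

theorem enorm_le_linfNorm_of_mem_jumpTimes {s : ℝ} {j : ℕ} (hp : (s, j) ∈ jumpTimes E) :
    ‖u s j‖ₑ ≤ linfNorm E u :=
  calc ‖u s j‖ₑ ≤ ⨆ p ∈ {p : ℝ × ℕ | p ∈ jumpTimes E ∧ p.1 + p.2 ≤ s + j}, ‖u p.1 p.2‖ₑ :=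
        le_iSup₂ (f := fun (p : ℝ × ℕ) (_ : p ∈ {p : ℝ × ℕ | p ∈ jumpTimes E ∧
          p.1 + p.2 ≤ s + j}) => ‖u p.1 p.2‖ₑ) (s, j) ⟨hp, le_rfl⟩
    _ ≤ linfTrunc E u (s + j) := le_max_right _ _
    _ ≤ linfNorm E u := le_iSup (linfTrunc E u) _

theorem ae_enorm_le_linfTrunc (j : ℕ) (T : ℝ) :
    ∀ᵐ s ∂(volume.restrict {s | (s, j) ∈ E \ jumpTimes E ∧ s + j ≤ T}),
      ‖u s j‖ₑ ≤ linfTrunc E u T := by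
  filter_upwards [ENNReal.ae_le_essSup (fun s => ‖u s j‖ₑ)] with s hs
  exact hs.trans <| (le_iSup (fun k : ℕ => essSup (fun s => ‖u s k‖ₑ)
    (volume.restrict {s | (s, k) ∈ E \ jumpTimes E ∧ s + k ≤ T})) j).trans (le_max_left _ _)

theorem ae_enorm_le_linfNorm (h : IsSliceSeq E t) (j : ℕ) :
    ∀ᵐ s ∂(volume.restrict (slice E j)), ‖u s j‖ₑ ≤ linfNorm E u := by
  have hflow : ∀ n : ℕ, ∀ᵐ s ∂(volume.restrict {s | (s, j) ∈ E \ jumpTimes E ∧ s + j ≤ (n : ℝ)}),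
      ‖u s j‖ₑ ≤ linfNorm E u := fun n =>
    (ae_enorm_le_linfTrunc u j n).mono fun s hs => hs.trans (le_iSup (linfTrunc E u) _)
  have hjump : ∀ᵐ s ∂(volume.restrict {t (j + 1)}), ‖u s j‖ₑ ≤ linfNorm E u := by
    rw [Measure.restrict_eq_zero.2 Real.volume_singleton]
    exact ae_zero.le trivial
  refine ae_restrict_of_ae_restrict_of_subset (fun s hs => ?_)
    ((ae_restrict_union_iff _ _ _).2 ⟨(ae_restrict_iUnion_iff _ _).2 hflow, hjump⟩)
  by_cases hj : (s, j) ∈ jumpTimes E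
  · exact Or.inr (h.eq_of_mem_jumpTimes hj)
  · obtain ⟨n, hn⟩ := exists_nat_ge (s + j)
    exact Or.inl (mem_iUnion.2 ⟨n, ⟨hs, hj⟩, hn⟩)

end LinfNorm

/-! ### The state space of the error system -/

/-- The action of a matrix on Euclidean vectors as a continuous linear map. -/
noncomputable abbrev mulL {m n : ℕ} (M : Matrix (Fin m) (Fin n) ℝ) : Eu n →L[ℝ] Eu m :=
  LinearMap.toContinuousLinearMap (Matrix.toEuclideanLin M)

namespace ErrState

variable {nz ny : ℕ}

/-- A shortcut for instance search, which otherwise times out on the iterated `WithLp`. -/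
instance instContinuousSMul : ContinuousSMul ℝ (ErrState nz ny) :=
  IsBoundedSMul.continuousSMul

/-- The coordinate `z` as a continuous linear map. -/
def zL : ErrState nz ny →L[ℝ] Eu nz := WithLp.fstL 2 ℝ _ _

/-- The coordinate `ε` as a continuous linear map. -/
def εL : ErrState nz ny →L[ℝ] Eu nz := (WithLp.fstL 2 ℝ _ _).comp (WithLp.sndL 2 ℝ _ _)

/-- The coordinate `θ̃` as a continuous linear map. -/
def θL : ErrState nz ny →L[ℝ] Eu ny :=
  (WithLp.fstL 2 ℝ _ _).comp ((WithLp.sndL 2 ℝ _ _).comp (WithLp.sndL 2 ℝ _ _))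

/-- The coordinate `τ` as a continuous linear map. -/
def τL : ErrState nz ny →L[ℝ] ℝ :=
  (WithLp.sndL 2 ℝ _ _).comp ((WithLp.sndL 2 ℝ _ _).comp (WithLp.sndL 2 ℝ _ _))

/-- The map `(z, ε, θ̃, τ) ↦ mk z ε θ̃ τ` as a continuous linear map. -/
def mkL : (Eu nz × Eu nz × Eu ny × ℝ) →L[ℝ] ErrState nz ny :=
  (WithLp.prodContinuousLinearEquiv 2 ℝ _ _).symm.toContinuousLinearMap.comp
    ((ContinuousLinearMap.id ℝ _).prodMap
      ((WithLp.prodContinuousLinearEquiv 2 ℝ _ _).symm.toContinuousLinearMap.comp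
        ((ContinuousLinearMap.id ℝ _).prodMap
          (WithLp.prodContinuousLinearEquiv 2 ℝ _ _).symm.toContinuousLinearMap)))

theorem mkL_apply (z ε : Eu nz) (θ : Eu ny) (τ : ℝ) : mkL (z, ε, θ, τ) = mk z ε θ τ := rfl

@[simp] theorem mk_z (z ε : Eu nz) (θ : Eu ny) (τ : ℝ) : (mk z ε θ τ).z = z := rfl
@[simp] theorem mk_ε (z ε : Eu nz) (θ : Eu ny) (τ : ℝ) : (mk z ε θ τ).ε = ε := rfl
@[simp] theorem mk_θ (z ε : Eu nz) (θ : Eu ny) (τ : ℝ) : (mk z ε θ τ).θ = θ := rfl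
@[simp] theorem mk_τ (z ε : Eu nz) (θ : Eu ny) (τ : ℝ) : (mk z ε θ τ).τ = τ := rfl

theorem norm_sq (x : ErrState nz ny) :
    ‖x‖ ^ 2 = ‖x.z‖ ^ 2 + (‖x.ε‖ ^ 2 + (‖x.θ‖ ^ 2 + ‖x.τ‖ ^ 2)) := by
  rw [WithLp.prod_norm_sq_eq_of_L2, WithLp.prod_norm_sq_eq_of_L2, WithLp.prod_norm_sq_eq_of_L2]
  rfl

theorem dist_sq (x y : ErrState nz ny) : dist x y ^ 2 =
    ‖x.z - y.z‖ ^ 2 + (‖x.ε - y.ε‖ ^ 2 + (‖x.θ - y.θ‖ ^ 2 + ‖x.τ - y.τ‖ ^ 2)) := by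
  rw [dist_eq_norm, norm_sq]
  rfl

theorem infDist_errSet {T₂ : ℝ} {x : ErrState nz ny} (hx : x.τ ∈ Icc 0 T₂) :
    Metric.infDist x (Plant.errSet nz ny T₂) = √(‖x.ε‖ ^ 2 + ‖x.θ‖ ^ 2) := by
  have hmem : mk x.z 0 0 x.τ ∈ Plant.errSet nz ny T₂ := ⟨rfl, rfl, hx⟩
  refine le_antisymm ?_ ((Metric.le_infDist ⟨_, hmem⟩).2 fun y ⟨hε, hθ, _⟩ => ?_)
  · refine (Metric.infDist_le_dist_of_mem hmem).trans (Real.le_sqrt_of_sq_le ?_)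
    rw [dist_sq]
    simp
  · refine Real.sqrt_le_iff.2 ⟨dist_nonneg, ?_⟩
    rw [dist_sq, hε, hθ, sub_zero, sub_zero]
    nlinarith [sq_nonneg ‖x.z - y.z‖, sq_nonneg ‖x.τ - y.τ‖]

theorem infDist_errSet_sq {T₂ : ℝ} {x : ErrState nz ny} (hx : x.τ ∈ Icc 0 T₂) :
    Metric.infDist x (Plant.errSet nz ny T₂) ^ 2 = ‖x.ε‖ ^ 2 + ‖x.θ‖ ^ 2 := by
  rw [infDist_errSet hx, Real.sq_sqrt (by positivity)]

end ErrState

/-! ### Lyapunov estimates along hybrid solutions -/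

namespace Plant

variable {nz nw ny ns nq np : ℕ}

/-- `V` is a dissipation function for the hybrid error system: along flows it decays at the rate
`2 λ_t` up to the supply `γ² |w|² - |C_p ε|²`, it is comparable to `|ε|² + |θ̃|²` with the constants
`a` and `b`, and a reset `θ̃⁺ = -η` increases it by at most `b |η|²`. Unlike in
`DissipationAssumption`, `V` need not split as `V₁(ε) + V₂(θ̃, τ)`. -/
structure IsLyapunov (P : Plant nz nw ny ns nq np) (L : Matrix (Fin nz) (Fin ny) ℝ)
    (H : Matrix (Fin ny) (Fin ny) ℝ) (T₂ lt γ : ℝ) (V : ErrState nz ny → ℝ) (a b : ℝ) :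
    Prop where
  contDiff : ContDiff ℝ 1 V
  a_pos : 0 < a
  b_pos : 0 < b
  le_self : ∀ x : ErrState nz ny, x.τ ∈ Icc 0 T₂ → a * (‖x.ε‖ ^ 2 + ‖x.θ‖ ^ 2) ≤ V x
  self_le : ∀ x : ErrState nz ny, x.τ ∈ Icc 0 T₂ → V x ≤ b * (‖x.ε‖ ^ 2 + ‖x.θ‖ ^ 2)
  reset : ∀ x : ErrState nz ny, x.τ ∈ Icc 0 T₂ → ∀ (η : Eu ny), ∀ v ∈ Icc 0 T₂,
    V (ErrState.mk x.z x.ε (-η) v) ≤ V x + b * ‖η‖ ^ 2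
  dissip : ∀ x : ErrState nz ny, x.τ ∈ Icc 0 T₂ → ∀ w : Eu nw,
    fderiv ℝ V x (P.errFlow L H x w) ≤
      -2 * lt * V x - ‖mulE P.Cp x.ε‖ ^ 2 + γ ^ 2 * ‖w‖ ^ 2

theorem DissipationAssumption.exists_isLyapunov {P : Plant nz nw ny ns nq np}
    {L : Matrix (Fin nz) (Fin ny) ℝ} {H : Matrix (Fin ny) (Fin ny) ℝ} {T₂ lt γ : ℝ}
    (hA : P.DissipationAssumption L H T₂ lt γ) :
    ∃ V a b, P.IsLyapunov L H T₂ lt γ V a b := by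
  obtain ⟨V₁, V₂, α₁, α₂, ω₁, ω₂, hV₁, hV₂, hα₁, hα₂, hω₁, -, h₁, h₂, hd⟩ := hA
  have hmin {p q : ℝ} : min α₁ ω₁ * (p ^ 2 + q ^ 2) ≤ α₁ * p ^ 2 + ω₁ * q ^ 2 := by
    rw [mul_add]
    gcongr
    exacts [min_le_left _ _, min_le_right _ _]
  have hmax {p q : ℝ} : α₂ * p ^ 2 + ω₂ * q ^ 2 ≤ max α₂ ω₂ * (p ^ 2 + q ^ 2) := by
    rw [mul_add]
    gcongr
    exacts [le_max_left _ _, le_max_right _ _]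
  refine ⟨lyap V₁ V₂, min α₁ ω₁, max α₂ ω₂, ?_, lt_min hα₁ hω₁, lt_max_of_lt_left hα₂,
    fun x hx => ?_, fun x hx => ?_, fun x hx η v hv => ?_, hd⟩
  · exact (hV₁.comp ErrState.εL.contDiff).add
      (hV₂.comp (ErrState.θL.prod ErrState.τL).contDiff)
  · exact hmin.trans (add_le_add (h₁ x.ε).1 (h₂ x.θ x.τ hx).1)
  · exact (add_le_add (h₁ x.ε).2 (h₂ x.θ x.τ hx).2).trans hmax
  · refine (add_assoc _ _ _).ge.trans' (add_le_add_right ?_ _)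
    calc V₂ (-η, v) ≤ ω₂ * ‖η‖ ^ 2 := norm_neg η ▸ (h₂ (-η) v hv).2
      _ ≤ V₂ (x.θ, x.τ) + max α₂ ω₂ * ‖η‖ ^ 2 :=
        le_add_of_nonneg_of_le ((by positivity : 0 ≤ ω₁ * ‖x.θ‖ ^ 2).trans (h₂ x.θ x.τ hx).1)
          (by gcongr; exact le_max_right _ _)

end Plant

theorem IsHybridArc.continuousOn_Icc {X : Type*} [SeminormedAddCommGroup X] {E : Set (ℝ × ℕ)}
    {φ : ℝ → ℕ → X} (hφ : IsHybridArc E φ) {j : ℕ} {c d : ℝ} (hcd : c ≤ d)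
    (h : Icc c d ⊆ slice E j) : ContinuousOn (fun s => φ s j) (Icc c d) := by
  rw [← uIcc_of_le hcd]
  exact (hφ j c d hcd h).continuousOn

theorem le_exp_mul_add_div_of_forall_le {x t : ℕ → ℝ} {c d δ : ℝ} (hc : 0 < c) (hδ : 0 < δ)
    (hd : 0 ≤ d) {n : ℕ}
    (hx : ∀ j ≤ n, x (j + 1) ≤ Real.exp (-c * (t (j + 1) - t j)) * x j + d)
    (ht : ∀ j < n, δ ≤ t (j + 2) - t (j + 1)) :
    x (n + 1) ≤ Real.exp (-c * (t (n + 1) - t 0)) * x 0 + d / (1 - Real.exp (-c * δ)) := by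
  have hq : Real.exp (-c * δ) < 1 := Real.exp_lt_one_iff.2 (by nlinarith)
  set R := d / (1 - Real.exp (-c * δ))
  have hR0 : 0 ≤ R := div_nonneg hd (by linarith)
  have hfix : Real.exp (-c * δ) * R + d = R := by
    linarith [div_mul_cancel₀ d (sub_pos.2 hq).ne']
  induction n with
  | zero =>
    have : 0 ≤ Real.exp (-c * δ) * R := by positivity
    linarith [hx 0 le_rfl]
  | succ n ih =>
    have hgap : Real.exp (-c * (t (n + 2) - t (n + 1))) ≤ Real.exp (-c * δ) :=
      Real.exp_le_exp.2 (by nlinarith [ht n n.lt_succ_self])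
    calc x (n + 2)
        ≤ Real.exp (-c * (t (n + 2) - t (n + 1))) * x (n + 1) + d := hx (n + 1) le_rfl
      _ ≤ Real.exp (-c * (t (n + 2) - t (n + 1))) *
            (Real.exp (-c * (t (n + 1) - t 0)) * x 0 + R) + d := by
          gcongr
          exact ih (fun j hj => hx j (hj.trans n.le_succ))
            fun j hj => ht j (hj.trans n.lt_succ_self)
      _ = Real.exp (-c * (t (n + 2) - t 0)) * x 0 +
            (Real.exp (-c * (t (n + 2) - t (n + 1))) * R + d) := by
          rw [mul_add, ← mul_assoc, ← Real.exp_add, add_assoc]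
          congr 4
          ring
      _ ≤ Real.exp (-c * (t (n + 2) - t 0)) * x 0 + R := by
          grw [hgap, hfix]

namespace Plant

variable {nz nw ny ns nq np : ℕ}

section Estimates

variable {P : Plant nz nw ny ns nq np} {L : Matrix (Fin nz) (Fin ny) ℝ}
  {H : Matrix (Fin ny) (Fin ny) ℝ} {T₁ T₂ lt γ : ℝ} {V : ErrState nz ny → ℝ} {a b : ℝ}
  {E : Set (ℝ × ℕ)} {φ : ℝ → ℕ → ErrState nz ny} {u : ℝ → ℕ → WithLp 2 (Eu nw × Eu ny)}
  {t : ℕ → ℝ} {s c d r : ℝ} {j : ℕ}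

theorem timer_mem_of_jump (hsol : (P.errSystem L H T₁ T₂).IsSolutionPair E φ u)
    (ht : IsSliceSeq E t) (hj : (slice E (j + 1)).Nonempty) :
    (φ (t (j + 1)) (j + 1)).τ ∈ Icc T₁ T₂ := by
  obtain ⟨-, v, hv, h⟩ := hsol.jump _ _ (ht.mem_jumpTimes hj)
  rw [h]
  exact hv

theorem timer_mem_left (hsol : (P.errSystem L H T₁ T₂).IsSolutionPair E φ u)
    (ht : IsSliceSeq E t) (hT₁ : 0 < T₁) (hT : T₁ ≤ T₂) (hj : (slice E j).Nonempty) :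
    (φ (t j) j).τ ∈ Icc 0 T₂ := by
  cases j with
  | zero =>
    rw [ht.zero]
    rcases hsol.init with h | (h : (φ 0 0).τ = 0)
    · exact h
    · exact ⟨h.ge, h.trans_le (hT₁.le.trans hT)⟩
  | succ j => exact Icc_subset_Icc_left hT₁.le (timer_mem_of_jump hsol ht hj)

theorem timer_mem (hsol : (P.errSystem L H T₁ T₂).IsSolutionPair E φ u)
    (ht : IsSliceSeq E t) (hT₁ : 0 < T₁) (hT : T₁ ≤ T₂) (hs : (s, j) ∈ E) :
    (φ s j).τ ∈ Icc 0 T₂ := by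
  rcases (ht.left_le hs).eq_or_lt with heq | hlt
  · rw [← heq]
    exact timer_mem_left hsol ht hT₁ hT ⟨s, hs⟩
  · have hcl := closure_Ioo hlt.ne
    have hcont : ContinuousOn (fun s => (φ s j).τ) (closure (Ioo (t j) s)) := by
      rw [hcl]
      exact ErrState.τL.continuous.comp_continuousOn
        (hsol.arc.continuousOn_Icc hlt.le (ht.Icc_subset hs))
    have hmaps : MapsTo (fun s => (φ s j).τ) (Ioo (t j) s) (Icc 0 T₂) := fun r hr =>
      hsol.flow_mem j r (interior_mono (ht.Icc_subset hs) (by rwa [interior_Icc]))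
    refine isClosed_Icc.closure_subset (hmaps.closure_of_continuousOn hcont ?_)
    rw [hcl]
    exact right_mem_Icc.2 hlt.le

theorem ae_hasDerivAt_of_Icc_subset (hsol : (P.errSystem L H T₁ T₂).IsSolutionPair E φ u)
    (h : Icc c d ⊆ slice E j) : ∀ᵐ s ∂(volume.restrict (Icc c d)),
      HasDerivAt (fun s => φ s j) (P.errFlow L H (φ s j) (u s j).fst) s :=
  ae_restrict_of_ae_restrict_of_subset h (hsol.flow j)

theorem timer_left_le (hsol : (P.errSystem L H T₁ T₂).IsSolutionPair E φ u)
    (ht : IsSliceSeq E t) (hs : (s, j) ∈ E) : (φ (t j) j).τ ≤ (φ s j).τ + (s - t j) := by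
  have hle := ht.left_le hs
  have hac := absolutelyContinuousOnInterval_comp_of_lipschitzWith (-ErrState.τL).lipschitz
    (hsol.arc j (t j) s hle (ht.Icc_subset hs))
  have hder : ∀ᵐ r ∂(volume.restrict (Icc (t j) s)),
      ∃ v, HasDerivAt (fun r => (-ErrState.τL) (φ r j)) v r ∧ v ≤ 1 := by
    filter_upwards [ae_hasDerivAt_of_Icc_subset hsol (ht.Icc_subset hs)] with r hr
    exact ⟨_, (-ErrState.τL).hasFDerivAt.comp_hasDerivAt r hr, (neg_neg (1 : ℝ)).le⟩
  have hint : -(φ s j).τ - -(φ (t j) j).τ ≤ ∫ _ in t j..s, (1 : ℝ) :=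
    sub_le_integral_of_ae_hasDerivAt_le hle hac hder (by simp)
  rw [integral_one] at hint
  linarith

theorem le_sub_of_jump (hsol : (P.errSystem L H T₁ T₂).IsSolutionPair E φ u)
    (ht : IsSliceSeq E t) (hj : (slice E (j + 2)).Nonempty) : T₁ ≤ t (j + 2) - t (j + 1) := by
  have hjump := ht.mem_jumpTimes hj
  have hend : (φ (t (j + 2)) (j + 1)).τ = 0 := (hsol.jump _ _ hjump).1
  have hstart := (timer_mem_of_jump hsol ht ⟨_, hjump.1⟩).1
  have hflow : (φ (t (j + 1)) (j + 1)).τ ≤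
      (φ (t (j + 2)) (j + 1)).τ + (t (j + 2) - t (j + 1)) := timer_left_le hsol ht hjump.1
  linarith

theorem mul_le_of_jump (hsol : (P.errSystem L H T₁ T₂).IsSolutionPair E φ u)
    (ht : IsSliceSeq E t) (hj : (slice E (j + 1)).Nonempty) : T₁ * j ≤ t (j + 1) := by
  induction j with
  | zero => simpa using ht.nonneg 1
  | succ j ih =>
    have hgap := le_sub_of_jump hsol ht hj
    have hle := ih (ht.nonempty_of_le (j + 1).le_succ hj)
    push_cast
    linarith

theorem mul_sub_one_le (hsol : (P.errSystem L H T₁ T₂).IsSolutionPair E φ u)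
    (ht : IsSliceSeq E t) (hT₁ : 0 < T₁) (hs : (s, j) ∈ E) : T₁ * (j - 1) ≤ s := by
  have hle := ht.left_le hs
  cases j with
  | zero =>
    have := ht.nonneg 0
    push_cast
    linarith
  | succ j =>
    have := mul_le_of_jump hsol ht ⟨s, hs⟩
    push_cast
    linarith

theorem absolutelyContinuousOnInterval_lyapunov (hV : P.IsLyapunov L H T₂ lt γ V a b)
    (hsol : (P.errSystem L H T₁ T₂).IsSolutionPair E φ u) (hcd : c ≤ d)
    (h : Icc c d ⊆ slice E j) : AbsolutelyContinuousOnInterval (fun s => V (φ s j)) c d :=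
  absolutelyContinuousOnInterval_comp_of_contDiff hV.contDiff (hsol.arc j c d hcd h)

theorem ae_hasDerivAt_lyapunov_le (hV : P.IsLyapunov L H T₂ lt γ V a b)
    (hsol : (P.errSystem L H T₁ T₂).IsSolutionPair E φ u) (ht : IsSliceSeq E t)
    (hT₁ : 0 < T₁) (hT : T₁ ≤ T₂) (h : Icc c d ⊆ slice E j) :
    ∀ᵐ s ∂(volume.restrict (Icc c d)), ∃ v, HasDerivAt (fun s => V (φ s j)) v s ∧
      v ≤ -2 * lt * V (φ s j) - ‖mulE P.Cp (φ s j).ε‖ ^ 2 + γ ^ 2 * ‖(u s j).fst‖ ^ 2 := by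
  filter_upwards [ae_hasDerivAt_of_Icc_subset hsol h, ae_restrict_mem measurableSet_Icc]
    with s hs hmem
  exact ⟨_, ((hV.contDiff.differentiable one_ne_zero) _).hasFDerivAt.comp_hasDerivAt s hs,
    hV.dissip _ (timer_mem hsol ht hT₁ hT (h hmem)) _⟩

theorem lyapunov_jump_le (hV : P.IsLyapunov L H T₂ lt γ V a b)
    (hsol : (P.errSystem L H T₁ T₂).IsSolutionPair E φ u) (ht : IsSliceSeq E t)
    (hT₁ : 0 < T₁) (hT : T₁ ≤ T₂) (hj : (slice E (j + 1)).Nonempty) :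
    V (φ (t (j + 1)) (j + 1)) ≤ V (φ (t (j + 1)) j) + b * ‖(u (t (j + 1)) j).snd‖ ^ 2 := by
  have hmem := ht.mem_jumpTimes hj
  obtain ⟨-, v, hv, h⟩ := hsol.jump _ _ hmem
  rw [h]
  exact hV.reset _ (timer_mem hsol ht hT₁ hT hmem.1) _ _ (Icc_subset_Icc_left hT₁.le hv)

theorem lyapunov_flow_le (hV : P.IsLyapunov L H T₂ lt γ V a b)
    (hsol : (P.errSystem L H T₁ T₂).IsSolutionPair E φ u) (ht : IsSliceSeq E t)
    (hT₁ : 0 < T₁) (hT : T₁ ≤ T₂) (hlt : 0 < lt)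
    (hw : ∀ᵐ s ∂(volume.restrict (slice E j)), ‖(u s j).fst‖ ≤ r) (hs : (s, j) ∈ E) :
    V (φ s j) - γ ^ 2 / (2 * lt) * r ^ 2 ≤
      Real.exp (-(2 * lt) * (s - t j)) * (V (φ (t j) j) - γ ^ 2 / (2 * lt) * r ^ 2) := by
  have hle := ht.left_le hs
  have hsub := ht.Icc_subset hs
  have hdecay := add_div_le_exp_mul_of_ae_hasDerivAt_le (c := -(2 * lt)) (k := γ ^ 2 * r ^ 2) hle
    (by linarith) (absolutelyContinuousOnInterval_lyapunov hV hsol hle hsub) ?_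
  · rwa [show γ ^ 2 * r ^ 2 / -(2 * lt) = -(γ ^ 2 / (2 * lt) * r ^ 2) by rw [div_neg]; ring,
      ← sub_eq_add_neg, ← sub_eq_add_neg] at hdecay
  · filter_upwards [ae_hasDerivAt_lyapunov_le hV hsol ht hT₁ hT hsub,
      ae_restrict_of_ae_restrict_of_subset hsub hw] with x ⟨v, hder, hv⟩ hx
    refine ⟨v, hder, hv.trans ?_⟩
    have : γ ^ 2 * ‖(u x j).fst‖ ^ 2 ≤ γ ^ 2 * r ^ 2 := by gcongr
    linarith [sq_nonneg ‖mulE P.Cp (φ x j).ε‖]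

theorem lyapunov_le (hV : P.IsLyapunov L H T₂ lt γ V a b)
    (hsol : (P.errSystem L H T₁ T₂).IsSolutionPair E φ u) (hT₁ : 0 < T₁) (hT : T₁ ≤ T₂)
    (hlt : 0 < lt) (hw : ∀ j, ∀ᵐ s ∂(volume.restrict (slice E j)), ‖(u s j).fst‖ ≤ r)
    (hη : ∀ s j, (s, j) ∈ jumpTimes E → ‖(u s j).snd‖ ≤ r) (hs : (s, j) ∈ E) :
    V (φ s j) ≤ Real.exp (-(2 * lt) * s) * V (φ 0 0) +
      (γ ^ 2 / (2 * lt) + b / (1 - Real.exp (-(2 * lt) * T₁))) * r ^ 2 := by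
  obtain ⟨t, ht⟩ := hsol.dom.exists_isSliceSeq
  have hb := hV.b_pos
  set q := γ ^ 2 / (2 * lt) * r ^ 2 with hq
  set R := b * r ^ 2 / (1 - Real.exp (-(2 * lt) * T₁)) with hR
  have hR0 : 0 ≤ R :=
    div_nonneg (by positivity) (sub_nonneg.2 (Real.exp_le_one_iff.2 (by nlinarith)))
  have flow : ∀ {s : ℝ} {j : ℕ}, (s, j) ∈ E →
      V (φ s j) - q ≤ Real.exp (-(2 * lt) * (s - t j)) * (V (φ (t j) j) - q) := fun {_ j} hs =>
    lyapunov_flow_le hV hsol ht hT₁ hT hlt (hw j) hs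
  have left : V (φ (t j) j) - q ≤ Real.exp (-(2 * lt) * t j) * (V (φ 0 0) - q) + R := by
    cases j with
    | zero => simpa [ht.zero] using hR0
    | succ n =>
      have hne : ∀ i ≤ n + 1, (slice E i).Nonempty := fun i hi => ht.nonempty_of_le hi ⟨s, hs⟩
      have hstep : ∀ i ≤ n, V (φ (t (i + 1)) (i + 1)) - q ≤
          Real.exp (-(2 * lt) * (t (i + 1) - t i)) * (V (φ (t i) i) - q) + b * r ^ 2 := by
        intro i hi
        have hmem := ht.mem_jumpTimes (hne (i + 1) (by omega))
        have hjump := lyapunov_jump_le hV hsol ht hT₁ hT (hne (i + 1) (by omega))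
        grw [hη _ _ hmem] at hjump
        linarith [flow hmem.1]
      simpa [ht.zero, hR] using le_exp_mul_add_div_of_forall_le (x := fun j => V (φ (t j) j) - q)
        (by positivity) hT₁ (by positivity) hstep fun i hi =>
          le_sub_of_jump hsol ht (hne (i + 2) (by omega))
  have hexp : Real.exp (-(2 * lt) * (s - t j)) ≤ 1 :=
    Real.exp_le_one_iff.2 (by nlinarith [ht.left_le hs])
  have hq0 : 0 ≤ Real.exp (-(2 * lt) * s) * q := by positivity
  calc V (φ s j) ≤ Real.exp (-(2 * lt) * (s - t j)) *
          (Real.exp (-(2 * lt) * t j) * (V (φ 0 0) - q) + R) + q :=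
        sub_le_iff_le_add.1 ((flow hs).trans (by gcongr))
    _ = Real.exp (-(2 * lt) * s) * (V (φ 0 0) - q) +
          Real.exp (-(2 * lt) * (s - t j)) * R + q := by
        rw [mul_add, ← mul_assoc, ← Real.exp_add, ← mul_add, sub_add_cancel]
    _ ≤ Real.exp (-(2 * lt) * s) * V (φ 0 0) + (q + R) := by
        nlinarith
    _ = _ := by rw [hq, hR]; ring

end Estimates

end Plant

theorem le_max_sqrt_two_mul_of_sq_le {d p x q y : ℝ} (hp : 0 ≤ p) (hx : 0 ≤ x) (hq : 0 ≤ q)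
    (hy : 0 ≤ y) (h : d ^ 2 ≤ p * x ^ 2 + q * y ^ 2) :
    d ≤ max (√(2 * p) * x) (√(2 * q) * y) := by
  have of_le {r z : ℝ} (hr : 0 ≤ r) (hz : 0 ≤ z) (hle : d ^ 2 ≤ 2 * (r * z ^ 2)) :
      d ≤ √(2 * r) * z := by
    refine le_of_sq_le_sq ?_ (by positivity)
    rwa [mul_pow, Real.sq_sqrt (by positivity), mul_assoc]
  rcases le_total (p * x ^ 2) (q * y ^ 2) with hle | hle
  · exact le_max_of_le_right (of_le hq hy (by linarith))
  · exact le_max_of_le_left (of_le hp hx (by linarith))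

theorem exp_neg_two_mul_le_of_mul_sub_one_le {lt T₁ s j : ℝ} (hlt : 0 < lt) (hT₁ : 0 < T₁)
    (h : T₁ * (j - 1) ≤ s) :
    Real.exp (-(2 * lt) * s) ≤
      (Real.exp (lt / (1 + 1 / T₁)) * Real.exp (-(lt / (1 + 1 / T₁)) * (s + j))) ^ 2 := by
  have hj : j - 1 ≤ s / T₁ := by rwa [le_div_iff₀ hT₁, mul_comm]
  have hrate : lt / (1 + 1 / T₁) * (s + s / T₁) = lt * s := by field_simp
  rw [← Real.exp_add, ← Real.exp_nat_mul]
  refine Real.exp_le_exp.2 ?_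
  have hle := mul_le_mul_of_nonneg_left hj (show 0 ≤ lt / (1 + 1 / T₁) by positivity)
  push_cast
  linarith

theorem norm_le_toNNReal_of_enorm_le {F : Type*} [NormedAddCommGroup F] {x : F} {C : ℝ≥0∞}
    (hC : C ≠ ∞) (h : ‖x‖ₑ ≤ C) : ‖x‖ ≤ C.toNNReal :=
  NNReal.coe_le_coe.2 (ENNReal.toNNReal_mono hC h)

namespace Plant

variable {nz nw ny ns nq np : ℕ}

/-- The gain from `‖u‖∞²` to `|ε|² + |θ̃|²` which a Lyapunov function with constants `a` and `b`
provides: `γ² / (2 λ_t)` comes from the flows, and the other summand from the geometric series of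
the contributions `b |η|²` of the jumps, which decay by the factor `exp (-2 λ_t T₁)` in between. -/
noncomputable def errGain (T₁ lt γ a b : ℝ) : ℝ :=
  (γ ^ 2 / (2 * lt) + b / (1 - Real.exp (-(2 * lt) * T₁))) / a

section Estimates

variable {P : Plant nz nw ny ns nq np} {L : Matrix (Fin nz) (Fin ny) ℝ}
  {H : Matrix (Fin ny) (Fin ny) ℝ} {T₁ T₂ lt γ : ℝ} {V : ErrState nz ny → ℝ} {a b : ℝ}
  {E : Set (ℝ × ℕ)} {φ : ℝ → ℕ → ErrState nz ny} {u : ℝ → ℕ → WithLp 2 (Eu nw × Eu ny)}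
  {t : ℕ → ℝ} {s c d r : ℝ} {j : ℕ}

theorem IsLyapunov.nonneg (hV : P.IsLyapunov L H T₂ lt γ V a b) {x : ErrState nz ny}
    (hx : x.τ ∈ Icc 0 T₂) : 0 ≤ V x := by
  have := hV.a_pos
  exact le_trans (by positivity) (hV.le_self x hx)

theorem IsLyapunov.errGain_nonneg (hV : P.IsLyapunov L H T₂ lt γ V a b) (hT₁ : 0 < T₁)
    (hlt : 0 < lt) : 0 ≤ errGain T₁ lt γ a b := by
  have ha := hV.a_pos
  have hb := hV.b_pos
  have : 0 ≤ 1 - Real.exp (-(2 * lt) * T₁) := sub_nonneg.2 (Real.exp_le_one_iff.2 (by nlinarith))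
  rw [errGain]
  positivity

theorem error_sq_le (hV : P.IsLyapunov L H T₂ lt γ V a b)
    (hsol : (P.errSystem L H T₁ T₂).IsSolutionPair E φ u) (hT₁ : 0 < T₁) (hT : T₁ ≤ T₂)
    (hlt : 0 < lt) (hw : ∀ j, ∀ᵐ s ∂(volume.restrict (slice E j)), ‖(u s j).fst‖ ≤ r)
    (hη : ∀ s j, (s, j) ∈ jumpTimes E → ‖(u s j).snd‖ ≤ r) (hs : (s, j) ∈ E) :
    ‖(φ s j).ε‖ ^ 2 + ‖(φ s j).θ‖ ^ 2 ≤
      b / a * Real.exp (-(2 * lt) * s) * (‖(φ 0 0).ε‖ ^ 2 + ‖(φ 0 0).θ‖ ^ 2) +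
        errGain T₁ lt γ a b * r ^ 2 := by
  obtain ⟨t, ht⟩ := hsol.dom.exists_isSliceSeq
  have ha := hV.a_pos
  have hdecay := lyapunov_le hV hsol hT₁ hT hlt hw hη hs
  grw [hV.self_le _ (timer_mem hsol ht hT₁ hT ht.zero_mem),
    ← hV.le_self _ (timer_mem hsol ht hT₁ hT hs)] at hdecay
  rw [← mul_le_mul_iff_right₀ ha]
  refine hdecay.trans_eq ?_
  rw [errGain]
  field_simp

theorem infDist_errSet_le_max (hV : P.IsLyapunov L H T₂ lt γ V a b)
    (hsol : (P.errSystem L H T₁ T₂).IsSolutionPair E φ u) (hT₁ : 0 < T₁) (hT : T₁ ≤ T₂)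
    (hlt : 0 < lt) (hu : linfNorm E u < ∞) (hs : (s, j) ∈ E) :
    Metric.infDist (φ s j) (errSet nz ny T₂) ≤
      max (√(2 * (b / a)) * (Real.exp (lt / (1 + 1 / T₁)) *
          Real.exp (-(lt / (1 + 1 / T₁)) * (s + j)) * Metric.infDist (φ 0 0) (errSet nz ny T₂)))
        (√(2 * errGain T₁ lt γ a b) * (linfNorm E u).toNNReal) := by
  obtain ⟨t, ht⟩ := hsol.dom.exists_isSliceSeq
  have ha := hV.a_pos
  have hb := hV.b_pos
  have hw : ∀ j, ∀ᵐ s ∂(volume.restrict (slice E j)),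
      ‖(u s j).fst‖ ≤ (linfNorm E u).toNNReal := fun j =>
    (ae_enorm_le_linfNorm u ht j).mono fun s hs =>
      (WithLp.norm_fst_le _ (u s j)).trans (norm_le_toNNReal_of_enorm_le hu.ne hs)
  have hη : ∀ s j, (s, j) ∈ jumpTimes E → ‖(u s j).snd‖ ≤ (linfNorm E u).toNNReal := fun s j hj =>
    (WithLp.norm_snd_le _ (u s j)).trans
      (norm_le_toNNReal_of_enorm_le hu.ne (enorm_le_linfNorm_of_mem_jumpTimes u hj))
  have herr := error_sq_le hV hsol hT₁ hT hlt hw hη hs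
  rw [← ErrState.infDist_errSet_sq (timer_mem hsol ht hT₁ hT hs),
    ← ErrState.infDist_errSet_sq (timer_mem hsol ht hT₁ hT ht.zero_mem)] at herr
  refine le_max_sqrt_two_mul_of_sq_le (by positivity)
    (mul_nonneg (by positivity) Metric.infDist_nonneg) (hV.errGain_nonneg hT₁ hlt)
    NNReal.zero_le_coe (herr.trans ?_)
  rw [mul_pow _ (Metric.infDist _ _), ← mul_assoc]
  gcongr
  exact exp_neg_two_mul_le_of_mul_sub_one_le hlt hT₁ (mul_sub_one_le hsol ht hT₁ hs)

theorem isPreEISS (hV : P.IsLyapunov L H T₂ lt γ V a b) (hT₁ : 0 < T₁) (hT : T₁ ≤ T₂)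
    (hlt : 0 < lt) : (P.errSystem L H T₁ T₂).IsPreEISS (errSet nz ny T₂) := by
  have ha := hV.a_pos
  have hb := hV.b_pos
  -- the summand `1` makes `ρ` strictly increasing even if the gain vanishes
  set k : ℝ≥0 := Real.toNNReal √(2 * errGain T₁ lt γ a b) + 1
  refine ⟨√(2 * (b / a)) * Real.exp (lt / (1 + 1 / T₁)), lt / (1 + 1 / T₁), fun r => k * r,
    by positivity, by positivity, by fun_prop, strictMono_mul_left_of_pos (by positivity),
    mul_zero k, fun E φ u hsol hu s j hs => ?_⟩
  refine (infDist_errSet_le_max hV hsol hT₁ hT hlt hu hs).trans (max_le_max ?_ ?_)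
  · simp only [mul_assoc, le_refl]
  · push_cast
    gcongr
    exact (Real.le_coe_toNNReal _).trans (le_add_of_nonneg_right zero_le_one)

end Estimates

end Plant

/-! ### The `L²` gain -/

theorem intervalIntegrable_norm_sq_of_isHybridInput {U : Type*} [NormedAddCommGroup U]
    {E : Set (ℝ × ℕ)} {u : ℝ → ℕ → U} (hu : IsHybridInput E u) {j : ℕ} {c d : ℝ} (hcd : c ≤ d)
    (h : Icc c d ⊆ slice E j) : IntervalIntegrable (fun s => ‖u s j‖ ^ 2) volume c d := by
  obtain ⟨hm, hbdd⟩ := hu j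
  obtain ⟨M, hM⟩ := hbdd d
  have hsub : Ioc c d ⊆ slice E j ∩ Iic d := fun s hs => ⟨h (Ioc_subset_Icc_self hs), hs.2⟩
  rw [intervalIntegrable_iff_integrableOn_Ioc_of_le hcd]
  refine Integrable.of_bound ((hm.mono_set (hsub.trans inter_subset_left)).norm.pow 2) (M ^ 2) ?_
  filter_upwards [ae_restrict_of_ae_restrict_of_subset hsub hM] with s hs
  rw [norm_pow, norm_norm]
  gcongr

theorem isHybridInput_fst {U₁ U₂ : Type*} [NormedAddCommGroup U₁] [NormedAddCommGroup U₂]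
    {E : Set (ℝ × ℕ)} {u : ℝ → ℕ → WithLp 2 (U₁ × U₂)} (hu : IsHybridInput E u) :
    IsHybridInput E fun s j => (u s j).fst := by
  refine fun j => ⟨(WithLp.continuous_fst 2 U₁ U₂).comp_aestronglyMeasurable (hu j).1, fun T => ?_⟩
  obtain ⟨M, hM⟩ := (hu j).2 T
  exact ⟨M, hM.mono fun s hs => (WithLp.norm_fst_le _ _).trans hs⟩

theorem setLIntegral_enorm_sq_eq_ofReal_integral {F : Type*} [NormedAddCommGroup F] {f : ℝ → F}
    {c d : ℝ} (hcd : c ≤ d) (hf : IntervalIntegrable (fun s => ‖f s‖ ^ 2) volume c d) :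
    ∫⁻ s in Icc c d, ‖f s‖ₑ ^ 2 = ENNReal.ofReal (∫ s in c..d, ‖f s‖ ^ 2) := by
  rw [intervalIntegral.integral_of_le hcd, ofReal_integral_eq_lintegral_ofReal
    ((intervalIntegrable_iff_integrableOn_Ioc_of_le hcd).1 hf)
    (Eventually.of_forall fun s => sq_nonneg _), restrict_Ioc_eq_restrict_Icc]
  exact lintegral_congr fun s => by rw [ENNReal.ofReal_pow (norm_nonneg _), ofReal_norm]

theorem tsum_le_add_tsum_of_forall_add_le {x y v : ℕ → ℝ≥0∞}
    (h : ∀ j, x j + v (j + 1) ≤ v j + y j) : ∑' j, x j ≤ v 0 + ∑' j, y j := by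
  have hsum : ∀ n, ∑ j ∈ Finset.range n, x j + v n ≤ v 0 + ∑ j ∈ Finset.range n, y j := by
    intro n
    induction n with
    | zero => simp
    | succ n ih =>
      calc ∑ j ∈ Finset.range (n + 1), x j + v (n + 1)
          = ∑ j ∈ Finset.range n, x j + (x n + v (n + 1)) := by
            rw [Finset.sum_range_succ, add_assoc]
        _ ≤ ∑ j ∈ Finset.range n, x j + v n + y n := by
            grw [h n, add_assoc]
        _ ≤ v 0 + ∑ j ∈ Finset.range (n + 1), y j := by
            rw [Finset.sum_range_succ, ← add_assoc]
            gcongr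
  refine ENNReal.tsum_le_of_sum_range_le fun n => le_self_add.trans ((hsum n).trans ?_)
  gcongr
  exact ENNReal.sum_le_tsum _

namespace Plant

variable {nz nw ny ns nq np : ℕ}

section Gain

variable {P : Plant nz nw ny ns nq np} {L : Matrix (Fin nz) (Fin ny) ℝ}
  {H : Matrix (Fin ny) (Fin ny) ℝ} {T₁ T₂ lt γ : ℝ} {V : ErrState nz ny → ℝ} {a b : ℝ}
  {E : Set (ℝ × ℕ)} {φ : ℝ → ℕ → ErrState nz ny} {u : ℝ → ℕ → WithLp 2 (Eu nw × Eu ny)}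
  {t : ℕ → ℝ} {c d : ℝ} {j : ℕ}

theorem setLIntegral_output_add_lyapunov_le (hV : P.IsLyapunov L H T₂ lt γ V a b)
    (hsol : (P.errSystem L H T₁ T₂).IsSolutionPair E φ u) (ht : IsSliceSeq E t)
    (hT₁ : 0 < T₁) (hT : T₁ ≤ T₂) (hlt : 0 < lt) (hcd : c ≤ d) (h : Icc c d ⊆ slice E j) :
    (∫⁻ s in Icc c d, ‖mulE P.Cp (φ s j).ε‖ₑ ^ 2) + ENNReal.ofReal (V (φ d j)) ≤
      ENNReal.ofReal (V (φ c j)) +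
        ENNReal.ofReal (γ ^ 2) * ∫⁻ s in Icc c d, ‖(u s j).fst‖ₑ ^ 2 := by
  have hVnn : ∀ s ∈ Icc c d, 0 ≤ V (φ s j) := fun s hs =>
    hV.nonneg (timer_mem hsol ht hT₁ hT (h hs))
  have hY : IntervalIntegrable (fun s => ‖mulE P.Cp (φ s j).ε‖ ^ 2) volume c d := by
    refine ContinuousOn.intervalIntegrable_of_Icc hcd ?_
    exact (((mulL P.Cp).continuous.comp ErrState.εL.continuous).comp_continuousOn
      (hsol.arc.continuousOn_Icc hcd h)).norm.pow 2
  have hW := intervalIntegrable_norm_sq_of_isHybridInput (isHybridInput_fst hsol.input) hcd h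
  have hdiss : V (φ d j) - V (φ c j) ≤
      ∫ s in c..d, (γ ^ 2 * ‖(u s j).fst‖ ^ 2 - ‖mulE P.Cp (φ s j).ε‖ ^ 2) := by
    refine sub_le_integral_of_ae_hasDerivAt_le hcd
      (absolutelyContinuousOnInterval_lyapunov hV hsol hcd h) ?_ ((hW.const_mul _).sub hY)
    filter_upwards [ae_hasDerivAt_lyapunov_le hV hsol ht hT₁ hT h,
      ae_restrict_mem measurableSet_Icc] with s ⟨v, hder, hv⟩ hs
    exact ⟨v, hder, by linarith [mul_nonneg hlt.le (hVnn s hs)]⟩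
  rw [intervalIntegral.integral_sub (hW.const_mul _) hY,
    intervalIntegral.integral_const_mul] at hdiss
  have hYnn := intervalIntegral.integral_nonneg (μ := volume) hcd fun s _ =>
    sq_nonneg ‖mulE P.Cp (φ s j).ε‖
  have hWnn := intervalIntegral.integral_nonneg (μ := volume) hcd fun s _ =>
    sq_nonneg ‖(u s j).fst‖
  rw [setLIntegral_enorm_sq_eq_ofReal_integral hcd hY,
    setLIntegral_enorm_sq_eq_ofReal_integral hcd hW, ← ENNReal.ofReal_mul (sq_nonneg γ),
    ← ENNReal.ofReal_add hYnn (hVnn d (right_mem_Icc.2 hcd)),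
    ← ENNReal.ofReal_add (hVnn c (left_mem_Icc.2 hcd)) (by positivity)]
  exact ENNReal.ofReal_le_ofReal (by linarith)

theorem setLIntegral_slice_output_add_lyapunov_le (hV : P.IsLyapunov L H T₂ lt γ V a b)
    (hsol : (P.errSystem L H T₁ T₂).IsSolutionPair E φ u) (ht : IsSliceSeq E t)
    (hT₁ : 0 < T₁) (hT : T₁ ≤ T₂) (hlt : 0 < lt) (hη : ∀ t j, (t, j) ∈ E → (u t j).snd = 0)
    (hj : (slice E (j + 1)).Nonempty) :
    (∫⁻ s in slice E j, ‖mulE P.Cp (φ s j).ε‖ₑ ^ 2) +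
        ENNReal.ofReal (V (φ (t (j + 1)) (j + 1))) ≤
      ENNReal.ofReal (V (φ (t j) j)) +
        ENNReal.ofReal (γ ^ 2) * ∫⁻ s in slice E j, ‖(u s j).fst‖ₑ ^ 2 := by
  have hjump := lyapunov_jump_le hV hsol ht hT₁ hT hj
  rw [hη _ _ (ht.mem_jumpTimes hj).1, norm_zero, zero_pow two_ne_zero, mul_zero, add_zero] at hjump
  rw [ht.slice_eq_Icc j hj]
  refine le_trans ?_ (setLIntegral_output_add_lyapunov_le hV hsol ht hT₁ hT hlt (ht.mono j.le_succ)
    (ht.slice_eq_Icc j hj).ge)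
  gcongr

theorem setLIntegral_slice_output_le (hV : P.IsLyapunov L H T₂ lt γ V a b)
    (hsol : (P.errSystem L H T₁ T₂).IsSolutionPair E φ u) (ht : IsSliceSeq E t)
    (hT₁ : 0 < T₁) (hT : T₁ ≤ T₂) (hlt : 0 < lt) :
    ∫⁻ s in slice E j, ‖mulE P.Cp (φ s j).ε‖ₑ ^ 2 ≤
      ENNReal.ofReal (V (φ (t j) j)) +
        ENNReal.ofReal (γ ^ 2) * ∫⁻ s in slice E j, ‖(u s j).fst‖ₑ ^ 2 := by
  refine lintegral_le_of_forall_lintegral_Icc_le (ht.ordConnected j) (fun s hs => ht.left_le hs)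
    fun s hs => le_self_add.trans <| (setLIntegral_output_add_lyapunov_le hV hsol ht hT₁ hT hlt
      (ht.left_le hs) (ht.Icc_subset hs)).trans ?_
  gcongr
  exact ht.Icc_subset hs

theorem lintegral_output_le (hV : P.IsLyapunov L H T₂ lt γ V a b)
    (hsol : (P.errSystem L H T₁ T₂).IsSolutionPair E φ u) (hT₁ : 0 < T₁) (hT : T₁ ≤ T₂)
    (hlt : 0 < lt) (hη : ∀ t j, (t, j) ∈ E → (u t j).snd = 0) :
    ∫⁻ s in domT E, ‖mulE P.Cp (φ s (jmin E s)).ε‖ₑ ^ 2 ≤ ENNReal.ofReal (V (φ 0 0)) +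
      ENNReal.ofReal (γ ^ 2) * ∫⁻ s in domT E, ‖(u s (jmin E s)).fst‖ₑ ^ 2 := by
  classical
  obtain ⟨t, ht⟩ := hsol.dom.exists_isSliceSeq
  set v : ℕ → ℝ≥0∞ :=
    fun j => if (slice E j).Nonempty then ENNReal.ofReal (V (φ (t j) j)) else 0 with hv
  have hv0 : v 0 = ENNReal.ofReal (V (φ 0 0)) := by
    simp only [hv, if_pos ht.nonempty, ht.zero]
  rw [ht.lintegral_domT fun s j => ‖mulE P.Cp (φ s j).ε‖ₑ ^ 2,
    ht.lintegral_domT fun s j => ‖(u s j).fst‖ₑ ^ 2, ← hv0, ← ENNReal.tsum_mul_left]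
  refine tsum_le_add_tsum_of_forall_add_le fun j => ?_
  by_cases hsucc : (slice E (j + 1)).Nonempty
  · simp only [hv, if_pos hsucc, if_pos (ht.nonempty_of_le j.le_succ hsucc)]
    exact setLIntegral_slice_output_add_lyapunov_le hV hsol ht hT₁ hT hlt hη hsucc
  by_cases hj : (slice E j).Nonempty
  · simp only [hv, if_neg hsucc, if_pos hj, add_zero]
    exact setLIntegral_slice_output_le hV hsol ht hT₁ hT hlt
  · simp [not_nonempty_iff_eq_empty.1 hj, hv, hsucc]

theorem l2_gain_errSystem (hV : P.IsLyapunov L H T₂ lt γ V a b)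
    (hsol : (P.errSystem L H T₁ T₂).IsSolutionPair E φ u) (hT₁ : 0 < T₁) (hT : T₁ ≤ T₂)
    (hlt : 0 < lt) (hγ : 0 < γ) (hη : ∀ t j, (t, j) ∈ E → (u t j).snd = 0) :
    (∫⁻ s in domT E, ‖mulE P.Cp (φ s (jmin E s)).ε‖ₑ ^ 2) ^ (1 / 2 : ℝ) ≤
      ENNReal.ofReal (√b * Metric.infDist (φ 0 0) (errSet nz ny T₂)) +
        ENNReal.ofReal γ * (∫⁻ s in domT E, ‖(u s (jmin E s)).fst‖ₑ ^ 2) ^ (1 / 2 : ℝ) := by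
  obtain ⟨t, ht⟩ := hsol.dom.exists_isSliceSeq
  have hτ := timer_mem hsol ht hT₁ hT ht.zero_mem
  have hhalf : (0 : ℝ) ≤ 1 / 2 := by norm_num
  have hinit : ENNReal.ofReal (V (φ 0 0)) ^ (1 / 2 : ℝ) ≤
      ENNReal.ofReal (√b * Metric.infDist (φ 0 0) (errSet nz ny T₂)) := by
    rw [ENNReal.ofReal_rpow_of_nonneg (hV.nonneg hτ) hhalf, ← Real.sqrt_eq_rpow,
      ErrState.infDist_errSet hτ, ← Real.sqrt_mul hV.b_pos.le]
    exact ENNReal.ofReal_le_ofReal (Real.sqrt_le_sqrt (hV.self_le _ hτ))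
  have hgain : ENNReal.ofReal (γ ^ 2) ^ (1 / 2 : ℝ) = ENNReal.ofReal γ := by
    rw [ENNReal.ofReal_rpow_of_nonneg (sq_nonneg _) hhalf, ← Real.sqrt_eq_rpow, Real.sqrt_sq hγ.le]
  grw [lintegral_output_le hV hsol hT₁ hT hlt hη,
    ENNReal.rpow_add_le_add_rpow _ _ hhalf (by norm_num), hinit,
    ENNReal.mul_rpow_of_nonneg _ _ hhalf, hgain]

end Gain

end Plant

/-- Lipschitz continuity with an unspecified constant. -/
def IsLip {X Y : Type*} [SeminormedAddCommGroup X] [SeminormedAddCommGroup Y] (f : X → Y) : Prop :=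
  ∃ K, LipschitzWith K f

namespace IsLip

variable {X Y Z : Type*} [SeminormedAddCommGroup X] [SeminormedAddCommGroup Y]
  [SeminormedAddCommGroup Z]

theorem continuous {f : X → Y} (hf : IsLip f) : Continuous f :=
  let ⟨_, h⟩ := hf; h.continuous

theorem comp {g : Y → Z} {f : X → Y} (hg : IsLip g) (hf : IsLip f) : IsLip fun x => g (f x) :=
  let ⟨_, h⟩ := hg; let ⟨_, h'⟩ := hf; ⟨_, h.comp h'⟩

theorem add {f g : X → Y} (hf : IsLip f) (hg : IsLip g) : IsLip fun x => f x + g x :=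
  let ⟨_, h⟩ := hf; let ⟨_, h'⟩ := hg; ⟨_, h.add h'⟩

theorem sub {f g : X → Y} (hf : IsLip f) (hg : IsLip g) : IsLip fun x => f x - g x :=
  let ⟨_, h⟩ := hf; let ⟨_, h'⟩ := hg; ⟨_, h.sub h'⟩

theorem prodMk {f : X → Y} {g : X → Z} (hf : IsLip f) (hg : IsLip g) :
    IsLip fun x => (f x, g x) :=
  let ⟨_, h⟩ := hf; let ⟨_, h'⟩ := hg; ⟨_, h.prodMk h'⟩

theorem id : IsLip fun x : X => x := ⟨_, LipschitzWith.id⟩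

theorem fst : IsLip fun p : X × Y => p.1 := ⟨_, LipschitzWith.prod_fst⟩

theorem snd : IsLip fun p : X × Y => p.2 := ⟨_, LipschitzWith.prod_snd⟩

theorem const (y : Y) : IsLip fun _ : X => y := ⟨_, LipschitzWith.const y⟩

theorem clm [NormedSpace ℝ Y] [NormedSpace ℝ Z] (A : Y →L[ℝ] Z) : IsLip A := ⟨_, A.lipschitz⟩

theorem mulE {m n : ℕ} (M : Matrix (Fin m) (Fin n) ℝ) {f : X → Eu n} (hf : IsLip f) :
    IsLip fun x => _root_.mulE M (f x) := (clm (mulL M)).comp hf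

theorem exists_norm_le {f : X → Y} (hf : IsLip f) : ∃ c, 0 < c ∧ ∀ x, ‖f x‖ ≤ c * (‖x‖ + 1) := by
  obtain ⟨K, hK⟩ := hf
  refine ⟨K + ‖f 0‖ + 1, by positivity, fun x => ?_⟩
  have hx : ‖f x - f 0‖ ≤ K * ‖x‖ := by simpa using hK.norm_sub_le x 0
  calc ‖f x‖ ≤ ‖f x - f 0‖ + ‖f 0‖ := norm_le_norm_sub_add _ _
    _ ≤ K * ‖x‖ + ‖f 0‖ := by grw [hx]
    _ ≤ (K + ‖f 0‖ + 1) * (‖x‖ + 1) := by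
      nlinarith [norm_nonneg x, mul_nonneg (norm_nonneg (f 0)) (norm_nonneg x), K.coe_nonneg]

end IsLip

namespace Plant

variable {nz nw ny ns nq np : ℕ} {P : Plant nz nw ny ns nq np}

theorem isLip_psi {ℓ : ℝ} (hℓ : 0 ≤ ℓ) (hψ : ∀ v₁ v₂, ‖P.ψ v₁ - P.ψ v₂‖ ≤ ℓ * ‖v₁ - v₂‖) :
    IsLip P.ψ :=
  ⟨⟨ℓ, hℓ⟩, LipschitzWith.of_dist_le_mul fun x y => by
    rw [dist_eq_norm, dist_eq_norm]
    exact hψ x y⟩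

theorem isLip_errFlow (L : Matrix (Fin nz) (Fin ny) ℝ) (H : Matrix (Fin ny) (Fin ny) ℝ)
    (hψ : IsLip P.ψ) : IsLip fun p : ErrState nz ny × Eu nw => P.errFlow L H p.1 p.2 := by
  have hz : IsLip fun p : ErrState nz ny × Eu nw => p.1.z := (IsLip.clm ErrState.zL).comp .fst
  have hε : IsLip fun p : ErrState nz ny × Eu nw => p.1.ε := (IsLip.clm ErrState.εL).comp .fst
  have hθ : IsLip fun p : ErrState nz ny × Eu nw => p.1.θ := (IsLip.clm ErrState.θL).comp .fst
  have hw : IsLip fun p : ErrState nz ny × Eu nw => p.2 := .snd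
  have hζ : IsLip fun p : ErrState nz ny × Eu nw => P.ζ p.1.z p.1.ε :=
    (hψ.comp (.mulE _ hz)).sub (hψ.comp (.mulE _ (hz.sub hε)))
  have hzdot := ((IsLip.mulE P.A hz).add (.mulE P.B (hψ.comp (.mulE P.S hz)))).add (.mulE P.N hw)
  have hεdot := (((IsLip.mulE (P.A - L * P.C) hε).add (.mulE L hθ)).add (.mulE P.B hζ)).add
    (.mulE P.N hw)
  have hθdot := (((IsLip.mulE (P.C * P.A - P.C * L * P.C - H * P.C) hε).add
    (.mulE (P.C * L + H) hθ)).add (.mulE (P.C * P.B) hζ)).add (.mulE (P.C * P.N) hw)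
  have hmk := (IsLip.clm (ErrState.mkL (nz := nz) (ny := ny))).comp
    (hzdot.prodMk (hεdot.prodMk (hθdot.prodMk (.const (-1)))))
  simpa only [errFlow, ErrState.mkL_apply] using! hmk

end Plant

/-! ### Extension of solution pairs -/

namespace HybridSystem

section Lipschitz

variable {X W Y : Type*} [NormedAddCommGroup X] [NormedAddCommGroup W] [NormedAddCommGroup Y]
  {S : HybridSystem X W Y} {E : Set (ℝ × ℕ)} {φ : ℝ → ℕ → X}
  {u : ℝ → ℕ → WithLp 2 (W × Y)} {t : ℕ → ℝ}

theorem exists_ae_norm_flowMap_le (hS : IsLip fun p : X × W => S.flowMap p.1 p.2)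
    (hu : IsHybridInput E u) (φ : ℝ → ℕ → X) (j : ℕ) (d : ℝ) :
    ∃ C, 0 < C ∧ ∀ᵐ s ∂(volume.restrict (slice E j ∩ Iic d)),
      ‖S.flowMap (φ s j) (u s j).fst‖ ≤ C * (‖φ s j‖ + 1) := by
  obtain ⟨c, hc, hle⟩ := hS.exists_norm_le
  obtain ⟨w, hw⟩ := (hu j).2 d
  refine ⟨c * (|w| + 1), by positivity, hw.mono fun s hs => ?_⟩
  have hnorm : ‖(φ s j, (u s j).fst)‖ ≤ ‖φ s j‖ + |w| :=
    max_le (le_add_of_nonneg_right (abs_nonneg w)) <| (WithLp.norm_fst_le _ (u s j)).trans <|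
      hs.trans <| (le_abs_self w).trans (le_add_of_nonneg_left (norm_nonneg _))
  calc ‖S.flowMap (φ s j) (u s j).fst‖ ≤ c * (‖φ s j‖ + |w| + 1) :=
        (hle (φ s j, (u s j).fst)).trans (by gcongr)
    _ ≤ c * ((|w| + 1) * (‖φ s j‖ + 1)) := by
        gcongr
        nlinarith [mul_nonneg (abs_nonneg w) (norm_nonneg (φ s j))]
    _ = c * (|w| + 1) * (‖φ s j‖ + 1) := (mul_assoc _ _ _).symm

variable [InnerProductSpace ℝ X] [FiniteDimensional ℝ X]

theorem IsSolutionPair.exists_norm_le_on_slice (hsol : S.IsSolutionPair E φ u)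
    (hS : IsLip fun p : X × W => S.flowMap p.1 p.2) (ht : IsSliceSeq E t) (j : ℕ) (d : ℝ) :
    ∃ M, ∀ s ∈ slice E j ∩ Iic d, ‖φ s j‖ ≤ M := by
  obtain ⟨C, hC, hle⟩ := exists_ae_norm_flowMap_le hS hsol.input φ j d
  refine ⟨√(Real.exp (3 * C * (d - t j)) * (‖φ (t j) j‖ ^ 2 + C / (3 * C))), fun s hs => ?_⟩
  have hsub : Icc (t j) s ⊆ slice E j := ht.Icc_subset hs.1
  have hsub' : Icc (t j) s ⊆ slice E j ∩ Iic d := fun r hr => ⟨hsub hr, hr.2.trans hs.2⟩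
  have hac := absolutelyContinuousOnInterval_comp_of_contDiff (contDiff_norm_sq ℝ)
    (hsol.arc j (t j) s (ht.left_le hs.1) hsub)
  have hder : ∀ᵐ r ∂(volume.restrict (Icc (t j) s)), ∃ v,
      HasDerivAt (fun r => ‖φ r j‖ ^ 2) v r ∧ v ≤ 3 * C * ‖φ r j‖ ^ 2 + C := by
    filter_upwards [ae_restrict_of_ae_restrict_of_subset hsub (hsol.flow j),
      ae_restrict_of_ae_restrict_of_subset hsub' hle]
      with r hr hbound
    refine ⟨_, hr.norm_sq, ?_⟩
    have hinner := (real_inner_le_norm (φ r j) (S.flowMap (φ r j) (u r j).fst)).trans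
      (mul_le_mul_of_nonneg_left hbound (norm_nonneg _))
    nlinarith [sq_nonneg (‖φ r j‖ - 1)]
  refine Real.le_sqrt_of_sq_le ?_
  calc ‖φ s j‖ ^ 2 ≤ ‖φ s j‖ ^ 2 + C / (3 * C) := le_add_of_nonneg_right (by positivity)
    _ ≤ Real.exp (3 * C * (s - t j)) * (‖φ (t j) j‖ ^ 2 + C / (3 * C)) :=
        add_div_le_exp_mul_of_ae_hasDerivAt_le (ht.left_le hs.1) (by positivity) hac hder
    _ ≤ Real.exp (3 * C * (d - t j)) * (‖φ (t j) j‖ ^ 2 + C / (3 * C)) := by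
        gcongr
        exact hs.2

theorem IsSolutionPair.exists_lipschitzOnWith_slice (hsol : S.IsSolutionPair E φ u)
    (hS : IsLip fun p : X × W => S.flowMap p.1 p.2) (j : ℕ) (d : ℝ) :
    ∃ K, LipschitzOnWith K (fun s => φ s j) (slice E j ∩ Iic d) := by
  obtain ⟨t, ht⟩ := hsol.dom.exists_isSliceSeq
  obtain ⟨C, hC, hle⟩ := exists_ae_norm_flowMap_le hS hsol.input φ j d
  obtain ⟨M, hM⟩ := hsol.exists_norm_le_on_slice hS ht j d
  refine ⟨(C * (M + 1)).toNNReal, lipschitzOnWith_of_norm_sub_le fun x hx y hy hxy => ?_⟩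
  have hsub : Icc x y ⊆ slice E j := (ht.ordConnected j).out hx.1 hy.1
  have hsub' : Icc x y ⊆ slice E j ∩ Iic d := fun s hs => ⟨hsub hs, hs.2.trans hy.2⟩
  have hder : ∀ᵐ s ∂(volume.restrict (Icc x y)), ∃ v,
      HasDerivAt (fun s => φ s j) v s ∧ ‖v‖ ≤ C * (M + 1) := by
    filter_upwards [ae_restrict_of_ae_restrict_of_subset hsub (hsol.flow j),
      ae_restrict_of_ae_restrict_of_subset hsub' hle, ae_restrict_mem measurableSet_Icc]
      with s hs hbound hmem
    refine ⟨_, hs, hbound.trans ?_⟩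
    gcongr
    exact hM s (hsub' hmem)
  refine (norm_sub_le_of_ae_hasDerivAt_le hxy (hsol.arc j x y hxy hsub) hder).trans ?_
  have := sub_nonneg.2 hxy
  gcongr
  exact Real.le_coe_toNNReal _

end Lipschitz

end HybridSystem

theorem isHybridInput_indicator {U : Type*} [NormedAddCommGroup U] {E : Set (ℝ × ℕ)}
    {u : ℝ → ℕ → U} (hu : IsHybridInput E u) (hE : ∀ j, MeasurableSet (slice E j))
    (E' : Set (ℝ × ℕ)) :
    IsHybridInput E' fun s j => (slice E j).indicator (fun s => u s j) s := by
  refine fun j => ⟨((aestronglyMeasurable_indicator_iff (hE j)).2 (hu j).1).mono_measure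
    Measure.restrict_le_self, fun T => ?_⟩
  obtain ⟨M, hM⟩ := (hu j).2 T
  rw [ae_restrict_iff' ((hE j).inter measurableSet_Iic)] at hM
  refine ⟨max M 0, ae_restrict_of_ae_restrict_of_subset inter_subset_right
    ((ae_restrict_iff' measurableSet_Iic).2 (hM.mono fun s hs hsT => ?_))⟩
  by_cases hmem : s ∈ slice E j
  · simp only [indicator_of_mem hmem]
    exact (hs ⟨hmem, hsT⟩).trans (le_max_left _ _)
  · simp [hmem]

section FiniteDomain

variable {t : ℕ → ℝ} {J j : ℕ} {b : ℝ}

theorem slice_finiteDomain_of_ne (hj : j ≠ J) (I I' : Set ℝ) :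
    slice (finiteDomain t J I) j = slice (finiteDomain t J I') j := by
  ext s
  simp [finiteDomain, slice, hj]

theorem isHybridTimeDomain_finiteDomain_Icc (h0 : t 0 = 0) (hm : Monotone t) (hb : t J ≤ b) :
    IsHybridTimeDomain (finiteDomain t J (Icc (t J) b)) := by
  have hle : ∀ {k}, k ≤ J → (if k ≤ J then t k else b) = t k := fun h => if_pos h
  refine ⟨fun k => if k ≤ J then t k else b, (hle J.zero_le).trans h0, fun i k hik => ?_,
    Or.inr ⟨J, _, Or.inl rfl, ?_⟩⟩
  · dsimp only
    split_ifs with hi hk hk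
    exacts [hm hik, (hm hi).trans hb, (hi (hik.trans hk)).elim, le_rfl]
  · ext ⟨s, k⟩
    refine or_congr (and_congr_right fun hk => ?_) ?_
    · simp only [hle (Nat.succ_le_of_lt hk), hle (le_of_lt hk)]
    · simp

end FiniteDomain

namespace HybridSystem

section Extension

variable {X W Y : Type*} [NormedAddCommGroup X] [NormedSpace ℝ X] [NormedAddCommGroup W]
  [NormedAddCommGroup Y] {S : HybridSystem X W Y} {E E' : Set (ℝ × ℕ)} {φ : ℝ → ℕ → X}
  {u : ℝ → ℕ → WithLp 2 (W × Y)} {χ : ℝ → X} {k : ℕ}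

/-- `(φ, u)` is a proper restriction of another solution pair. -/
def IsExtendable (S : HybridSystem X W Y) (E : Set (ℝ × ℕ)) (φ : ℝ → ℕ → X)
    (u : ℝ → ℕ → WithLp 2 (W × Y)) : Prop :=
  ∃ E' φ' u', S.IsSolutionPair E' φ' u' ∧ E ⊆ E' ∧
    (∀ t j, (t, j) ∈ E → φ' t j = φ t j ∧ u' t j = u t j) ∧ E' ≠ E

theorem IsMaximalPair.not_isExtendable (h : S.IsMaximalPair E φ u) : ¬ S.IsExtendable E φ u :=
  fun ⟨E', φ', u', hsol, hsub, hag, hne⟩ => hne (h.2 E' φ' u' hsol hsub hag)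

theorem IsSolutionPair.ae_hasDerivAt_of_eqOn_slice (hsol : S.IsSolutionPair E φ u)
    (hχ : EqOn χ (fun s => φ s k) (slice E k)) :
    ∀ᵐ s ∂(volume.restrict (slice E k)), HasDerivAt χ (S.flowMap (χ s) (u s k).fst) s := by
  obtain ⟨t, ht⟩ := hsol.dom.exists_isSliceSeq
  filter_upwards [hsol.flow k, ae_mem_interior_of_ordConnected (ht.ordConnected k)] with s hs hint
  rw [hχ (interior_subset hint)]
  refine hs.congr_of_eventuallyEq ?_
  filter_upwards [isOpen_interior.mem_nhds hint] with r hr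
  exact hχ (interior_subset hr)

theorem IsSolutionPair.ae_hasDerivAt_extension (hsol : S.IsSolutionPair E φ u)
    (hE' : IsHybridTimeDomain E') (hk : slice E k ⊆ slice E' k)
    (hχ : EqOn χ (fun s => φ s k) (slice E k))
    (hflow : ∀ᵐ s ∂(volume.restrict (slice E' k \ slice E k)),
      HasDerivAt χ (S.flowMap (χ s) 0) s) :
    ∀ᵐ s ∂(volume.restrict (slice E' k)),
      HasDerivAt χ (S.flowMap (χ s) ((slice E k).indicator (fun s => u s k) s).fst) s := by
  obtain ⟨t, ht⟩ := hsol.dom.exists_isSliceSeq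
  obtain ⟨t', ht'⟩ := hE'.exists_isSliceSeq
  have hmeas := ht.measurableSet_slice k
  rw [← union_sdiff_cancel hk, ae_restrict_union_iff]
  constructor
  · filter_upwards [hsol.ae_hasDerivAt_of_eqOn_slice hχ, ae_restrict_mem hmeas] with s hs hmem
    rwa [indicator_of_mem hmem]
  · filter_upwards [hflow, ae_restrict_mem ((ht'.measurableSet_slice k).diff hmeas)] with s hs hmem
    rwa [indicator_of_notMem hmem.2]

theorem IsSolutionPair.isExtendable_of_slice_ssubset (hsol : S.IsSolutionPair E φ u)
    (hE' : IsHybridTimeDomain E') (hslice : ∀ j, j ≠ k → slice E' j = slice E j)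
    (hlast : slice E (k + 1) = ∅) (hk : slice E k ⊂ slice E' k)
    (hχ : EqOn χ (fun s => φ s k) (slice E k))
    (harc : ∀ a b, a ≤ b → Icc a b ⊆ slice E' k → AbsolutelyContinuousOnInterval χ a b)
    (hmem : ∀ s ∈ interior (slice E' k) \ interior (slice E k), χ s ∈ S.flowSet)
    (hflow : ∀ᵐ s ∂(volume.restrict (slice E' k \ slice E k)),
      HasDerivAt χ (S.flowMap (χ s) 0) s)
    (hjump : ∀ s j, j + 1 = k → s ∈ slice E j → s ∈ slice E' k \ slice E k →
      φ s j ∈ S.jumpSet ∧ χ s ∈ S.jumpMap (φ s j) (u s j).snd) :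
    S.IsExtendable E φ u := by
  obtain ⟨t, ht⟩ := hsol.dom.exists_isSliceSeq
  have hagree : ∀ s j, s ∈ slice E j → Function.update (φ s) k (χ s) j = φ s j := by
    intro s j hs
    rcases eq_or_ne j k with rfl | hj
    · rw [Function.update_self, hχ hs]
    · rw [Function.update_of_ne hj]
  refine ⟨E', fun s => Function.update (φ s) k (χ s),
    fun s j => (slice E j).indicator (fun s => u s j) s,
    ⟨hE', fun j => ?arc, isHybridInput_indicator hsol.input ht.measurableSet_slice E',
      (hagree 0 0 ht.zero_mem).symm ▸ hsol.init, fun j s hs => ?mem, fun j => ?flow,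
      fun s j hs => ?jump⟩,
    fun ⟨s, j⟩ hs => ?sub, fun s j hs => ⟨hagree s j hs, ?input⟩,
    fun h => hk.ne (h ▸ rfl)⟩
  case sub =>
    rcases eq_or_ne j k with rfl | hj
    exacts [hk.subset hs, (hslice j hj).ge hs]
  case input => exact indicator_of_mem (s := slice E j) hs _
  case arc =>
    rcases eq_or_ne j k with rfl | hj
    · simpa only [Function.update_self] using harc
    · simpa only [Function.update_of_ne hj, hslice j hj] using hsol.arc j
  case mem =>
    by_cases hint : s ∈ interior (slice E j)
    · exact (hagree s j (interior_subset hint)).symm ▸ hsol.flow_mem j s hint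
    · rcases eq_or_ne j k with rfl | hj
      · simpa only [Function.update_self] using hmem s ⟨hs, hint⟩
      · exact (hint (hslice j hj ▸ hs)).elim
  case flow =>
    rcases eq_or_ne j k with rfl | hj
    · simpa only [Function.update_self] using hsol.ae_hasDerivAt_extension hE' hk.subset hχ hflow
    · simp only [Function.update_of_ne hj, hslice j hj]
      filter_upwards [hsol.flow j, ae_restrict_mem (ht.measurableSet_slice j)] with s hs hsE
      rwa [indicator_of_mem hsE]
  case jump =>
    have hj : j ≠ k := by
      rintro rfl
      have hsucc : s ∈ slice E (j + 1) := (hslice _ (Nat.succ_ne_self j)).le hs.2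
      rwa [hlast] at hsucc
    have hsE : s ∈ slice E j := (hslice j hj).le hs.1
    rw [hagree s j hsE, indicator_of_mem hsE]
    by_cases hs' : s ∈ slice E (j + 1)
    · rw [hagree s (j + 1) hs']
      exact hsol.jump s j ⟨hsE, hs'⟩
    · obtain rfl : j + 1 = k := by_contra fun h => hs' ((hslice _ h).le hs.2)
      simpa only [Function.update_self] using hjump s j rfl hsE ⟨hs.2, hs'⟩

variable {t : ℕ → ℝ} {J : ℕ} {I : Set ℝ} {b : ℝ} {K : ℝ≥0}

theorem IsSolutionPair.isExtendable_of_lipschitzOnWith (h0 : t 0 = 0) (hm : Monotone t)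
    (hsol : S.IsSolutionPair (finiteDomain t J I) φ u) (hJ : t J ∈ I) (hI : I ⊂ Icc (t J) b)
    (hχ : EqOn χ (fun s => φ s J) I) (hlip : LipschitzOnWith K χ (Icc (t J) b))
    (hmem : ∀ s ∈ Ioo (t J) b \ interior I, χ s ∈ S.flowSet)
    (hflow : ∀ᵐ s ∂(volume.restrict (Icc (t J) b \ I)), HasDerivAt χ (S.flowMap (χ s) 0) s) :
    S.IsExtendable (finiteDomain t J I) φ u := by
  have hslice := slice_finiteDomain_self t J
  refine hsol.isExtendable_of_slice_ssubset (E' := finiteDomain t J (Icc (t J) b)) (k := J) (χ := χ)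
    (isHybridTimeDomain_finiteDomain_Icc h0 hm (hI.subset hJ).2)
    (fun j hj => slice_finiteDomain_of_ne hj _ _) (slice_finiteDomain_of_gt J.lt_succ_self)
    ?_ ?_ ?_ ?_ ?_ ?_ <;> simp only [hslice]
  · exact hI
  · exact hχ
  · intro a c hac hsub
    exact (hlip.mono (uIcc_of_le hac ▸ hsub)).absolutelyContinuousOnInterval
  · rwa [interior_Icc]
  · exact hflow
  · rintro s j rfl hs ⟨hs', hsI⟩
    rw [slice_finiteDomain_of_lt j.lt_succ_self] at hs
    exact (hsI (le_antisymm hs.2 hs'.1 ▸ hJ)).elim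

theorem IsSolutionPair.isExtendable_of_jump (h0 : t 0 = 0) (hm : Monotone t)
    (hsol : S.IsSolutionPair (finiteDomain t J (Icc (t J) (t (J + 1)))) φ u)
    (hD : φ (t (J + 1)) J ∈ S.jumpSet) {g : X}
    (hg : g ∈ S.jumpMap (φ (t (J + 1)) J) (u (t (J + 1)) J).snd) :
    S.IsExtendable (finiteDomain t J (Icc (t J) (t (J + 1)))) φ u := by
  have hempty : slice (finiteDomain t J (Icc (t J) (t (J + 1)))) (J + 1) = ∅ :=
    slice_finiteDomain_of_gt J.lt_succ_self
  have hsingle : slice (finiteDomain t (J + 1) (Icc (t (J + 1)) (t (J + 1)))) (J + 1) =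
      {t (J + 1)} := by
    rw [slice_finiteDomain_self, Icc_self]
  refine hsol.isExtendable_of_slice_ssubset (k := J + 1) (χ := fun _ => g)
    (E' := finiteDomain t (J + 1) (Icc (t (J + 1)) (t (J + 1))))
    (isHybridTimeDomain_finiteDomain_Icc h0 hm le_rfl) (fun j hj => ?_)
    (slice_finiteDomain_of_gt (by lia)) ?_ ?_
    (fun a b _ _ => ((LipschitzWith.const g).lipschitzOnWith).absolutelyContinuousOnInterval)
    ?_ ?_ ?_
  · rcases lt_trichotomy j J with h | rfl | h
    · rw [slice_finiteDomain_of_lt h, slice_finiteDomain_of_lt (by lia)]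
    · rw [slice_finiteDomain_self, slice_finiteDomain_of_lt j.lt_succ_self]
    · rw [slice_finiteDomain_of_gt h, slice_finiteDomain_of_gt (by lia)]
  · rw [hempty, hsingle]
    exact empty_ssubset.2 (singleton_nonempty _)
  · rw [hempty]
    exact eqOn_empty _ _
  · rw [hsingle, interior_singleton, empty_sdiff]
    exact fun s hs => hs.elim
  · rw [hsingle, hempty, sdiff_empty, Measure.restrict_eq_zero.2 Real.volume_singleton]
    exact ae_zero.le trivial
  · rintro s j hj - ⟨hs, -⟩
    obtain rfl : j = J := Nat.succ_injective hj
    rw [hsingle] at hs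
    exact hs ▸ ⟨hD, hg⟩

end Extension

end HybridSystem

theorem lipschitzOnWith_congr {X Y : Type*} [PseudoEMetricSpace X] [PseudoEMetricSpace Y]
    {f g : X → Y} {s : Set X} {K : ℝ≥0} (hf : LipschitzOnWith K f s) (h : EqOn g f s) :
    LipschitzOnWith K g s := fun x hx y hy => by
  rw [h hx, h hy]
  exact hf hx hy

theorem lipschitzOnWith_Icc_of_Icc_of_Icc {E : Type*} [SeminormedAddCommGroup E] {f : ℝ → E}
    {a b c : ℝ} {K : ℝ≥0} (hab : a ≤ b) (hbc : b ≤ c) (hl : LipschitzOnWith K f (Icc a b))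
    (hr : LipschitzOnWith K f (Icc b c)) : LipschitzOnWith K f (Icc a c) := by
  refine lipschitzOnWith_of_norm_sub_le fun x hx y hy hxy => ?_
  have hle : ∀ {s : Set ℝ}, LipschitzOnWith K f s → ∀ x ∈ s, ∀ y ∈ s, x ≤ y →
      ‖f y - f x‖ ≤ K * (y - x) := fun h x hx y hy hxy => by
    simpa only [Real.norm_of_nonneg (sub_nonneg.2 hxy)] using h.norm_sub_le hy hx
  rcases le_total y b with hyb | hby
  · exact hle hl x ⟨hx.1, hxy.trans hyb⟩ y ⟨hy.1, hyb⟩ hxy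
  rcases le_total b x with hbx | hxb
  · exact hle hr x ⟨hbx, hx.2⟩ y ⟨hby, hy.2⟩ hxy
  calc ‖f y - f x‖ ≤ ‖f y - f b‖ + ‖f b - f x‖ := norm_sub_le_norm_sub_add_norm_sub _ _ _
    _ ≤ K * (y - b) + K * (b - x) :=
      add_le_add (hle hr b ⟨le_rfl, hbc⟩ y ⟨hby, hy.2⟩ hby)
        (hle hl x ⟨hx.1, hxb⟩ b ⟨hab, le_rfl⟩ hxb)
    _ = K * (y - x) := by ring

theorem IsLip.exists_lipschitzOnWith_of_hasDerivWithinAt {X : Type*} [NormedAddCommGroup X]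
    [NormedSpace ℝ X] {f : X → X} (hf : IsLip f) {α : ℝ → X} {a : ℝ}
    (hα : ∀ s, a ≤ s → HasDerivWithinAt α (f (α s)) (Ici a) s) (b : ℝ) :
    ∃ K, LipschitzOnWith K α (Icc a b) := by
  obtain ⟨K, hK⟩ := hf
  have hcont : ContinuousOn α (Icc a b) := fun s hs =>
    (hα s hs.1).continuousWithinAt.mono Icc_subset_Ici_self
  obtain ⟨M, hM⟩ :=
    isCompact_Icc.exists_bound_of_continuousOn (hK.continuous.comp_continuousOn hcont)
  exact ⟨_, lipschitzOnWith_Icc_of_hasDerivAt hcont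
    (fun s hs => (hα s hs.1.le).hasDerivAt (Ici_mem_nhds hs.1))
    fun s hs => hM s (Ioo_subset_Icc_self hs)⟩

namespace HybridSystem

section Lipschitz

variable {X W Y : Type*} [NormedAddCommGroup X] [InnerProductSpace ℝ X] [FiniteDimensional ℝ X]
  [NormedAddCommGroup W] [NormedAddCommGroup Y] {S : HybridSystem X W Y} {φ : ℝ → ℕ → X}
  {u : ℝ → ℕ → WithLp 2 (W × Y)} {t : ℕ → ℝ} {J : ℕ}

theorem IsSolutionPair.isExtendable_of_Ico (hS : IsLip fun p : X × W => S.flowMap p.1 p.2)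
    (h0 : t 0 = 0) (hm : Monotone t) (hlt : t J < t (J + 1))
    (hsol : S.IsSolutionPair (finiteDomain t J (Ico (t J) (t (J + 1)))) φ u) :
    S.IsExtendable (finiteDomain t J (Ico (t J) (t (J + 1)))) φ u := by
  have hsub : Ico (t J) (t (J + 1)) ⊆ Icc (t J) (t (J + 1)) := Ico_subset_Icc_self
  obtain ⟨K, hK⟩ := hsol.exists_lipschitzOnWith_slice hS J (t (J + 1))
  rw [slice_finiteDomain_self, inter_eq_left.2 fun s hs => hs.2.le] at hK
  obtain ⟨χ, hχ, heq⟩ := hK.extend_finite_dimension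
  refine hsol.isExtendable_of_lipschitzOnWith h0 hm (left_mem_Ico.2 hlt)
    (ssubset_iff_subset_ne.2 ⟨hsub, fun h => ?_⟩) heq.symm hχ.lipschitzOnWith ?_ ?_
  · exact lt_irrefl _ (h.ge (right_mem_Icc.2 hlt.le)).2
  · rw [interior_Ico, sdiff_self]
    exact fun s hs => hs.elim
  · rw [Icc_sdiff_Ico_same hlt.le, Measure.restrict_eq_zero.2 Real.volume_singleton]
    exact ae_zero.le trivial

theorem IsSolutionPair.isExtendable_of_flow (hS : IsLip fun p : X × W => S.flowMap p.1 p.2)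
    (h0 : t 0 = 0) (hm : Monotone t)
    (hsol : S.IsSolutionPair (finiteDomain t J (Icc (t J) (t (J + 1)))) φ u) {α : ℝ → X} {δ : ℝ}
    (hδ : 0 < δ) (hα₀ : α (t (J + 1)) = φ (t (J + 1)) J)
    (hα : ∀ s, t (J + 1) ≤ s → HasDerivWithinAt α (S.flowMap (α s) 0) (Ici (t (J + 1))) s)
    (hmem : ∀ s ∈ Ico (t (J + 1)) (t (J + 1) + δ), α s ∈ S.flowSet) :
    S.IsExtendable (finiteDomain t J (Icc (t J) (t (J + 1)))) φ u := by
  have hle : t J ≤ t (J + 1) := hm J.le_succ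
  have hδ' : t (J + 1) ≤ t (J + 1) + δ := le_add_of_nonneg_right hδ.le
  set χ : ℝ → X := fun s => if s ≤ t (J + 1) then φ s J else α s
  have hχl : EqOn χ (fun s => φ s J) (Icc (t J) (t (J + 1))) := fun s hs => if_pos hs.2
  have hχr : EqOn χ α (Icc (t (J + 1)) (t (J + 1) + δ)) := fun s hs => by
    rcases hs.1.eq_or_lt with rfl | h
    exacts [(if_pos le_rfl).trans hα₀.symm, if_neg h.not_ge]
  obtain ⟨K₁, hK₁⟩ := hsol.exists_lipschitzOnWith_slice hS J (t (J + 1))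
  rw [slice_finiteDomain_self, inter_eq_left.2 fun s hs => hs.2] at hK₁
  obtain ⟨K₂, hK₂⟩ :=
    (hS.comp (.prodMk .id (.const 0))).exists_lipschitzOnWith_of_hasDerivWithinAt hα (t (J + 1) + δ)
  have hlip : LipschitzOnWith (max K₁ K₂) χ (Icc (t J) (t (J + 1) + δ)) :=
    lipschitzOnWith_Icc_of_Icc_of_Icc hle hδ'
      ((lipschitzOnWith_congr hK₁ hχl).weaken (le_max_left _ _))
      ((lipschitzOnWith_congr hK₂ hχr).weaken (le_max_right _ _))
  refine hsol.isExtendable_of_lipschitzOnWith h0 hm (left_mem_Icc.2 hle)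
    (Icc_ssubset_Icc_right (hle.trans hδ') le_rfl (lt_add_of_pos_right _ hδ)) hχl hlip ?_ ?_
  · rw [interior_Icc]
    rintro s ⟨hs, hs'⟩
    have hsd : t (J + 1) ≤ s := not_lt.1 fun h => hs' ⟨hs.1, h⟩
    rw [hχr ⟨hsd, hs.2.le⟩]
    exact hmem s ⟨hsd, hs.2⟩
  · refine (ae_restrict_mem (measurableSet_Icc.diff measurableSet_Icc)).mono fun s ⟨hs, hs'⟩ => ?_
    have hsd : t (J + 1) < s := not_le.1 fun h => hs' ⟨hs.1, h⟩
    rw [hχr ⟨hsd.le, hs.2⟩]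
    refine ((hα s hsd.le).hasDerivAt (Ici_mem_nhds hsd)).congr_of_eventuallyEq ?_
    filter_upwards [Ioi_mem_nhds hsd] with r hr
    exact if_neg hr.not_ge

end Lipschitz

end HybridSystem

namespace Plant

variable {nz nw ny ns nq np : ℕ} {P : Plant nz nw ny ns nq np} {L : Matrix (Fin nz) (Fin ny) ℝ}
  {H : Matrix (Fin ny) (Fin ny) ℝ} {T₁ T₂ : ℝ} {φ : ℝ → ℕ → ErrState nz ny}
  {u : ℝ → ℕ → WithLp 2 (Eu nw × Eu ny)}

theorem exists_flow (hψ : IsLip P.ψ) (L : Matrix (Fin nz) (Fin ny) ℝ)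
    (H : Matrix (Fin ny) (Fin ny) ℝ) (d : ℝ) (x₀ : ErrState nz ny) :
    ∃ α : ℝ → ErrState nz ny, α d = x₀ ∧
      (∀ s, d ≤ s → HasDerivWithinAt α (P.errFlow L H (α s) 0) (Ici d) s) ∧
      ∀ s, d ≤ s → (α s).τ = x₀.τ - (s - d) := by
  have : CompleteSpace (ErrState nz ny) := FiniteDimensional.complete ℝ _
  obtain ⟨K, hK⟩ : IsLip fun x => P.errFlow L H x 0 :=
    (isLip_errFlow (nw := nw) L H hψ).comp (f := fun x => (x, 0)) (.prodMk .id (.const 0))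
  obtain ⟨α, h0, hα⟩ := exists_hasDerivWithinAt_Ici_of_lipschitzWith
    (f := fun _ x => P.errFlow L H x 0) (fun _ => hK) (fun _ => continuous_const) d x₀
  refine ⟨α, h0, hα, fun s hs => ?_⟩
  have hder : ∀ r, d ≤ r → HasDerivWithinAt (fun r => (α r).τ + r) 0 (Ici d) r := fun r hr =>
    ((ErrState.τL.hasFDerivAt.comp_hasDerivWithinAt r (hα r hr)).add
      (hasDerivWithinAt_id r (Ici d))).congr_deriv (neg_add_cancel (1 : ℝ))
  have hconst : (α s).τ + s = (α d).τ + d :=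
    constant_of_has_deriv_right_zero (f := fun r => (α r).τ + r)
      (fun r hr => (hder r hr.1).continuousWithinAt.mono Icc_subset_Ici_self)
      (fun r hr => (hder r hr.1).mono (Ici_subset_Ici.2 hr.1)) s ⟨hs, le_rfl⟩
  rw [h0] at hconst
  linarith

theorem isExtendable_of_Icc (hψ : IsLip P.ψ) (hT₁ : 0 < T₁) (hT : T₁ ≤ T₂) {t : ℕ → ℝ} {J : ℕ}
    (h0 : t 0 = 0) (hm : Monotone t)
    (hsol : (P.errSystem L H T₁ T₂).IsSolutionPair (finiteDomain t J (Icc (t J) (t (J + 1)))) φ u) :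
    (P.errSystem L H T₁ T₂).IsExtendable (finiteDomain t J (Icc (t J) (t (J + 1)))) φ u := by
  have hmem : (t (J + 1), J) ∈ finiteDomain t J (Icc (t J) (t (J + 1))) :=
    Or.inr ⟨rfl, hm J.le_succ, le_rfl⟩
  have hτ := timer_mem hsol (isSliceSeq_finiteDomain h0 hm (Or.inl rfl)) hT₁ hT hmem
  rcases hτ.1.eq_or_lt with hzero | hpos
  · exact hsol.isExtendable_of_jump h0 hm hzero.symm ⟨T₁, ⟨le_rfl, hT⟩, rfl⟩
  · obtain ⟨α, hα₀, hα, hατ⟩ := P.exists_flow (nw := nw) hψ L H (t (J + 1)) (φ (t (J + 1)) J)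
    refine hsol.isExtendable_of_flow (isLip_errFlow L H hψ) h0 hm hpos hα₀ hα fun s hs => ?_
    change (α s).τ ∈ Icc 0 T₂
    rw [hατ s hs.1]
    constructor <;> linarith [hs.1, hs.2, hτ.2]

theorem isCompleteDom_of_isMaximalPair (hψ : IsLip P.ψ) (hT₁ : 0 < T₁) (hT : T₁ ≤ T₂)
    {E : Set (ℝ × ℕ)} (hmax : (P.errSystem L H T₁ T₂).IsMaximalPair E φ u) :
    HybridSystem.IsCompleteDom E := by
  have hext := hmax.not_isExtendable
  have hsol := hmax.1
  obtain ⟨t, h0, hm, h⟩ := hsol.dom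
  have hnn : ∀ j, 0 ≤ t j := fun j => h0 ▸ hm j.zero_le
  intro M
  rcases h with rfl | ⟨J, I, rfl | ⟨hlt, rfl⟩ | rfl, rfl⟩
  · obtain ⟨j, hj⟩ := exists_nat_gt M
    exact ⟨(t j, j), ⟨le_rfl, hm j.le_succ⟩, hj.trans_le (le_add_of_nonneg_left (hnn j))⟩
  · exact (hext (isExtendable_of_Icc hψ hT₁ hT h0 hm hsol)).elim
  · exact (hext (hsol.isExtendable_of_Ico (isLip_errFlow L H hψ) h0 hm hlt)).elim
  · obtain ⟨n, hn⟩ := exists_nat_gt M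
    refine ⟨(t J + n, J), Or.inr ⟨rfl, mem_Ici.2 (le_add_of_nonneg_right n.cast_nonneg)⟩,
      hn.trans_le ?_⟩
    dsimp only
    linarith [hnn J, J.cast_nonneg (α := ℝ)]

end Plant

/-! ### Trajectories of the interconnection as hybrid solutions -/

theorem absolutelyContinuousOnInterval_of_hasDerivAt {E : Type*} [NormedAddCommGroup E]
    [NormedSpace ℝ E] {f f' : ℝ → E} {a b : ℝ} (hab : a ≤ b) (hf : ContinuousOn f (Icc a b))
    (hd : ∀ s ∈ Ioo a b, HasDerivAt f (f' s) s) (hf' : ContinuousOn f' (Icc a b)) :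
    AbsolutelyContinuousOnInterval f a b := by
  obtain ⟨M, hM⟩ := isCompact_Icc.exists_bound_of_continuousOn hf'
  refine LipschitzOnWith.absolutelyContinuousOnInterval (K := M.toNNReal) ?_
  rw [uIcc_of_le hab]
  exact lipschitzOnWith_Icc_of_hasDerivAt hf hd fun s hs => hM s (Ioo_subset_Icc_self hs)

theorem absolutelyContinuousOnInterval_prodMk {E F : Type*} [NormedAddCommGroup E]
    [NormedSpace ℝ E] [NormedAddCommGroup F] [NormedSpace ℝ F] {f : ℝ → E} {g : ℝ → F} {a b : ℝ}
    (hf : AbsolutelyContinuousOnInterval f a b) (hg : AbsolutelyContinuousOnInterval g a b) :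
    AbsolutelyContinuousOnInterval (fun s => (f s, g s)) a b := by
  have hsum := (absolutelyContinuousOnInterval_comp_of_lipschitzWith
    (ContinuousLinearMap.inl ℝ E F).lipschitz hf).fun_add
      (absolutelyContinuousOnInterval_comp_of_lipschitzWith
        (ContinuousLinearMap.inr ℝ E F).lipschitz hg)
  exact absolutelyContinuousOnInterval_congr hsum fun s _ => by simp

theorem mulE_mul {m n k : ℕ} (M : Matrix (Fin m) (Fin n) ℝ) (N : Matrix (Fin n) (Fin k) ℝ)
    (v : Eu k) : mulE (M * N) v = mulE M (mulE N v) := by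
  simp [mulE, Matrix.toLpLin_apply, Matrix.mulVec_mulVec]

namespace Plant

variable {nz nw ny ns nq np : ℕ}

/-- The left end points of the slices of the hybrid time domain of a trajectory: the initial time
`0`, followed by the sampling times. If `t 0 = 0`, then the first slice is `{0}`. -/
def switchTime (t : ℕ → ℝ) : ℕ → ℝ
  | 0 => 0
  | k + 1 => t k

/-- The hybrid time domain with jumps at the sampling times. -/
def samplingDomain (t : ℕ → ℝ) : Set (ℝ × ℕ) :=
  {p | p.1 ∈ Icc (switchTime t p.2) (switchTime t (p.2 + 1))}

/-- The observer state `θ` on the `j`-th slice. It differs from `θ` only at the left end point,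
where it takes the value after the reset. -/
noncomputable def injection (P : Plant nz nw ny ns nq np) (t : ℕ → ℝ) (η : ℝ → Eu ny)
    (z zh : ℝ → Eu nz) (θ : ℝ → Eu ny) (s : ℝ) : ℕ → Eu ny
  | 0 => θ s
  | k + 1 => if s ≤ t k then mulE P.C (z (t k)) + η (t k) - mulE P.C (zh (t k)) else θ s

/-- The hybrid arc of a trajectory; the timer holds the time that is left until the next sample. -/
noncomputable def trajectoryArc (P : Plant nz nw ny ns nq np) (t : ℕ → ℝ) (η : ℝ → Eu ny)
    (z zh : ℝ → Eu nz) (θ : ℝ → Eu ny) (s : ℝ) (j : ℕ) : ErrState nz ny :=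
  ErrState.mk (z s) (z s - zh s) (mulE P.C (z s - zh s) - P.injection t η z zh θ s j)
    (switchTime t (j + 1) - s)

/-- The hybrid input of a trajectory. The noise `η` is arbitrary and only acts at the jumps, hence
it is set to zero elsewhere, which makes the input measurable and locally bounded. -/
noncomputable def trajectoryInput (t : ℕ → ℝ) (w : ℝ → Eu nw) (η : ℝ → Eu ny) (s : ℝ) (j : ℕ) :
    WithLp 2 (Eu nw × Eu ny) :=
  WithLp.toLp 2 (w s, if s = t j then η s else 0)

section SamplingSeq

variable {T₁ T₂ : ℝ} {t : ℕ → ℝ}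

theorem slice_samplingDomain (t : ℕ → ℝ) (j : ℕ) :
    slice (samplingDomain t) j = Icc (switchTime t j) (switchTime t (j + 1)) := rfl

theorem exists_mem_Ioc_switchTime {s : ℝ} (hs : 0 < s) (hle : ∃ k, s ≤ t k) :
    ∃ j, s ∈ Ioc (switchTime t j) (switchTime t (j + 1)) := by
  obtain ⟨k, hk⟩ := hle
  induction k with
  | zero => exact ⟨0, hs, hk⟩
  | succ k ih =>
    rcases le_or_gt s (t k) with hsk | hsk
    · exact ih hsk
    · exact ⟨k + 1, hsk, hk⟩

theorem monotone_switchTime (h0 : 0 ≤ t 0) (ht : Monotone t) : Monotone (switchTime t) :=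
  monotone_nat_of_le_succ fun k => by
    cases k with
    | zero => exact h0
    | succ k => exact ht k.le_succ

namespace IsSamplingSeq

theorem strictMono (ht : IsSamplingSeq T₁ T₂ t) (hT₁ : 0 < T₁) : StrictMono t :=
  strictMono_nat_of_lt_succ fun k => by linarith [(ht.2.2 k).1]

theorem exists_le (ht : IsSamplingSeq T₁ T₂ t) (hT₁ : 0 < T₁) (s : ℝ) : ∃ k, s ≤ t k := by
  have hlb : ∀ k : ℕ, k * T₁ ≤ t k := fun k => by
    induction k with
    | zero => simpa using ht.1
    | succ k ih => push_cast; linarith [(ht.2.2 k).1]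
  obtain ⟨k, hk⟩ := exists_nat_ge (s / T₁)
  exact ⟨k, ((div_le_iff₀ hT₁).1 hk).trans (hlb k)⟩

theorem switchTime_succ_sub_le (ht : IsSamplingSeq T₁ T₂ t) (j : ℕ) :
    switchTime t (j + 1) - switchTime t j ≤ T₂ := by
  cases j with
  | zero => exact (sub_zero _).trans_le ht.2.1
  | succ j => exact (ht.2.2 j).2

theorem monotone_switchTime (ht : IsSamplingSeq T₁ T₂ t) (hT₁ : 0 < T₁) :
    Monotone (switchTime t) :=
  Plant.monotone_switchTime ht.1 (ht.strictMono hT₁).monotone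

theorem isSliceSeq (ht : IsSamplingSeq T₁ T₂ t) (hT₁ : 0 < T₁) :
    IsSliceSeq (samplingDomain t) (switchTime t) :=
  ⟨rfl, ht.monotone_switchTime hT₁, ⟨0, le_rfl, ht.1⟩, fun _ => Or.inr (Or.inl rfl),
    fun _ _ => rfl⟩

theorem Icc_switchTime_subset_Ici (ht : IsSamplingSeq T₁ T₂ t) (hT₁ : 0 < T₁) (j : ℕ) :
    Icc (switchTime t j) (switchTime t (j + 1)) ⊆ Ici 0 :=
  Icc_subset_Ici_self.trans (Ici_subset_Ici.2 ((ht.isSliceSeq hT₁).nonneg j))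

theorem notMem_range (ht : IsSamplingSeq T₁ T₂ t) (hT₁ : 0 < T₁) {j : ℕ} {s : ℝ}
    (hs : s ∈ Ioo (switchTime t j) (switchTime t (j + 1))) : s ∉ range t := by
  rintro ⟨k, rfl⟩
  have hkj : k < j := (ht.strictMono hT₁).lt_iff_lt.1 hs.2
  exact hs.1.not_ge (ht.monotone_switchTime hT₁ (Nat.succ_le_of_lt hkj))

theorem domT_samplingDomain (ht : IsSamplingSeq T₁ T₂ t) (hT₁ : 0 < T₁) :
    domT (samplingDomain t) = Ici 0 := by
  ext s
  constructor
  · rintro ⟨j, hj⟩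
    exact ht.Icc_switchTime_subset_Ici hT₁ j hj
  · intro hs
    rcases (mem_Ici.1 hs).eq_or_lt with rfl | hpos
    · exact ⟨0, le_rfl, ht.1⟩
    · obtain ⟨j, hj⟩ := exists_mem_Ioc_switchTime hpos (ht.exists_le hT₁ s)
      exact ⟨j, Ioc_subset_Icc_self hj⟩

end IsSamplingSeq

variable {P : Plant nz nw ny ns nq np} {η : ℝ → Eu ny} {z zh : ℝ → Eu nz} {θ : ℝ → Eu ny}

theorem injection_succ_left (j : ℕ) : P.injection t η z zh θ (t j) (j + 1) =
    mulE P.C (z (t j)) + η (t j) - mulE P.C (zh (t j)) :=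
  if_pos le_rfl

theorem injection_of_switchTime_lt {j : ℕ} {s : ℝ} (hs : switchTime t j < s) :
    P.injection t η z zh θ s j = θ s := by
  cases j with
  | zero => rfl
  | succ j => exact if_neg (not_le.2 hs)

theorem injection_eventuallyEq {j : ℕ} {s : ℝ} (hs : switchTime t j < s) :
    (fun r => P.injection t η z zh θ r j) =ᶠ[𝓝 s] θ :=
  (eventually_gt_nhds hs).mono fun _ => injection_of_switchTime_lt

theorem exists_injection_eq (P : Plant nz nw ny ns nq np) (η : ℝ → Eu ny) (z zh : ℝ → Eu nz)
    (θ : ℝ → Eu ny) (ht : IsSamplingSeq T₁ T₂ t) (hT₁ : 0 < T₁) {s : ℝ} (hs : 0 ≤ s) :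
    ∃ j, (s, j) ∈ samplingDomain t ∧ P.injection t η z zh θ s j = θ s := by
  rcases hs.eq_or_lt with rfl | hpos
  · exact ⟨0, ⟨le_rfl, ht.1⟩, rfl⟩
  · obtain ⟨j, hj⟩ := exists_mem_Ioc_switchTime hpos (ht.exists_le hT₁ s)
    exact ⟨j, Ioc_subset_Icc_self hj, injection_of_switchTime_lt hj.1⟩

end SamplingSeq

theorem errFlow_mk_sub (P : Plant nz nw ny ns nq np) (L : Matrix (Fin nz) (Fin ny) ℝ)
    (H : Matrix (Fin ny) (Fin ny) ℝ) (z zh : Eu nz) (θ : Eu ny) (τ : ℝ) (w : Eu nw)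
    {dz dzh : Eu nz} (hz : dz = mulE P.A z + mulE P.B (P.ψ (mulE P.S z)) + mulE P.N w)
    (hzh : dzh = mulE P.A zh + mulE P.B (P.ψ (mulE P.S zh)) + mulE L θ) :
    P.errFlow L H (ErrState.mk z (z - zh) (mulE P.C (z - zh) - θ) τ) w =
      ErrState.mk dz (dz - dzh) (mulE P.C (dz - dzh) - mulE H θ) (-1) := by
  subst hz hzh
  simp only [errFlow, ErrState.mk_z, ErrState.mk_ε, ErrState.mk_θ, ζ, sub_sub_cancel, mulE_mul,
    map_add, map_sub, LinearMap.add_apply, LinearMap.sub_apply]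
  congr 1 <;> abel

section Trajectory

variable {P : Plant nz nw ny ns nq np} {L : Matrix (Fin nz) (Fin ny) ℝ}
  {H : Matrix (Fin ny) (Fin ny) ℝ} {T₁ T₂ : ℝ} {t : ℕ → ℝ} {w : ℝ → Eu nw} {η : ℝ → Eu ny}
  {z zh : ℝ → Eu nz} {θ : ℝ → Eu ny}

namespace IsTrajectory

theorem continuousWithinAt_injection_left (hx : P.IsTrajectory L H t w η z zh θ)
    (ht : IsSamplingSeq T₁ T₂ t) (hT₁ : 0 < T₁) {j : ℕ}
    (hj : switchTime t j < switchTime t (j + 1)) :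
    ContinuousWithinAt (fun s => P.injection t η z zh θ s j) (Ici (switchTime t j))
      (switchTime t j) := by
  cases j with
  | zero =>
    refine hx.inj_zero ?_
    rintro ⟨k, hk⟩
    exact (hj.trans_le ((ht.strictMono hT₁).monotone k.zero_le)).ne' hk
  | succ j =>
    refine continuousWithinAt_Ioi_iff_Ici.1 ?_
    change Tendsto _ _ (𝓝 (P.injection t η z zh θ (t j) (j + 1)))
    rw [injection_succ_left]
    refine (hx.inj_reset j).congr' ?_
    filter_upwards [self_mem_nhdsWithin] with r hr
    exact (injection_of_switchTime_lt hr).symm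

theorem continuousWithinAt_injection_right (hx : P.IsTrajectory L H t w η z zh θ)
    (ht : IsSamplingSeq T₁ T₂ t) (hT₁ : 0 < T₁) {j : ℕ}
    (hj : switchTime t j < switchTime t (j + 1)) :
    ContinuousWithinAt (fun s => P.injection t η z zh θ s j) (Iic (switchTime t (j + 1)))
      (switchTime t (j + 1)) :=
  (hx.inj_left j (((ht.isSliceSeq hT₁).nonneg j).trans_lt hj)).congr_of_eventuallyEq
    (nhdsWithin_le_nhds (injection_eventuallyEq hj)) (injection_of_switchTime_lt hj)

theorem hasDerivAt_injection (hx : P.IsTrajectory L H t w η z zh θ)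
    (ht : IsSamplingSeq T₁ T₂ t) (hT₁ : 0 < T₁) {j : ℕ} {s : ℝ}
    (hs : s ∈ Ioo (switchTime t j) (switchTime t (j + 1))) :
    HasDerivAt (fun r => P.injection t η z zh θ r j) (mulE H (P.injection t η z zh θ s j)) s := by
  rw [injection_of_switchTime_lt hs.1]
  exact (hx.inj_ode s (((ht.isSliceSeq hT₁).nonneg j).trans_lt hs.1)
    (ht.notMem_range hT₁ hs)).congr_of_eventuallyEq (injection_eventuallyEq hs.1)

theorem hasDerivAt_estimate (hx : P.IsTrajectory L H t w η z zh θ)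
    (ht : IsSamplingSeq T₁ T₂ t) (hT₁ : 0 < T₁) {j : ℕ} {s : ℝ}
    (hs : s ∈ Ioo (switchTime t j) (switchTime t (j + 1))) :
    HasDerivAt zh (mulE P.A (zh s) + mulE P.B (P.ψ (mulE P.S (zh s))) +
      mulE L (P.injection t η z zh θ s j)) s := by
  rw [injection_of_switchTime_lt hs.1]
  exact hx.est_ode s (((ht.isSliceSeq hT₁).nonneg j).trans_lt hs.1) (ht.notMem_range hT₁ hs)

theorem continuousOn_injection (hx : P.IsTrajectory L H t w η z zh θ)
    (ht : IsSamplingSeq T₁ T₂ t) (hT₁ : 0 < T₁) (j : ℕ) :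
    ContinuousOn (fun s => P.injection t η z zh θ s j)
      (Icc (switchTime t j) (switchTime t (j + 1))) := by
  rcases (ht.monotone_switchTime hT₁ j.le_succ).eq_or_lt with heq | hlt
  · rw [← heq, Icc_self]
    exact continuousOn_singleton _ _
  intro s hs
  rcases hs.1.eq_or_lt with rfl | hleft
  · exact (hx.continuousWithinAt_injection_left ht hT₁ hlt).mono Icc_subset_Ici_self
  rcases hs.2.eq_or_lt with rfl | hright
  · exact (hx.continuousWithinAt_injection_right ht hT₁ hlt).mono Icc_subset_Iic_self
  · exact (hx.hasDerivAt_injection ht hT₁ ⟨hleft, hright⟩).continuousAt.continuousWithinAt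

theorem absolutelyContinuousOnInterval_injection (hx : P.IsTrajectory L H t w η z zh θ)
    (ht : IsSamplingSeq T₁ T₂ t) (hT₁ : 0 < T₁) (j : ℕ) :
    AbsolutelyContinuousOnInterval (fun s => P.injection t η z zh θ s j) (switchTime t j)
      (switchTime t (j + 1)) := by
  have hθ := hx.continuousOn_injection ht hT₁ j
  exact absolutelyContinuousOnInterval_of_hasDerivAt (ht.monotone_switchTime hT₁ j.le_succ) hθ
    (fun s => hx.hasDerivAt_injection ht hT₁) ((mulL H).continuous.comp_continuousOn hθ)

theorem absolutelyContinuousOnInterval_estimate (hx : P.IsTrajectory L H t w η z zh θ)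
    (hψ : Continuous P.ψ) (ht : IsSamplingSeq T₁ T₂ t) (hT₁ : 0 < T₁) (j : ℕ) :
    AbsolutelyContinuousOnInterval zh (switchTime t j) (switchTime t (j + 1)) := by
  have hzh := hx.est_cont.mono (ht.Icc_switchTime_subset_Ici hT₁ j)
  have hψzh : ContinuousOn (fun s => P.ψ (mulE P.S (zh s))) _ :=
    hψ.comp_continuousOn ((mulL P.S).continuous.comp_continuousOn hzh)
  exact absolutelyContinuousOnInterval_of_hasDerivAt (ht.monotone_switchTime hT₁ j.le_succ) hzh
    (fun s => hx.hasDerivAt_estimate ht hT₁)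
    ((((mulL P.A).continuous.comp_continuousOn hzh).add
      ((mulL P.B).continuous.comp_continuousOn hψzh)).add
        ((mulL L).continuous.comp_continuousOn (hx.continuousOn_injection ht hT₁ j)))

theorem isHybridArc_trajectoryArc (hx : P.IsTrajectory L H t w η z zh θ) (hψ : Continuous P.ψ)
    (ht : IsSamplingSeq T₁ T₂ t) (hT₁ : 0 < T₁) :
    IsHybridArc (samplingDomain t) (P.trajectoryArc t η z zh θ) := by
  intro j a b hab hsub
  have hmono := ht.monotone_switchTime hT₁ j.le_succ
  have hb := (ht.isSliceSeq hT₁).nonneg (j + 1)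
  rw [slice_samplingDomain, ← uIcc_of_le hab, ← uIcc_of_le hmono] at hsub
  have hz : AbsolutelyContinuousOnInterval z (switchTime t j) (switchTime t (j + 1)) := by
    refine (hx.plant_ac _ hb).mono ?_
    rw [uIcc_of_le hmono, uIcc_of_le hb]
    exact Icc_subset_Icc_left ((ht.isSliceSeq hT₁).nonneg j)
  have hε := hz.fun_sub (hx.absolutelyContinuousOnInterval_estimate hψ ht hT₁ j)
  have hθ := (absolutelyContinuousOnInterval_comp_of_lipschitzWith (mulL P.C).lipschitz hε).fun_sub
    (hx.absolutelyContinuousOnInterval_injection ht hT₁ j)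
  have hτ : AbsolutelyContinuousOnInterval (fun s => switchTime t (j + 1) - s) (switchTime t j)
      (switchTime t (j + 1)) :=
    ContDiffOn.absolutelyContinuousOnInterval (by fun_prop)
  exact (absolutelyContinuousOnInterval_comp_of_lipschitzWith ErrState.mkL.lipschitz
    (absolutelyContinuousOnInterval_prodMk hz (absolutelyContinuousOnInterval_prodMk hε
      (absolutelyContinuousOnInterval_prodMk hθ hτ)))).mono hsub

theorem ae_hasDerivAt_trajectoryArc (hx : P.IsTrajectory L H t w η z zh θ)
    (ht : IsSamplingSeq T₁ T₂ t) (hT₁ : 0 < T₁) (j : ℕ) :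
    ∀ᵐ s ∂(volume.restrict (slice (samplingDomain t) j)),
      HasDerivAt (fun r => P.trajectoryArc t η z zh θ r j)
        (P.errFlow L H (P.trajectoryArc t η z zh θ s j) (w s)) s := by
  have hplant := ae_restrict_of_ae_restrict_of_subset (ht.Icc_switchTime_subset_Ici hT₁ j)
    hx.plant_ode
  rw [slice_samplingDomain]
  rw [← restrict_Ioo_eq_restrict_Icc] at hplant ⊢
  filter_upwards [hplant, ae_restrict_mem measurableSet_Ioo] with s hz hs
  have hε := hz.sub (hx.hasDerivAt_estimate ht hT₁ hs)
  have hθ := ((mulL P.C).hasFDerivAt.comp_hasDerivAt s hε).sub (hx.hasDerivAt_injection ht hT₁ hs)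
  have hτ := (hasDerivAt_id s).const_sub (switchTime t (j + 1))
  exact (ErrState.mkL.hasFDerivAt.comp_hasDerivAt s
    (hz.prodMk (hε.prodMk (hθ.prodMk hτ)))).congr_deriv
      (P.errFlow_mk_sub L H (z s) (zh s) _ _ (w s) rfl rfl).symm

end IsTrajectory

theorem trajectoryInput_ae_eq (t : ℕ → ℝ) (w : ℝ → Eu nw) (η : ℝ → Eu ny) (j : ℕ) :
    (fun s => trajectoryInput t w η s j) =ᵐ[volume]
      fun s => (WithLp.toLp 2 (w s, 0) : WithLp 2 (Eu nw × Eu ny)) := by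
  filter_upwards [Measure.ae_ne volume (t j)] with s hs
  simp [trajectoryInput, hs]

theorem isHybridInput_trajectoryInput (hw : IsLocBddInput w) (ht : IsSamplingSeq T₁ T₂ t)
    (hT₁ : 0 < T₁) : IsHybridInput (samplingDomain t) (trajectoryInput t w η) := by
  intro j
  have hsub : slice (samplingDomain t) j ⊆ Ici 0 := ht.Icc_switchTime_subset_Ici hT₁ j
  refine ⟨?_, fun T => ?_⟩
  · have hcont : Continuous fun v : Eu nw => (WithLp.toLp 2 (v, 0) : WithLp 2 (Eu nw × Eu ny)) :=
      (WithLp.prod_continuous_toLp 2 _ _).comp (Continuous.prodMk_left 0)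
    exact (hcont.comp_aestronglyMeasurable (hw.1.mono_set hsub)).congr
      (EventuallyEq.symm (ae_restrict_of_ae (trajectoryInput_ae_eq t w η j)))
  · obtain ⟨M, hM⟩ := hw.2 T
    have hsub' : slice (samplingDomain t) j ∩ Iic T ⊆ Icc 0 T := fun s hs => ⟨hsub hs.1, hs.2⟩
    refine ⟨M, ?_⟩
    filter_upwards [ae_restrict_of_ae_restrict_of_subset hsub' hM,
      ae_restrict_of_ae (trajectoryInput_ae_eq t w η j)] with s hs heq
    rw [heq]
    simpa using hs

theorem trajectoryArc_mem_jumpMap (hs : ∀ k, T₁ ≤ t (k + 1) - t k ∧ t (k + 1) - t k ≤ T₂) (j : ℕ) :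
    P.trajectoryArc t η z zh θ (t j) (j + 1) ∈ (P.errSystem L H T₁ T₂).jumpMap
      (P.trajectoryArc t η z zh θ (t j) j) (trajectoryInput t w η (t j) j).snd := by
  refine ⟨t (j + 1) - t j, hs j, ?_⟩
  have hη : (trajectoryInput t w η (t j) j).snd = η (t j) := if_pos rfl
  rw [hη]
  simp only [trajectoryArc, injection_succ_left, ErrState.mk_z, ErrState.mk_ε, switchTime, map_sub]
  congr 1
  abel

theorem IsTrajectory.isSolutionPair (hx : P.IsTrajectory L H t w η z zh θ) (hψ : Continuous P.ψ)
    (hw : IsLocBddInput w) (ht : IsSamplingSeq T₁ T₂ t) (hT₁ : 0 < T₁) :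
    (P.errSystem L H T₁ T₂).IsSolutionPair (samplingDomain t) (P.trajectoryArc t η z zh θ)
      (trajectoryInput t w η) where
  dom := ⟨switchTime t, rfl, ht.monotone_switchTime hT₁, Or.inl rfl⟩
  arc := hx.isHybridArc_trajectoryArc hψ ht hT₁
  input := isHybridInput_trajectoryInput hw ht hT₁
  init := Or.inl ⟨(sub_zero (t 0)).ge.trans' ht.1, (sub_zero (t 0)).le.trans ht.2.1⟩
  flow_mem j s hs := by
    have hmem : s ∈ slice (samplingDomain t) j := interior_subset hs
    exact ⟨sub_nonneg.2 hmem.2, (sub_le_sub_left hmem.1 _).trans (ht.switchTime_succ_sub_le j)⟩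
  flow j := hx.ae_hasDerivAt_trajectoryArc ht hT₁ j
  jump s j hs := by
    obtain rfl : s = t j := (ht.isSliceSeq hT₁).eq_of_mem_jumpTimes hs
    exact ⟨sub_self _, trajectoryArc_mem_jumpMap ht.2.2 j⟩

end Trajectory

end Plant

/-! ### Estimates for the trajectories of the interconnection -/

namespace Plant

section TargetSet

variable {nz ny : ℕ}

theorem dist_obsState_sq (z zh v : Eu nz) (θ : Eu ny) :
    dist (obsState z zh θ) (obsState v v 0) ^ 2 =
      ‖z - zh‖ ^ 2 / 2 + ‖θ‖ ^ 2 + ‖(z - v) + (zh - v)‖ ^ 2 / 2 := by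
  have hsub : obsState z zh θ - obsState v v 0 = obsState (z - v) (zh - v) (θ - 0) := rfl
  have hpar := parallelogram_law_with_norm ℝ (z - v) (zh - v)
  rw [sub_sub_sub_cancel_right] at hpar
  have hnorm : ‖obsState (z - v) (zh - v) (θ - 0)‖ ^ 2 =
      ‖z - v‖ ^ 2 + (‖zh - v‖ ^ 2 + ‖θ‖ ^ 2) := by
    simp [obsState, WithLp.prod_norm_sq_eq_of_L2]
  rw [dist_eq_norm, hsub, hnorm]
  linarith

theorem infDist_targetSet (z zh : Eu nz) (θ : Eu ny) :
    Metric.infDist (obsState z zh θ) (targetSet nz ny) = √(‖z - zh‖ ^ 2 / 2 + ‖θ‖ ^ 2) := by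
  have hmem (v : Eu nz) : obsState v v 0 ∈ targetSet nz ny := ⟨v, rfl⟩
  refine le_antisymm ?_ ((Metric.le_infDist ⟨_, hmem 0⟩).2 ?_)
  · refine (Metric.infDist_le_dist_of_mem (hmem (midpoint ℝ z zh))).trans
      (Real.le_sqrt_of_sq_le ?_)
    simp [dist_obsState_sq, ← smul_add]
  · rintro _ ⟨v, rfl⟩
    rw [Real.sqrt_le_left dist_nonneg, dist_obsState_sq]
    exact le_add_of_nonneg_right (by positivity)

theorem infDist_targetSet_sq (z zh : Eu nz) (θ : Eu ny) :
    Metric.infDist (obsState z zh θ) (targetSet nz ny) ^ 2 = ‖z - zh‖ ^ 2 / 2 + ‖θ‖ ^ 2 := by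
  rw [infDist_targetSet, Real.sq_sqrt (by positivity)]

/-- The constant of the equivalence between `|ε|² + |θ̃|²`, where `θ̃ = C ε - θ`, and the squared
distance `|ε|² / 2 + |θ|²` of `(z, ẑ, θ)` to the target set. -/
noncomputable def errorEquivConst (C : Matrix (Fin ny) (Fin nz) ℝ) : ℝ := 2 + 4 * ‖mulL C‖ ^ 2

theorem errorEquivConst_pos (C : Matrix (Fin ny) (Fin nz) ℝ) : 0 < errorEquivConst C := by
  rw [errorEquivConst]
  positivity

theorem norm_mulE_sub_sq_le (C : Matrix (Fin ny) (Fin nz) ℝ) (ε : Eu nz) (θ : Eu ny) :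
    ‖mulE C ε - θ‖ ^ 2 ≤ 2 * ‖mulL C‖ ^ 2 * ‖ε‖ ^ 2 + 2 * ‖θ‖ ^ 2 :=
  calc ‖mulE C ε - θ‖ ^ 2 ≤ (‖mulL C‖ * ‖ε‖ + ‖θ‖) ^ 2 := by
        gcongr
        exact (norm_sub_le _ _).trans (add_le_add_left ((mulL C).le_opNorm ε) _)
    _ ≤ 2 * ((‖mulL C‖ * ‖ε‖) ^ 2 + ‖θ‖ ^ 2) := add_sq_le
    _ = 2 * ‖mulL C‖ ^ 2 * ‖ε‖ ^ 2 + 2 * ‖θ‖ ^ 2 := by ring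

theorem error_sq_le_mul_infDist_sq (C : Matrix (Fin ny) (Fin nz) ℝ) (z zh : Eu nz) (θ : Eu ny) :
    ‖z - zh‖ ^ 2 + ‖mulE C (z - zh) - θ‖ ^ 2 ≤
      errorEquivConst C * Metric.infDist (obsState z zh θ) (targetSet nz ny) ^ 2 := by
  rw [infDist_targetSet_sq, errorEquivConst]
  nlinarith [norm_mulE_sub_sq_le C (z - zh) θ, mul_nonneg (sq_nonneg ‖mulL C‖) (sq_nonneg ‖θ‖)]

theorem infDist_sq_le_mul_error_sq (C : Matrix (Fin ny) (Fin nz) ℝ) (z zh : Eu nz) (θ : Eu ny) :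
    Metric.infDist (obsState z zh θ) (targetSet nz ny) ^ 2 ≤
      errorEquivConst C * (‖z - zh‖ ^ 2 + ‖mulE C (z - zh) - θ‖ ^ 2) := by
  have hθ := norm_mulE_sub_sq_le C (z - zh) (mulE C (z - zh) - θ)
  rw [sub_sub_cancel] at hθ
  rw [infDist_targetSet_sq, errorEquivConst]
  nlinarith [sq_nonneg ‖z - zh‖, mul_nonneg (sq_nonneg ‖mulL C‖) (sq_nonneg ‖z - zh‖),
    mul_nonneg (sq_nonneg ‖mulL C‖) (sq_nonneg ‖mulE C (z - zh) - θ‖)]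

end TargetSet

variable {nz nw ny ns nq np : ℕ} {P : Plant nz nw ny ns nq np} {L : Matrix (Fin nz) (Fin ny) ℝ}
  {H : Matrix (Fin ny) (Fin ny) ℝ} {T₁ T₂ lt γ a b : ℝ} {V : ErrState nz ny → ℝ}

theorem isLocBddInput_zero : IsLocBddInput (fun _ => (0 : Eu nw)) :=
  ⟨aestronglyMeasurable_const, fun _ => ⟨0, by simp⟩⟩

theorem IsTrajectory.error_sq_le (hV : P.IsLyapunov L H T₂ lt γ V a b) (hψ : Continuous P.ψ)
    (hT₁ : 0 < T₁) (hT : T₁ ≤ T₂) (hlt : 0 < lt) {t : ℕ → ℝ} (ht : IsSamplingSeq T₁ T₂ t)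
    {w : ℝ → Eu nw} {η : ℝ → Eu ny} {z zh : ℝ → Eu nz} {θ : ℝ → Eu ny} (hw : IsLocBddInput w)
    {r : ℝ} (hwr : ∀ᵐ s ∂(volume.restrict (Ici 0)), ‖w s‖ ≤ r) (hηr : ∀ k, ‖η (t k)‖ ≤ r)
    (hx : P.IsTrajectory L H t w η z zh θ) {s : ℝ} (hs : 0 ≤ s) :
    ‖z s - zh s‖ ^ 2 + ‖mulE P.C (z s - zh s) - θ s‖ ^ 2 ≤
      b / a * Real.exp (-(2 * lt) * s) * (errorEquivConst P.C *
        Metric.infDist (obsState (z 0) (zh 0) (θ 0)) (targetSet nz ny) ^ 2) +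
      errGain T₁ lt γ a b * r ^ 2 := by
  have ha := hV.a_pos
  have hb := hV.b_pos
  obtain ⟨j, hj, hθ⟩ := exists_injection_eq P η z zh θ ht hT₁ hs
  have hhybrid := Plant.error_sq_le hV (hx.isSolutionPair hψ hw ht hT₁) hT₁ hT hlt
    (fun j => ae_restrict_of_ae_restrict_of_subset (ht.Icc_switchTime_subset_Ici hT₁ j) hwr)
    (fun s j hsj => ?_) hj
  · simp only [trajectoryArc, ErrState.mk_ε, ErrState.mk_θ, hθ] at hhybrid
    refine hhybrid.trans ?_
    gcongr
    exact error_sq_le_mul_infDist_sq P.C (z 0) (zh 0) (θ 0)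
  · obtain rfl : s = t j := (ht.isSliceSeq hT₁).eq_of_mem_jumpTimes hsj
    simpa [trajectoryInput] using hηr j

theorem exp_stable_of_isLyapunov (hV : P.IsLyapunov L H T₂ lt γ V a b) (hψ : Continuous P.ψ)
    (hT₁ : 0 < T₁) (hT : T₁ ≤ T₂) (hlt : 0 < lt) :
    ∃ κ : ℝ, 0 < κ ∧ ∀ t, IsSamplingSeq T₁ T₂ t → ∀ z zh θ,
      P.IsTrajectory L H t (fun _ => 0) (fun _ => 0) z zh θ → ∀ s, 0 ≤ s →
        Metric.infDist (obsState (z s) (zh s) (θ s)) (targetSet nz ny) ≤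
          κ * Real.exp (-lt * s) *
            Metric.infDist (obsState (z 0) (zh 0) (θ 0)) (targetSet nz ny) := by
  have hba : 0 < b / a := div_pos hV.b_pos hV.a_pos
  have hk := errorEquivConst_pos P.C
  refine ⟨errorEquivConst P.C * √(b / a), by positivity, fun t ht z zh θ hx s hs => ?_⟩
  have herr := hx.error_sq_le hV hψ hT₁ hT hlt ht isLocBddInput_zero (r := 0) (by simp) (by simp) hs
  set k := errorEquivConst P.C
  set D := Metric.infDist (obsState (z 0) (zh 0) (θ 0)) (targetSet nz ny)
  have hD : 0 ≤ D := Metric.infDist_nonneg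
  have hexp : Real.exp (-(2 * lt) * s) = Real.exp (-lt * s) ^ 2 := by
    rw [← Real.exp_nat_mul]
    congr 1
    push_cast
    ring
  refine le_of_sq_le_sq ?_ (by positivity)
  calc Metric.infDist (obsState (z s) (zh s) (θ s)) (targetSet nz ny) ^ 2
      ≤ k * (b / a * Real.exp (-(2 * lt) * s) * (k * D ^ 2) + errGain T₁ lt γ a b * 0 ^ 2) := by
        grw [infDist_sq_le_mul_error_sq P.C, herr]
    _ = k ^ 2 * (b / a) * Real.exp (-lt * s) ^ 2 * D ^ 2 := by rw [hexp]; ring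
    _ = (k * √(b / a) * Real.exp (-lt * s) * D) ^ 2 := by
        rw [mul_pow, mul_pow, mul_pow, Real.sq_sqrt hba.le]

theorem bounded_of_isLyapunov (hV : P.IsLyapunov L H T₂ lt γ V a b) (hψ : Continuous P.ψ)
    (hT₁ : 0 < T₁) (hT : T₁ ≤ T₂) (hlt : 0 < lt) (r : ℝ) :
    ∃ M : ℝ, ∀ t, IsSamplingSeq T₁ T₂ t → ∀ (w : ℝ → Eu nw) (η : ℝ → Eu ny),
      IsLocBddInput w → (∀ᵐ s ∂(volume.restrict (Ici 0)), ‖w s‖ ≤ r) → (∀ k, ‖η (t k)‖ ≤ r) →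
      ∀ z zh θ, P.IsTrajectory L H t w η z zh θ →
        Metric.infDist (obsState (z 0) (zh 0) (θ 0)) (targetSet nz ny) ≤ r →
        ∀ s, 0 ≤ s → ‖z s - zh s‖ ≤ M := by
  have hba : 0 < b / a := div_pos hV.b_pos hV.a_pos
  have hk := errorEquivConst_pos P.C
  refine ⟨√(b / a * (errorEquivConst P.C * r ^ 2) + errGain T₁ lt γ a b * r ^ 2),
    fun t ht w η hw hwr hηr z zh θ hx h0 s hs => Real.le_sqrt_of_sq_le ?_⟩
  have hexp : Real.exp (-(2 * lt) * s) ≤ 1 := Real.exp_le_one_iff.2 (by nlinarith)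
  calc ‖z s - zh s‖ ^ 2 ≤ ‖z s - zh s‖ ^ 2 + ‖mulE P.C (z s - zh s) - θ s‖ ^ 2 :=
        le_add_of_nonneg_right (sq_nonneg _)
    _ ≤ _ := hx.error_sq_le hV hψ hT₁ hT hlt ht hw hwr hηr hs
    _ ≤ b / a * 1 * (errorEquivConst P.C * r ^ 2) + errGain T₁ lt γ a b * r ^ 2 := by
        gcongr
        exact Metric.infDist_nonneg
    _ = b / a * (errorEquivConst P.C * r ^ 2) + errGain T₁ lt γ a b * r ^ 2 := by rw [mul_one]

theorem l2_gain_of_isLyapunov (hV : P.IsLyapunov L H T₂ lt γ V a b) (hψ : Continuous P.ψ)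
    (hT₁ : 0 < T₁) (hT : T₁ ≤ T₂) (hlt : 0 < lt) (hγ : 0 < γ) :
    ∃ α : ℝ, 0 < α ∧ ∀ t, IsSamplingSeq T₁ T₂ t → ∀ w : ℝ → Eu nw, IsLocBddInput w →
      ∀ z zh θ, P.IsTrajectory L H t w (fun _ => 0) z zh θ →
        (∫⁻ s in Ici 0, ‖mulE P.Cp (z s - zh s)‖ₑ ^ 2) ^ (1 / 2 : ℝ) ≤
          ENNReal.ofReal
              (α * Metric.infDist (obsState (z 0) (zh 0) (θ 0)) (targetSet nz ny)) +
            ENNReal.ofReal γ * (∫⁻ s in Ici 0, ‖w s‖ₑ ^ 2) ^ (1 / 2 : ℝ) := by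
  have hb := hV.b_pos
  have hk := errorEquivConst_pos P.C
  refine ⟨√b * √(errorEquivConst P.C), by positivity, fun t ht w hw z zh θ hx => ?_⟩
  have hsol := hx.isSolutionPair hψ hw ht hT₁
  have hgain := l2_gain_errSystem hV hsol hT₁ hT hlt hγ fun s j _ => by simp [trajectoryInput]
  have hτ : (P.trajectoryArc t (fun _ => 0) z zh θ 0 0).τ ∈ Icc 0 T₂ :=
    timer_mem hsol (ht.isSliceSeq hT₁) hT₁ hT (ht.isSliceSeq hT₁).zero_mem
  rw [ht.domT_samplingDomain hT₁, ErrState.infDist_errSet hτ] at hgain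
  refine hgain.trans (add_le_add_left (ENNReal.ofReal_le_ofReal ?_) _)
  rw [mul_assoc]
  gcongr
  rw [← Real.sqrt_sq (Metric.infDist_nonneg (s := targetSet nz ny)), ← Real.sqrt_mul hk.le]
  exact Real.sqrt_le_sqrt (error_sq_le_mul_infDist_sq P.C (z 0) (zh 0) (θ 0))

end Plant

/-! ### Existence of trajectories of the interconnection -/

section Perturbation

variable {E : Type*} [NormedAddCommGroup E] [NormedSpace ℝ E] [CompleteSpace E]

theorem exists_ae_hasDerivAt_add_of_isLip {g : E → E} (hg : IsLip g) {W v : ℝ → E}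
    (hWc : Continuous W) (hWac : ∀ b, 0 ≤ b → AbsolutelyContinuousOnInterval W 0 b)
    (hWd : ∀ᵐ s ∂(volume.restrict (Ici 0)), HasDerivAt W (v s) s) (x₀ : E) :
    ∃ x : ℝ → E, x 0 = x₀ ∧ (∀ b, 0 ≤ b → AbsolutelyContinuousOnInterval x 0 b) ∧
      ∀ᵐ s ∂(volume.restrict (Ici 0)), HasDerivAt x (g (x s) + v s) s := by
  obtain ⟨K, hK⟩ := hg
  -- With `x = α + W`, the right-hand side of the equation for `α` is continuous in time.
  obtain ⟨α, h0, hα⟩ := exists_hasDerivWithinAt_Ici_of_lipschitzWith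
    (f := fun s x => g (x + W s)) (K := K)
    (fun s => LipschitzWith.of_dist_le_mul fun x y => by
      simpa using hK.dist_le_mul (x + W s) (y + W s))
    (fun x => hK.continuous.comp (continuous_const.add hWc)) 0 (x₀ - W 0)
  refine ⟨fun s => α s + W s, by simp only [h0, sub_add_cancel], fun b hb => ?_, ?_⟩
  · have hαc : ContinuousOn α (Icc 0 b) := fun s hs =>
      (hα s hs.1).continuousWithinAt.mono Icc_subset_Ici_self
    exact (absolutelyContinuousOnInterval_of_hasDerivAt hb hαc
      (fun s hs => (hα s hs.1.le).hasDerivAt (Ici_mem_nhds hs.1))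
      (hK.continuous.comp_continuousOn (hαc.add hWc.continuousOn))).fun_add (hWac b hb)
  · rw [← restrict_Ioi_eq_restrict_Ici] at hWd ⊢
    filter_upwards [hWd, ae_restrict_mem measurableSet_Ioi] with s hs hpos
    exact ((hα s (mem_Ioi.1 hpos).le).hasDerivAt (Ici_mem_nhds hpos)).add hs

end Perturbation

namespace Plant

section Disturbance

variable {nz nw ny ns nq np : ℕ} {w : ℝ → Eu nw}

theorem IsLocBddInput.locallyIntegrable_indicator (hw : IsLocBddInput w) :
    LocallyIntegrable ((Ici 0).indicator w) volume := by
  rw [locallyIntegrable_iff]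
  intro K hK
  obtain ⟨T, hT⟩ := hK.bddAbove
  obtain ⟨M, hM⟩ := hw.2 T
  refine Measure.integrableOn_of_bounded (M := max M 0) hK.measure_lt_top.ne
    ((aestronglyMeasurable_indicator_iff measurableSet_Ici).2 hw.1) ?_
  rw [ae_restrict_iff' measurableSet_Icc] at hM
  rw [ae_restrict_iff' hK.measurableSet]
  filter_upwards [hM] with s hs hsK
  by_cases h0 : s ∈ Ici (0 : ℝ)
  · rw [indicator_of_mem h0]
    exact (hs ⟨h0, hT hsK⟩).trans (le_max_left _ _)
  · rw [indicator_of_notMem h0, norm_zero]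
    exact le_max_right _ _

theorem IsLocBddInput.exists_primitive (hw : IsLocBddInput w) :
    ∃ W : ℝ → Eu nw, Continuous W ∧ (∀ b, 0 ≤ b → AbsolutelyContinuousOnInterval W 0 b) ∧
      ∀ᵐ s ∂(volume.restrict (Ici 0)), HasDerivAt W (w s) s := by
  have hloc := hw.locallyIntegrable_indicator
  have hint : ∀ a b : ℝ, IntervalIntegrable ((Ici 0).indicator w) volume a b := fun a b =>
    (hloc.integrableOn_isCompact isCompact_uIcc).intervalIntegrable
  refine ⟨fun s => ∫ r in (0 : ℝ)..s, (Ici 0).indicator w r,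
    intervalIntegral.continuous_primitive hint 0, fun b hb => ?_, ?_⟩
  · obtain ⟨M, hM⟩ := hw.2 b
    rw [ae_restrict_iff' measurableSet_Icc] at hM
    refine (LipschitzOnWith.of_dist_le_mul (K := M.toNNReal)
      fun x hx y hy => ?_).absolutelyContinuousOnInterval
    rw [dist_eq_norm, dist_eq_norm, intervalIntegral.integral_interval_sub_left (hint _ _)
      (hint _ _)]
    refine intervalIntegral.norm_integral_le_of_norm_le_const_ae ?_
    filter_upwards [hM] with s hs hsI
    have hsb : s ∈ Icc 0 b := uIcc_of_le hb ▸ uIcc_subset_uIcc hy hx (uIoc_subset_uIcc hsI)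
    rw [indicator_of_mem (mem_Ici.2 hsb.1)]
    exact (hs hsb).trans (Real.le_coe_toNNReal M)
  · filter_upwards [ae_restrict_of_ae (_root_.LocallyIntegrable.ae_hasDerivAt_integral hloc),
      ae_restrict_mem measurableSet_Ici] with s hs h0
    simpa only [indicator_of_mem h0] using hs 0

theorem exists_plant_trajectory {P : Plant nz nw ny ns nq np} (hψ : IsLip P.ψ)
    (hw : IsLocBddInput w) (z₀ : Eu nz) :
    ∃ z : ℝ → Eu nz, z 0 = z₀ ∧ (∀ b, 0 ≤ b → AbsolutelyContinuousOnInterval z 0 b) ∧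
      ∀ᵐ s ∂(volume.restrict (Ici 0)), HasDerivAt z
        (mulE P.A (z s) + mulE P.B (P.ψ (mulE P.S (z s))) + mulE P.N (w s)) s := by
  obtain ⟨W, hWc, hWac, hWd⟩ := hw.exists_primitive
  have hg : IsLip fun z : Eu nz => mulE P.A z + mulE P.B (P.ψ (mulE P.S z)) :=
    (IsLip.mulE P.A .id).add (.mulE P.B (hψ.comp (.mulE P.S .id)))
  have hNWc : Continuous fun s => mulE P.N (W s) := (mulL P.N).continuous.comp hWc
  have hNWac : ∀ b, 0 ≤ b → AbsolutelyContinuousOnInterval (fun s => mulE P.N (W s)) 0 b :=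
    fun b hb =>
      absolutelyContinuousOnInterval_comp_of_lipschitzWith (mulL P.N).lipschitz (hWac b hb)
  have hNWd : ∀ᵐ s ∂(volume.restrict (Ici 0)),
      HasDerivAt (fun s => mulE P.N (W s)) (mulE P.N (w s)) s :=
    hWd.mono fun s hs => (mulL P.N).hasFDerivAt.comp_hasDerivAt s hs
  exact exists_ae_hasDerivAt_add_of_isLip hg hNWc hNWac hNWd z₀

end Disturbance

section Impulsive

variable {E : Type*} [NormedAddCommGroup E] [NormedSpace ℝ E] {f : ℝ → E → E} {R : ℕ → E → E}
  {t : ℕ → ℝ} {x : ℝ → E}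

/-- Solutions on `[0, ∞)` of the impulsive differential equation `x' = f s x` with resets
`x⁺ = R k x` at the times `t k`. As in `IsTrajectory`, the value at a reset time is the one before
the reset. -/
structure IsImpulsiveSolution (f : ℝ → E → E) (R : ℕ → E → E) (t : ℕ → ℝ) (x : ℝ → E) : Prop where
  hasDerivAt : ∀ s, 0 < s → s ∉ range t → HasDerivAt x (f s (x s)) s
  continuousWithinAt_zero : 0 ∉ range t → ContinuousWithinAt x (Ici 0) 0
  continuousWithinAt_Iic : ∀ k, 0 < t k → ContinuousWithinAt x (Iic (t k)) (t k)
  tendsto_reset : ∀ k, Tendsto x (𝓝[>] (t k)) (𝓝 (R k (x (t k))))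

theorem IsImpulsiveSolution.continuousOn_comp {F : Type*} [TopologicalSpace F] {g : E → F}
    (hx : IsImpulsiveSolution f R t x) (hg : Continuous g) (hR : ∀ k y, g (R k y) = g y) :
    ContinuousOn (fun s => g (x s)) (Ici 0) := by
  intro s hs
  by_cases hst : s ∈ range t
  · obtain ⟨k, rfl⟩ := hst
    have hright : ContinuousWithinAt (fun s => g (x s)) (Ioi (t k)) (t k) := by
      simpa only [ContinuousWithinAt, hR] using! (hg.tendsto _).comp (hx.tendsto_reset k)
    rcases (mem_Ici.1 hs).eq_or_lt with h0 | hpos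
    · rw [← h0] at hright ⊢
      exact continuousWithinAt_Ioi_iff_Ici.1 hright
    · exact (continuousAt_iff_continuous_left_right.2
        ⟨hg.continuousAt.comp_continuousWithinAt (hx.continuousWithinAt_Iic k hpos),
          continuousWithinAt_Ioi_iff_Ici.1 hright⟩).continuousWithinAt
  · rcases (mem_Ici.1 hs).eq_or_lt with rfl | hpos
    · exact hg.continuousAt.comp_continuousWithinAt (hx.continuousWithinAt_zero hst)
    · exact (hg.continuousAt.comp (hx.hasDerivAt s hpos hst).continuousAt).continuousWithinAt

theorem exists_sampled_flows [CompleteSpace E] {K : ℝ≥0} (hf : ∀ s, LipschitzWith K (f s))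
    (hc : ∀ y, Continuous fun s => f s y) (R : ℕ → E → E) (t : ℕ → ℝ) (x₀ : E) :
    ∃ G : ℕ → ℝ → E, G 0 0 = x₀ ∧ (∀ k, G (k + 1) (t k) = R k (G k (t k))) ∧
      ∀ k s, switchTime t k ≤ s →
        HasDerivWithinAt (G k) (f s (G k s)) (Ici (switchTime t k)) s := by
  choose Φ hΦ₀ hΦ using exists_hasDerivWithinAt_Ici_of_lipschitzWith hf hc
  let X : ℕ → E := fun k => Nat.rec x₀ (fun k y => R k (Φ (switchTime t k) y (t k))) k
  exact ⟨fun k => Φ (switchTime t k) (X k), hΦ₀ 0 x₀, fun k => hΦ₀ (t k) (X (k + 1)),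
    fun k s hs => hΦ (switchTime t k) (X k) s hs⟩

theorem exists_eqOn_Ioc_of_monotone {α : Type*} {τ : ℕ → ℝ} (hτ : Monotone τ)
    (G : ℕ → ℝ → α) :
    ∃ x : ℝ → α, x (τ 0) = G 0 (τ 0) ∧ ∀ k, EqOn x (G k) (Ioc (τ k) (τ (k + 1))) := by
  classical
  refine ⟨fun s => if h : ∃ k, s ∈ Ioc (τ k) (τ (k + 1)) then G h.choose s else G 0 s,
    dif_neg ?_, fun k s hs => ?_⟩
  · rintro ⟨k, hk⟩
    exact hk.1.not_ge (hτ k.zero_le)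
  · have h : ∃ k, s ∈ Ioc (τ k) (τ (k + 1)) := ⟨k, hs⟩
    have hk : h.choose = k := by
      by_contra hne
      exact (hτ.pairwise_disjoint_on_Ioc_succ hne).le_bot ⟨h.choose_spec, hs⟩
    exact (dif_pos h).trans (by rw [hk])

theorem isImpulsiveSolution_of_eqOn_Ioc {G : ℕ → ℝ → E} (h0 : 0 ≤ t 0) (ht : StrictMono t)
    (hub : ∀ s, ∃ k, s ≤ t k)
    (hG : ∀ k s, switchTime t k ≤ s →
      HasDerivWithinAt (G k) (f s (G k s)) (Ici (switchTime t k)) s)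
    (hR : ∀ k, G (k + 1) (t k) = R k (G k (t k))) (hx0 : x 0 = G 0 0)
    (hxG : ∀ k, EqOn x (G k) (Ioc (switchTime t k) (switchTime t (k + 1)))) :
    IsImpulsiveSolution f R t x := by
  have hGd : ∀ k s, switchTime t k < s → HasDerivAt (G k) (f s (G k s)) s := fun k s hs =>
    (hG k s hs.le).hasDerivAt (Ici_mem_nhds hs)
  have hlt : ∀ k, 0 < t k → switchTime t k < t k := fun k hk => by
    cases k with
    | zero => exact hk
    | succ k => exact ht k.lt_succ_self
  have hxt : ∀ k, x (t k) = G k (t k) := fun k => by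
    rcases (h0.trans (ht.monotone k.zero_le)).eq_or_lt with hk | hk
    · obtain rfl : k = 0 := Nat.le_zero.1 (ht.le_iff_le.1 (hk ▸ h0))
      rw [← hk, hx0]
    · exact hxG k ⟨hlt k hk, le_rfl⟩
  refine ⟨fun s hs hst => ?_, fun hst => ?_, fun k hk => ?_, fun k => ?_⟩
  · obtain ⟨k, hk⟩ := exists_mem_Ioc_switchTime hs (hub s)
    have hk' : s < switchTime t (k + 1) := hk.2.lt_of_ne fun h => hst ⟨k, h.symm⟩
    rw [hxG k hk]
    exact (hGd k s hk.1).congr_of_eventuallyEq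
      ((hxG k).eventuallyEq_of_mem (Ioc_mem_nhds hk.1 hk'))
  · have hpos : 0 < t 0 := h0.lt_of_ne fun h => hst ⟨0, h.symm⟩
    refine continuousWithinAt_Ioi_iff_Ici.1 (((hG 0 0 le_rfl).continuousWithinAt.mono
      Ioi_subset_Ici_self).congr_of_eventuallyEq ?_ hx0)
    exact (hxG 0).eventuallyEq_of_mem (Ioc_mem_nhdsGT hpos)
  · exact (hGd k _ (hlt k hk)).continuousAt.continuousWithinAt.congr_of_eventuallyEq
      ((hxG k).eventuallyEq_of_mem (Ioc_mem_nhdsLE (hlt k hk))) (hxt k)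
  · rw [hxt, ← hR]
    have hright : Tendsto (G (k + 1)) (𝓝[>] (t k)) (𝓝 (G (k + 1) (t k))) :=
      (hG (k + 1) (t k) le_rfl).continuousWithinAt.mono Ioi_subset_Ici_self
    exact hright.congr'
      ((hxG (k + 1)).eventuallyEq_of_mem (Ioc_mem_nhdsGT (ht k.lt_succ_self))).symm

theorem exists_isImpulsiveSolution [CompleteSpace E] {K : ℝ≥0} (hf : ∀ s, LipschitzWith K (f s))
    (hc : ∀ y, Continuous fun s => f s y) (R : ℕ → E → E) (h0 : 0 ≤ t 0) (ht : StrictMono t)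
    (hub : ∀ s, ∃ k, s ≤ t k) (x₀ : E) : ∃ x, IsImpulsiveSolution f R t x ∧ x 0 = x₀ := by
  obtain ⟨G, hG₀, hR, hG⟩ := exists_sampled_flows hf hc R t x₀
  obtain ⟨x, hx0, hxG⟩ := exists_eqOn_Ioc_of_monotone (monotone_switchTime h0 ht.monotone) G
  exact ⟨x, isImpulsiveSolution_of_eqOn_Ioc h0 ht hub hG hR hx0 hxG, hx0.trans hG₀⟩

end Impulsive

theorem exists_isTrajectory {nz nw ny ns nq np : ℕ} {P : Plant nz nw ny ns nq np} {T₁ T₂ : ℝ}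
    {t : ℕ → ℝ} {w : ℝ → Eu nw} (L : Matrix (Fin nz) (Fin ny) ℝ) (H : Matrix (Fin ny) (Fin ny) ℝ)
    (hψ : IsLip P.ψ) (ht : IsSamplingSeq T₁ T₂ t) (hT₁ : 0 < T₁) (η : ℝ → Eu ny)
    (hw : IsLocBddInput w) (z₀ zh₀ : Eu nz) (θ₀ : Eu ny) :
    ∃ z zh θ, P.IsTrajectory L H t w η z zh θ ∧ z 0 = z₀ ∧ zh 0 = zh₀ ∧ θ 0 = θ₀ := by
  obtain ⟨z, hz₀, hz_ac, hz_ode⟩ := exists_plant_trajectory hψ hw z₀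
  obtain ⟨K, hK⟩ : IsLip fun x : Eu nz × Eu ny =>
      (mulE P.A x.1 + mulE P.B (P.ψ (mulE P.S x.1)) + mulE L x.2, mulE H x.2) :=
    (((IsLip.mulE P.A .fst).add (.mulE P.B (hψ.comp (.mulE P.S .fst)))).add
      (.mulE L .snd)).prodMk (.mulE H .snd)
  obtain ⟨x, hx, hx₀⟩ := exists_isImpulsiveSolution (fun _ : ℝ => hK) (fun _ => continuous_const)
    (fun k x => (x.1, mulE P.C (z (t k)) + η (t k) - mulE P.C x.1)) ht.1 (ht.strictMono hT₁)
    (ht.exists_le hT₁) (zh₀, θ₀)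
  refine ⟨z, fun s => (x s).1, fun s => (x s).2, ⟨hz_ac, hz_ode, ?_, ?_, ?_, ?_, ?_, ?_⟩, hz₀,
    congrArg Prod.fst hx₀, congrArg Prod.snd hx₀⟩
  · exact hx.continuousOn_comp continuous_fst fun _ _ => rfl
  · exact fun s hs hst => (hx.hasDerivAt s hs hst).fst
  · exact fun s hs hst => (hx.hasDerivAt s hs hst).snd
  · exact fun h0 => (hx.continuousWithinAt_zero h0).snd
  · exact fun k hk => (hx.continuousWithinAt_Iic k hk).snd
  · exact fun k => (continuous_snd.tendsto _).comp (hx.tendsto_reset k)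

end Plant

theorem theorem1 {nz nw ny ns nq np : ℕ} (P : Plant nz nw ny ns nq np)
    (L : Matrix (Fin nz) (Fin ny) ℝ) (H : Matrix (Fin ny) (Fin ny) ℝ)
    (ℓ T₁ T₂ lt γ : ℝ) (hℓ : 0 < ℓ)
    (hψ : ∀ v₁ v₂, ‖P.ψ v₁ - P.ψ v₂‖ ≤ ℓ * ‖v₁ - v₂‖)
    (hT₁ : 0 < T₁) (hT : T₁ ≤ T₂) (hlt : 0 < lt) (hγ : 0 < γ)
    (hA : P.DissipationAssumption L H T₂ lt γ) :
    (P.errSystem L H T₁ T₂).IsEISS (Plant.errSet nz ny T₂) ∧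
    (∃ α : ℝ, 0 < α ∧ ∀ E φ u, (P.errSystem L H T₁ T₂).IsSolutionPair E φ u →
      (∀ t j, (t, j) ∈ E → (u t j).snd = 0) →
      (∫⁻ s in domT E, ‖mulE P.Cp (φ s (jmin E s)).ε‖ₑ ^ 2) ^ (1 / 2 : ℝ) ≤
        ENNReal.ofReal (α * Metric.infDist (φ 0 0) (Plant.errSet nz ny T₂)) +
          ENNReal.ofReal γ * (∫⁻ s in domT E, ‖(u s (jmin E s)).fst‖ₑ ^ 2) ^ (1 / 2 : ℝ)) ∧
    P.SolvesEstimationProblem L H T₁ T₂ lt γ := by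
  obtain ⟨V, a, b, hV⟩ := hA.exists_isLyapunov
  have hψ' : IsLip P.ψ := Plant.isLip_psi hℓ.le hψ
  have hb := hV.b_pos
  exact ⟨⟨Plant.isPreEISS hV hT₁ hT hlt,
      fun E φ u h => Plant.isCompleteDom_of_isMaximalPair hψ' hT₁ hT h⟩,
    ⟨√b, by positivity, fun E φ u hsol hη => Plant.l2_gain_errSystem hV hsol hT₁ hT hlt hγ hη⟩,
    ⟨fun t ht w η hw z₀ zh₀ θ₀ => Plant.exists_isTrajectory L H hψ' ht hT₁ η hw z₀ zh₀ θ₀,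
      Plant.exp_stable_of_isLyapunov hV hψ'.continuous hT₁ hT hlt,
      Plant.bounded_of_isLyapunov hV hψ'.continuous hT₁ hT hlt,
      Plant.l2_gain_of_isLyapunov hV hψ'.continuous hT₁ hT hlt hγ⟩⟩
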